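/- Let $k$ be a field of characteristic $0$ and let $L=\bigoplus_{i\in\mathbb Z}L^i$ be a dg Lie algebra over $k$ with differential $d$ of degree $+1$. Let $L=F_0L\supseteq F_1L\supseteq F_2L\supseteq\cdots$ be a decreasing filtration by graded subspaces with $dF_p\subseteq F_p$ and $[F_p,F_q]\subseteq F_{p+q}$, and assume that $L$ is $L^0$-complete with respect to it: $L^0\subseteq F_1L$, and $L^i\to\varprojlim_p L^i/(F_pL\cap L^i)$ is bijective for every $i$. *The moduli set.* Let $V_L=\{p\in L^1 : dp+\tfrac12[p,p]=0\}$. Let $\exp L^0$ act on $V_L$ by $p\mapsto(\exp b)(d+p)-d$ for $b\in L^0$, where $\exp b=\sum_n \frac1{n!}(\mathrm{ad}\,b)^n$ is computed in $L\oplus k\,d$ with $[b,d]=-db$, and put $M_L=V_L/\exp L^0$. *The coalgebra $\hat C(L)$.* Let $sL$ be the suspension, $(sL)^i=L^{i+1}$, and let $T^c(sL)=\bigoplus_n (sL)^{\otimes n}$ have the deconcatenation coproduct. Let $G_m\subseteq T^c(sL)$ be spanned by the tensors $sx_1\otimes\cdots\otimes sx_n$ such that $n\ge m$, or $x_i\in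 F_{p_i}L$ with $\sum p_i\ge m$ (if $F_1L=L$, the second condition alone gives the same span), and let $\hat T^c(sL)=\varprojlim_m T^c(sL)/G_m$. Then $\hat C(L)\subseteq \hat T^c(sL)$ is the completion of the sub-coalgebra $C(L)$ of graded symmetric tensors, with the extension by continuity of the coproduct and of the coderivation determined by $sx\mapsto -s(dx)$ and $sx\otimes sy+(-1)^{|sx||sy|}sy\otimes sx\mapsto(-1)^{|x|}s[x,y]$. Let $\pi$ denote the projection to the tensors of length one. *Filtered maps and homotopies.* Let $J$ be the unit interval coalgebra: its elements are the formal series $\sum a_it_i+\sum b_i\,t_iu$ with $a_i,b_i\in k$, where $t_i$ has degree $0$ and $t_iu$ has degree $-1$, $\Delta t_n=\sum_{i+j=n}t_i\otimes t_j$, $\Delta(t_nu)=\sum_{i+j=n}(t_iu\otimes t_j+t_i\otimes t_ju)$, $d(t_nu)=(n+1)t_{n+1}$, $dt_n=0$, the counit takes the coefficient $a_0$, and $F_pJ$ consists of the series in the $t_i,t_iu$ with $i\ge p$. The field $k$ is a coalgebra in degree $0$ with $\Delta 1=1\otimes1$, $F_0k=k$ and $F_1k=0$. For $C=k$ or $C=J$,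 a filtered map $f:C\to\hat C(L)$ is a linear map of degree $0$ that preserves filtrations ($\hat C(L)$ being filtered by the kernels of the projections to $T^c(sL)/G_m$), is compatible with differentials, counits and coproducts (with values in completed tensor products), and is such that $\pi f$ maps $F_pC$ to $F_pL$ for all $p$. Two filtered maps $f,g:k\to\hat C(L)$ are filtered homotopic if there is a filtered map $h:J\to\hat C(L)$ with $h(t_0)=f(1)$ and $h\bigl(\sum_i t_i\bigr)=g(1)$. **Theorem.** Lying in the same $\exp L^0$-orbit (that is, $q=(\exp b)(d+p)-d$ for some $b\in L^0$) is an equivalence relation on $V_L$, filtered homotopy is an equivalence relation on the set of filtered maps $k\to\hat C(L)$, and there is a bijection from $M_L$ onto the set of filtered homotopy classes of filtered maps $k\to\hat C(L)$. It sends the class of $p\in V_L$ to the class of the classifying map $\chi(p)$, the filtered map with $\chi(p)(1)=1+sp+sp\otimes sp+\cdots$. -/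

import Mathlib

open scoped TensorProduct

noncomputable section

namespace HomotopyModuli

universe u v w

/-! ### Decreasing filtrations, completions, completed tensor products -/

/-- A decreasing filtration of a vector space, indexed by the natural numbers. -/
structure Filtration (k : Type u) (M : Type v) [Field k] [AddCommGroup M] [Module k M] where
  /-- The subspaces `F_p`. -/
  F : ℕ → Submodule k M
  anti : Antitone F

section Completion

variable {k : Type u} [Field k]
variable {M : Type v} [AddCommGroup M] [Module k M]
variable {N : Type w} [AddCommGroup N] [Module k N]

/-- The completion `lim_p M / F_p`, as a subspace of the product of all the `M / F_p`. -/
def completion (A : Filtration k M) : Submodule k ((p : ℕ) → M ⧸ A.F p) where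
  carrier := {x | ∀ p q (h : p ≤ q), Submodule.factor (A.anti h) (x q) = x p}
  add_mem' := by
    intro x y hx hy p q h
    simp [hx p q h, hy p q h]
  zero_mem' := by
    intro p q h
    simp
  smul_mem' := by
    intro c x hx p q h
    simp [hx p q h]

/-- The filtration of the completion by the kernels of the projections to `M / F_p`. -/
def completionFiltration (A : Filtration k M) : Filtration k (completion A) where
  F p := LinearMap.ker ((LinearMap.proj p).comp (completion A).subtype)
  anti := by
    intro p q h x hx
    have h1 : x.1 q = 0 := hx
    have h2 := x.2 p q h
    rw [h1, map_zero] at h2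
    exact h2.symm

/-- The canonical map of `M` to its completion. -/
def toCompletion (A : Filtration k M) : M →ₗ[k] completion A where
  toFun m := ⟨fun p => (A.F p).mkQ m, fun p q h => Submodule.factor_mk (A.anti h) m⟩
  map_add' := by
    intro x y
    ext p
    simp
  map_smul' := by
    intro c x
    ext p
    simp

/-- The map of completions induced by a linear map `f` with `f (F_{p+s} M) ⊆ F_p N` for all `p`. -/
def completionMap (A : Filtration k M) (B : Filtration k N) (f : M →ₗ[k] N) (s : ℕ)
    (h : ∀ p, A.F (p + s) ≤ (B.F p).comap f) : completion A →ₗ[k] completion B where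
  toFun x := ⟨fun p => Submodule.mapQ _ _ f (h p) (x.1 (p + s)), by
    intro p q hpq
    have h2 := x.2 (p + s) (q + s) (by omega)
    obtain ⟨m, hm⟩ := Submodule.mkQ_surjective _ (x.1 (q + s))
    have h3 : Submodule.mkQ _ m = x.1 (p + s) := by
      rw [← h2, ← hm]
      rfl
    change Submodule.factor (B.anti hpq) (Submodule.mapQ _ _ f (h q) (x.1 (q + s)))
      = Submodule.mapQ _ _ f (h p) (x.1 (p + s))
    rw [← hm, ← h3]
    rfl⟩
  map_add' := by
    intro x y
    ext p
    simp
  map_smul' := by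
    intro c x
    ext p
    simp

/-- The filtration `F_n (M ⊗ N) = ∑_{p + q ≥ n} F_p M ⊗ F_q N` of a tensor product. -/
def tensorFiltration (A : Filtration k M) (B : Filtration k N) : Filtration k (M ⊗[k] N) where
  F n := Submodule.span k {z | ∃ p q : ℕ, n ≤ p + q ∧ ∃ x ∈ A.F p, ∃ y ∈ B.F q, z = x ⊗ₜ[k] y}
  anti := by
    intro m n h
    apply Submodule.span_mono
    rintro z ⟨p, q, hpq, hz⟩
    exact ⟨p, q, h.trans hpq, hz⟩

/-- The completed tensor product `M ⊗̂ N`. -/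
abbrev completedTensor (A : Filtration k M) (B : Filtration k N) :
    Submodule k ((n : ℕ) → (M ⊗[k] N) ⧸ (tensorFiltration A B).F n) :=
  completion (tensorFiltration A B)

theorem tensorFiltration_map {M' : Type*} {N' : Type*} [AddCommGroup M'] [Module k M']
    [AddCommGroup N'] [Module k N']
    (A : Filtration k M) (B : Filtration k N) (A' : Filtration k M') (B' : Filtration k N')
    (f : M →ₗ[k] M') (g : N →ₗ[k] N') (hf : ∀ p, A.F p ≤ (A'.F p).comap f)
    (hg : ∀ p, B.F p ≤ (B'.F p).comap g) (n : ℕ) :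
    (tensorFiltration A B).F n ≤
      ((tensorFiltration A' B').F n).comap (TensorProduct.map f g) := by
  refine Submodule.span_le.2 ?_
  rintro z ⟨p, q, hpq, x, hx, y, hy, rfl⟩
  exact Submodule.subset_span ⟨p, q, hpq, f x, hf p hx, g y, hg q hy, by simp⟩

/-- The map `f ⊗̂ f` of completed tensor squares induced by a filtration preserving `f`. -/
def completedSquare (A : Filtration k M) (B : Filtration k N) (f : M →ₗ[k] N)
    (hf : ∀ p, A.F p ≤ (B.F p).comap f) : completedTensor A A →ₗ[k] completedTensor B B :=
  completionMap _ _ (TensorProduct.map f f) 0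
    (fun n => tensorFiltration_map A A B B f f hf hf n)

end Completion

/-! ### Filtered differential graded coalgebras and their maps -/

/-- The data of a filtered counital dg coalgebra with coproduct `Δ : X → X ⊗̂ X`.  It is used only
for the concrete coalgebras built below. -/
structure DGCoalgebraData (k : Type u) (X : Type v) [Field k] [AddCommGroup X] [Module k X] where
  deg : ℤ → Submodule k X
  fil : Filtration k X
  d : X →ₗ[k] X
  counit : X →ₗ[k] k
  comul : X →ₗ[k] completedTensor fil fil

/-- A map of filtered dg coalgebras: linear, of degree zero, filtration preserving, and compatible
with differentials, counits and coproducts. -/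
structure DGCoalgebraMap {k : Type u} {X : Type v} {Y : Type w} [Field k] [AddCommGroup X]
    [Module k X] [AddCommGroup Y] [Module k Y] (C : DGCoalgebraData k X) (D : DGCoalgebraData k Y)
    where
  toLin : X →ₗ[k] Y
  map_deg : ∀ i, ∀ x ∈ C.deg i, toLin x ∈ D.deg i
  map_fil : ∀ p, C.fil.F p ≤ (D.fil.F p).comap toLin
  map_d : ∀ x, toLin (C.d x) = D.d (toLin x)
  map_counit : ∀ x, D.counit (toLin x) = C.counit x
  map_comul : ∀ x, completedSquare C.fil D.fil toLin map_fil (C.comul x) = D.comul (toLin x)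

section Domains

variable (k : Type u) [Field k]

/-- The filtration of the ground field with `F_0 = k` and `F_p = 0` for `p > 0`. -/
def pointFiltration : Filtration k k where
  F p := if p = 0 then ⊤ else ⊥
  anti := by
    intro p q h
    by_cases hq : q = 0
    · have hp : p = 0 := by omega
      simp [hp, hq]
    · simp [hq]

/-- The ground field as a coalgebra (the "point"): degree zero, `d = 0`, `Δ 1 = 1 ⊗ 1`. -/
def point : DGCoalgebraData k k where
  deg i := if i = 0 then ⊤ else ⊥
  fil := pointFiltration k
  d := 0
  counit := LinearMap.id
  comul := (toCompletion _).comp (TensorProduct.mk k k k 1)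

/-- The space underlying the unit interval coalgebra `J`: the pair `(a, b)` stands for the formal
series `∑ a_i t_i + ∑ b_i t_i u`. -/
abbrev IntervalSpace : Type u := (ℕ → k) × (ℕ → k)

variable {k}

/-- The element `t_i` of `J`. -/
def tElt (i : ℕ) : IntervalSpace k := (Pi.single i 1, 0)

/-- The element `t_i u` of `J`. -/
def tuElt (i : ℕ) : IntervalSpace k := (0, Pi.single i 1)

variable (k)

/-- `F_p J` consists of the series in the `t_i` and `t_i u` with `i ≥ p`. -/
def intervalFiltration : Filtration k (IntervalSpace k) where
  F p :=
    { carrier := {x | ∀ i < p, x.1 i = 0 ∧ x.2 i = 0}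
      add_mem' := by
        intro x y hx hy i hi
        simp [hx i hi, hy i hi]
      zero_mem' := by
        intro i hi
        simp
      smul_mem' := by
        intro c x hx i hi
        simp [hx i hi] }
  anti := by
    intro p q h x hx i hi
    exact hx i (lt_of_lt_of_le hi h)

variable {k}

theorem tElt_mem (i : ℕ) : tElt i ∈ (intervalFiltration k).F i := by
  intro j hj
  simp [tElt, hj.ne]

theorem tuElt_mem (i : ℕ) : tuElt i ∈ (intervalFiltration k).F i := by
  intro j hj
  simp [tuElt, hj.ne]

/-- For `x = ∑ a_n t_n + ∑ b_n t_n u`, the degree `n` part of `Δ x`, given by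
`Δ t_n = ∑_{i + j = n} t_i ⊗ t_j` and
`Δ (t_n u) = ∑_{i + j = n} (t_i u ⊗ t_j + t_i ⊗ t_j u)`. -/
def intervalComulTerm (n : ℕ) : IntervalSpace k →ₗ[k] IntervalSpace k ⊗[k] IntervalSpace k where
  toFun x := ∑ ij ∈ Finset.HasAntidiagonal.antidiagonal n,
    (x.1 n • (tElt ij.1 ⊗ₜ[k] tElt ij.2) +
      x.2 n • (tuElt ij.1 ⊗ₜ[k] tElt ij.2 + tElt ij.1 ⊗ₜ[k] tuElt ij.2))
  map_add' := by
    intro x y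
    rw [← Finset.sum_add_distrib]
    refine Finset.sum_congr rfl fun ij _ => ?_
    simp only [Prod.fst_add, Prod.snd_add, Pi.add_apply, add_smul]
    abel
  map_smul' := by
    intro c x
    rw [RingHom.id_apply, Finset.smul_sum]
    refine Finset.sum_congr rfl fun ij _ => ?_
    simp only [Prod.smul_fst, Prod.smul_snd, Pi.smul_apply, smul_add, smul_smul, smul_eq_mul]

theorem intervalComulTerm_mem (n : ℕ) (x : IntervalSpace k) :
    intervalComulTerm n x ∈
      (tensorFiltration (intervalFiltration k) (intervalFiltration k)).F n := by
  rw [intervalComulTerm, LinearMap.coe_mk, AddHom.coe_mk]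
  refine Submodule.sum_mem _ fun ij hij => ?_
  have hn : n ≤ ij.1 + ij.2 := (Finset.HasAntidiagonal.mem_antidiagonal.1 hij).ge
  refine Submodule.add_mem _ (Submodule.smul_mem _ _ ?_) (Submodule.smul_mem _ _
    (Submodule.add_mem _ ?_ ?_))
  · exact Submodule.subset_span ⟨_, _, hn, _, tElt_mem _, _, tElt_mem _, rfl⟩
  · exact Submodule.subset_span ⟨_, _, hn, _, tuElt_mem _, _, tElt_mem _, rfl⟩
  · exact Submodule.subset_span ⟨_, _, hn, _, tElt_mem _, _, tuElt_mem _, rfl⟩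

/-- The coproduct `Δ : J → J ⊗̂ J`. -/
def intervalComul : IntervalSpace k →ₗ[k]
    completedTensor (intervalFiltration k) (intervalFiltration k) where
  toFun x := ⟨fun p => Submodule.mkQ _ (∑ n ∈ Finset.range p, intervalComulTerm n x), by
    intro p q h
    rw [Submodule.factor_mk, ← sub_eq_zero, ← map_sub, Submodule.mkQ_apply,
      Submodule.Quotient.mk_eq_zero, ← Finset.sum_range_add_sum_Ico _ h, add_sub_cancel_left]
    refine Submodule.sum_mem _ fun n hn => ?_
    exact (tensorFiltration _ _).anti (Finset.mem_Ico.1 hn).1 (intervalComulTerm_mem n x)⟩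
  map_add' := by
    intro x y
    ext p
    simp only [map_add, Finset.sum_add_distrib]
    rfl
  map_smul' := by
    intro c x
    ext p
    simp only [map_smul, ← Finset.smul_sum]
    rfl

variable (k)

/-- The unit interval coalgebra `J`, with `t_i` in degree `0`, `t_i u` in degree `-1` and
`d (t_i u) = (i + 1) t_{i+1}`; it is the completed dual of the algebra `k[t, dt]`. -/
def interval : DGCoalgebraData k (IntervalSpace k) where
  deg i := if i = 0 then LinearMap.ker (LinearMap.snd k (ℕ → k) (ℕ → k))
    else if i = -1 then LinearMap.ker (LinearMap.fst k (ℕ → k) (ℕ → k)) else ⊥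
  fil := intervalFiltration k
  d :=
    { toFun := fun x => (fun n => (n : k) * x.2 (n - 1), 0)
      map_add' := by
        intro x y
        ext n <;> simp [mul_add]
      map_smul' := by
        intro c x
        ext n <;> simp [mul_left_comm] }
  counit := (LinearMap.proj 0).comp (LinearMap.fst k (ℕ → k) (ℕ → k))
  comul := intervalComul

end Domains

/-! ### Complete dg Lie algebras -/

/-- A `ℤ`-graded dg Lie algebra over `k`, with differential of degree `+1`. -/
structure DGLieAlgebra (k : Type u) (L : Type v) [Field k] [AddCommGroup L] [Module k L] where
  deg : ℤ → Submodule k L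
  isInternal : DirectSum.IsInternal deg
  bracket : L →ₗ[k] L →ₗ[k] L
  d : L →ₗ[k] L
  bracket_mem : ∀ i j, ∀ x ∈ deg i, ∀ y ∈ deg j, bracket x y ∈ deg (i + j)
  bracket_skew : ∀ i j, ∀ x ∈ deg i, ∀ y ∈ deg j,
    bracket x y = -((i * j).negOnePow • bracket y x)
  jacobi : ∀ i j, ∀ x ∈ deg i, ∀ y ∈ deg j, ∀ z,
    bracket x (bracket y z) = bracket (bracket x y) z + (i * j).negOnePow • bracket y (bracket x z)
  d_mem : ∀ i, ∀ x ∈ deg i, d x ∈ deg (i + 1)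
  d_d : ∀ x, d (d x) = 0
  leibniz : ∀ i, ∀ x ∈ deg i, ∀ y, d (bracket x y) = bracket (d x) y + i.negOnePow • bracket x (d y)

section Grading

variable {k : Type u} [Field k] {L : Type v} [AddCommGroup L] [Module k L]

/-- The decomposition of `L` as the direct sum of its homogeneous parts. -/
def DGLieAlgebra.decompose (A : DGLieAlgebra k L) : L ≃ₗ[k] DirectSum ℤ (fun i => A.deg i) :=
  (LinearEquiv.ofBijective (DirectSum.coeLinearMap A.deg) A.isInternal).symm

/-- The operator `x ↦ (-1)^|x| x`. -/
def DGLieAlgebra.parity (A : DGLieAlgebra k L) : L →ₗ[k] L :=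
  (DirectSum.toModule k ℤ L (fun i => (i.negOnePow : ℤ) • (A.deg i).subtype)).comp
    A.decompose.toLinearMap

end Grading

/-- A decreasing dg Lie filtration `L = F_0 ⊇ F_1 ⊇ ...` of `L` for which `L` is `L^0`-complete:
`L^0` has positive filtration (so bracketing with `L^0` raises the filtration), and every `L^i` is
complete, that is, `L^i → lim_p L^i / F_p L^i` is bijective. -/
structure CompleteFiltration {k : Type u} {L : Type v} [Field k] [AddCommGroup L] [Module k L]
    (A : DGLieAlgebra k L) extends Filtration k L where
  F_zero : F 0 = ⊤
  homogeneous : ∀ p, ∀ x ∈ F p, ∀ i, (A.decompose x i : L) ∈ F p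
  d_mem : ∀ p, ∀ x ∈ F p, A.d x ∈ F p
  bracket_mem : ∀ p q, ∀ x ∈ F p, ∀ y ∈ F q, A.bracket x y ∈ F (p + q)
  deg_zero_le : A.deg 0 ≤ F 1
  separated : ∀ i, ∀ x ∈ A.deg i, (∀ p, x ∈ F p) → x = 0
  complete : ∀ i, ∀ x : ℕ → L, (∀ p, x p ∈ A.deg i) → (∀ p, x (p + 1) - x p ∈ F p) →
    ∃ y ∈ A.deg i, ∀ p, y - x p ∈ F p

/-! ### The moduli set `M_L = V_L / exp L^0` -/

section Moduli

variable {k : Type u} [Field k] {L : Type v} [AddCommGroup L] [Module k L]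

/-- The set `V_L` of Maurer-Cartan elements: `p ∈ L^1` with `d p + 1/2 [p, p] = 0`. -/
def MaurerCartan (A : DGLieAlgebra k L) : Type v :=
  {p : L // p ∈ A.deg 1 ∧ A.d p + (2 : k)⁻¹ • A.bracket p p = 0}

/-- For `b ∈ L^0`, the operator `ad b` on `L[d] = L ⊕ k d`, where `(x, c)` stands for `x + c d`:
since `[b, d] = -[d, b] = - d b`, it sends `x + c d` to `[b, x] - c (d b)`. -/
def adIncorporated (A : DGLieAlgebra k L) (b : L) : L × k →ₗ[k] L × k where
  toFun z := (A.bracket b z.1 - z.2 • A.d b, 0)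
  map_add' := by
    intro x y
    ext
    · simp only [Prod.fst_add, Prod.snd_add, map_add, add_smul]
      abel
    · simp
  map_smul' := by
    intro c x
    ext
    · simp [smul_sub, smul_smul]
    · simp

/-- The `n`-th partial sum of `(exp b) (d + p)` in `L[d]`. -/
def expPartialSum (A : DGLieAlgebra k L) (b p : L) (n : ℕ) : L × k :=
  ∑ i ∈ Finset.range n, ((i.factorial : k)⁻¹) • ((adIncorporated A b) ^ i) (p, 1)

variable {A : DGLieAlgebra k L}

/-- `(exp b) (d + p) - d = q`, the series being taken in the topology of the filtration. -/
def GaugeAct (F : CompleteFiltration A) (b p q : L) : Prop :=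
  ∀ m, ∃ n₀, ∀ n ≥ n₀, (expPartialSum A b p n).2 = 1 ∧ (expPartialSum A b p n).1 - q ∈ F.F m

/-- Two Maurer-Cartan elements are in the same orbit of `exp L^0`. -/
def GaugeEquivalent (F : CompleteFiltration A) (p q : MaurerCartan A) : Prop :=
  ∃ b ∈ A.deg 0, GaugeAct F b p.1 q.1

/-- The moduli set `M_L = V_L / exp L^0`. -/
def ModuliSet (F : CompleteFiltration A) : Type v := Quot (GaugeEquivalent F)

end Moduli

/-! ### The tensor coalgebra on `sL`

The underlying space of the suspension `sL` is `L`, an element of `L^i` having degree `i - 1` in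
`sL`.  The space underlying the tensor coalgebra is `TensorAlgebra k L`; its concatenation product
is only used to write tensors down. -/

section Tensor

variable {k : Type u} [Field k] {L : Type v} [AddCommGroup L] [Module k L]

/-- The tensor `x_1 ⊗ ... ⊗ x_n`. -/
def word (l : List L) : TensorAlgebra k L := (l.map (TensorAlgebra.ι k)).prod

variable (k L)

/-- An auxiliary recursion for the deconcatenation, which satisfies
`Δ (x ⊗ w) = 1 ⊗ (x ⊗ w) + (x ⊗ 1) Δ w`. -/
def deconcatenationStep :
    L →ₗ[k] Module.End k (TensorAlgebra k L × (TensorAlgebra k L ⊗[k] TensorAlgebra k L)) where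
  toFun x :=
    { toFun := fun z => (TensorAlgebra.ι k x * z.1,
        1 ⊗ₜ[k] (TensorAlgebra.ι k x * z.1) + (TensorAlgebra.ι k x ⊗ₜ[k] 1) * z.2)
      map_add' := by
        intro y z
        ext
        · simp [mul_add]
        · simp only [Prod.fst_add, Prod.snd_add, mul_add, TensorProduct.tmul_add]
          abel
      map_smul' := by
        intro c z
        ext <;> simp }
  map_add' := by
    intro x y
    refine LinearMap.ext fun z => ?_
    ext
    · simp [add_mul]
    · simp only [map_add, add_mul, TensorProduct.tmul_add, TensorProduct.add_tmul,
        LinearMap.coe_mk, AddHom.coe_mk, LinearMap.add_apply, Prod.snd_add]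
      abel
  map_smul' := by
    intro c x
    refine LinearMap.ext fun z => ?_
    ext
    · simp
    · simp [← TensorProduct.smul_tmul']

/-- The deconcatenation coproduct
`Δ (x_1 ⊗ ... ⊗ x_n) = ∑ (x_1 ⊗ ... ⊗ x_p) ⊗ (x_{p+1} ⊗ ... ⊗ x_n)`. -/
def deconcatenation : TensorAlgebra k L →ₗ[k] TensorAlgebra k L ⊗[k] TensorAlgebra k L where
  toFun t := (TensorAlgebra.lift k (deconcatenationStep k L) t (1, 1 ⊗ₜ[k] 1)).2
  map_add' := by
    intro x y
    simp
  map_smul' := by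
    intro c x
    simp

variable {k L}

theorem deconcatenation_one : deconcatenation k L 1 = 1 ⊗ₜ[k] 1 := by
  simp [deconcatenation]

theorem lift_deconcatenationStep_fst (t : TensorAlgebra k L) (a : TensorAlgebra k L)
    (b : TensorAlgebra k L ⊗[k] TensorAlgebra k L) :
    (TensorAlgebra.lift k (deconcatenationStep k L) t (a, b)).1 = t * a := by
  induction t using TensorAlgebra.induction generalizing a b with
  | algebraMap r => simp [Algebra.smul_def]
  | ι x => simp [deconcatenationStep]
  | mul x y hx hy =>
    rw [map_mul, Module.End.mul_apply, mul_assoc, ← hy a b]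
    exact hx _ _
  | add x y hx hy => simp [hx, hy, add_mul]

theorem deconcatenation_ι_mul (x : L) (t : TensorAlgebra k L) :
    deconcatenation k L (TensorAlgebra.ι k x * t) =
      1 ⊗ₜ[k] (TensorAlgebra.ι k x * t) + (TensorAlgebra.ι k x ⊗ₜ[k] 1) * deconcatenation k L t := by
  have h := lift_deconcatenationStep_fst (k := k) t 1 (1 ⊗ₜ[k] 1)
  rw [mul_one] at h
  change (TensorAlgebra.lift k (deconcatenationStep k L) (TensorAlgebra.ι k x * t)
    (1, 1 ⊗ₜ[k] 1)).2 = _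
  rw [map_mul, Module.End.mul_apply, TensorAlgebra.lift_ι_apply]
  change 1 ⊗ₜ[k] (TensorAlgebra.ι k x *
    (TensorAlgebra.lift k (deconcatenationStep k L) t (1, 1 ⊗ₜ[k] 1)).1) + _ = _
  rw [h]
  rfl

variable (k L)

/-- The projection `π` of the tensor coalgebra to the tensors of length one. -/
def cogenerator : TensorAlgebra k L →ₗ[k] L := TensorAlgebra.ιInv

/-- The projection to the tensors of length two. -/
def lengthTwo : TensorAlgebra k L →ₗ[k] L ⊗[k] L :=
  (TensorProduct.map (cogenerator k L) (cogenerator k L)).comp (deconcatenation k L)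

/-- The iterated deconcatenation, with values in `T ⊗ (T ⊗ T)`. -/
def deconcatenation₃ : TensorAlgebra k L →ₗ[k]
    TensorAlgebra k L ⊗[k] (TensorAlgebra k L ⊗[k] TensorAlgebra k L) :=
  (TensorProduct.map LinearMap.id (deconcatenation k L)).comp (deconcatenation k L)

variable {k L}

/-- The operator `sx ↦ (-1)^|sx| sx` on `sL`. -/
def suspendedParity (A : DGLieAlgebra k L) : L →ₗ[k] L := -A.parity

/-- The operator `w ↦ (-1)^|w| w` on the tensor coalgebra of `sL`. -/
def tensorParity (A : DGLieAlgebra k L) : TensorAlgebra k L →ₗ[k] TensorAlgebra k L :=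
  (TensorAlgebra.lift k ((TensorAlgebra.ι k).comp (suspendedParity A))).toLinearMap

/-- The linear map cogenerating the differential: it is `sx ↦ - s(dx)` on tensors of length one,
`sx ⊗ sy ↦ 1/2 (-1)^|x| s[x, y]` on tensors of length two (so that
`sx ⊗ sy + (-1)^{|sx||sy|} sy ⊗ sx ↦ (-1)^|x| s[x, y]`), and zero on all other lengths. -/
def cogeneratingMap (A : DGLieAlgebra k L) : TensorAlgebra k L →ₗ[k] L :=
  (2 : k)⁻¹ • (TensorProduct.lift (A.bracket.comp A.parity)).comp (lengthTwo k L)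
    - A.d.comp (cogenerator k L)

/-- The coderivation of degree one of the tensor coalgebra cogenerated by `cogeneratingMap`:
`w ↦ ∑ (-1)^|w₁| w₁ ⊗ γ(w₂) ⊗ w₃` over all decompositions `w = w₁ ⊗ w₂ ⊗ w₃`. -/
def coderivation (A : DGLieAlgebra k L) : TensorAlgebra k L →ₗ[k] TensorAlgebra k L :=
  (LinearMap.mul' k (TensorAlgebra k L)).comp
    ((TensorProduct.map (tensorParity A)
      ((LinearMap.mul' k (TensorAlgebra k L)).comp
        (TensorProduct.map ((TensorAlgebra.ι k).comp (cogeneratingMap A)) LinearMap.id))).comp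
      (deconcatenation₃ k L))

/-- The signed exchange `sx ⊗ sy ↦ (-1)^{|sx||sy|} sy ⊗ sx`, written by means of the operator `ε` of
`suspendedParity` as the plain exchange composed with
`1/2 (1 ⊗ 1 + ε ⊗ 1 + 1 ⊗ ε - ε ⊗ ε)`. -/
def signedSwap (A : DGLieAlgebra k L) : L ⊗[k] L →ₗ[k] L ⊗[k] L :=
  (TensorProduct.comm k L L).toLinearMap.comp
    ((2 : k)⁻¹ • (LinearMap.id
      + TensorProduct.map (suspendedParity A) LinearMap.id
      + TensorProduct.map LinearMap.id (suspendedParity A)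
      - TensorProduct.map (suspendedParity A) (suspendedParity A)))

/-- The map that sends a tensor to the family of all its decompositions
`w₁ ⊗ (x ⊗ y) ⊗ w₂` with `x, y` of length one. -/
def adjacentPairs (k : Type u) [Field k] (L : Type v) [AddCommGroup L] [Module k L] :
    TensorAlgebra k L →ₗ[k] TensorAlgebra k L ⊗[k] ((L ⊗[k] L) ⊗[k] TensorAlgebra k L) :=
  (TensorProduct.map LinearMap.id (TensorProduct.map (lengthTwo k L) LinearMap.id)).comp
    (deconcatenation₃ k L)

/-- The subspace `S^c(sL)` of graded symmetric tensors: those invariant under all signed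
permutations, that is, under the signed exchange of any two adjacent factors. -/
def symmetricTensors (A : DGLieAlgebra k L) : Submodule k (TensorAlgebra k L) :=
  LinearMap.ker ((TensorProduct.map LinearMap.id
    (TensorProduct.map (signedSwap A) LinearMap.id)).comp (adjacentPairs k L) - adjacentPairs k L)

/-- The tensors of degree `m`, spanned by the `sx_1 ⊗ ... ⊗ sx_n` with `x_i` homogeneous and
`∑ (|x_i| - 1) = m`. -/
def tensorDeg (A : DGLieAlgebra k L) (m : ℤ) : Submodule k (TensorAlgebra k L) :=
  Submodule.span k {t | ∃ l : List (L × ℤ), (∀ a ∈ l, a.1 ∈ A.deg a.2) ∧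
    (l.map (fun a => a.2 - 1)).sum = m ∧ t = word (l.map Prod.fst)}

variable {A : DGLieAlgebra k L}

/-- The filtration used to complete the tensor coalgebra: `G_m` is spanned by the
`sx_1 ⊗ ... ⊗ sx_n` such that either `x_i ∈ F_{p_i}` with `∑ p_i ≥ m`, or `n ≥ m`.  If `L = F_1 L`,
the first alternative contains the second one, and this is the filtration induced by that of `L`. -/
def tensorCoalgebraFiltration (F : CompleteFiltration A) : Filtration k (TensorAlgebra k L) where
  F m := Submodule.span k {t | ∃ l : List (L × ℕ), (∀ a ∈ l, a.1 ∈ F.F a.2) ∧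
    (m ≤ (l.map Prod.snd).sum ∨ m ≤ l.length) ∧ t = word (l.map Prod.fst)}
  anti := by
    intro m n h
    apply Submodule.span_mono
    rintro t ⟨l, hl, hn, ht⟩
    exact ⟨l, hl, hn.imp h.trans h.trans, ht⟩

/-! ### Continuity of the coproduct and of the coderivation -/

theorem word_nil : word (k := k) ([] : List L) = 1 := rfl

theorem word_cons (x : L) (l : List L) :
    word (k := k) (x :: l) = TensorAlgebra.ι k x * word l := rfl

theorem word_append (l l' : List L) :
    word (k := k) (l ++ l') = word l * word l' := by
  simp [word]

theorem deconcatenation_word (l : List L) :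
    deconcatenation k L (word l) ∈ Submodule.span k
      {z | ∃ l₁ l₂ : List L, l₁ ++ l₂ = l ∧ z = word l₁ ⊗ₜ[k] word l₂} := by
  induction l with
  | nil =>
    rw [word_nil, deconcatenation_one]
    exact Submodule.subset_span ⟨[], [], rfl, rfl⟩
  | cons x l ih =>
    rw [word_cons, deconcatenation_ι_mul]
    refine Submodule.add_mem _ (Submodule.subset_span ⟨[], x :: l, rfl, rfl⟩) ?_
    have h : ∀ z ∈ Submodule.span k {z : TensorAlgebra k L ⊗[k] TensorAlgebra k L |
        ∃ l₁ l₂ : List L, l₁ ++ l₂ = l ∧ z = word l₁ ⊗ₜ[k] word l₂},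
        (TensorAlgebra.ι k x ⊗ₜ[k] 1) * z ∈ Submodule.span k
          {z : TensorAlgebra k L ⊗[k] TensorAlgebra k L |
            ∃ l₁ l₂ : List L, l₁ ++ l₂ = x :: l ∧ z = word l₁ ⊗ₜ[k] word l₂} := by
      intro z hz
      induction hz using Submodule.span_induction with
      | mem z hz =>
        obtain ⟨l₁, l₂, h, rfl⟩ := hz
        exact Submodule.subset_span ⟨x :: l₁, l₂, by simp [h], by
          simp [word_cons]⟩
      | zero => simp
      | add a b _ _ ha hb =>
        rw [mul_add]
        exact Submodule.add_mem _ ha hb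
      | smul c a _ ha =>
        rw [mul_smul_comm]
        exact Submodule.smul_mem _ c ha
    exact h _ ih

theorem deconcatenation₃_word (l : List L) :
    deconcatenation₃ k L (word l) ∈ Submodule.span k
      {z | ∃ l₁ l₂ l₃ : List L, l₁ ++ (l₂ ++ l₃) = l ∧
        z = word l₁ ⊗ₜ[k] (word l₂ ⊗ₜ[k] word l₃)} := by
  have h : ∀ z ∈ Submodule.span k {z : TensorAlgebra k L ⊗[k] TensorAlgebra k L |
      ∃ l₁ l₂ : List L, l₁ ++ l₂ = l ∧ z = word l₁ ⊗ₜ[k] word l₂},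
      TensorProduct.map LinearMap.id (deconcatenation k L) z ∈ Submodule.span k
        {z | ∃ l₁ l₂ l₃ : List L, l₁ ++ (l₂ ++ l₃) = l ∧
          z = word l₁ ⊗ₜ[k] (word l₂ ⊗ₜ[k] word l₃)} := by
    intro z hz
    induction hz using Submodule.span_induction with
    | mem z hz =>
      obtain ⟨l₁, l₂, h, rfl⟩ := hz
      rw [TensorProduct.map_tmul, LinearMap.id_apply]
      have h2 := Submodule.mem_map_of_mem 
        (f := TensorProduct.mk k (TensorAlgebra k L) (TensorAlgebra k L ⊗[k] TensorAlgebra k L)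
          (word l₁))
        (deconcatenation_word (k := k) l₂)
      rw [Submodule.map_span] at h2
      refine Submodule.span_mono (R := k) ?_ h2
      rintro _ ⟨_, ⟨l₃, l₄, h34, rfl⟩, rfl⟩
      exact ⟨l₁, l₃, l₄, by rw [h34, h], rfl⟩
    | zero => simp
    | add a b _ _ ha hb =>
      rw [map_add]
      exact Submodule.add_mem _ ha hb
    | smul c a _ ha =>
      rw [map_smul]
      exact Submodule.smul_mem _ c ha
  exact h _ (deconcatenation_word l)

theorem cogenerator_one : cogenerator k L 1 = 0 := by
  let _ : Module kᵐᵒᵖ L := Module.compHom _ ((RingHom.id k).fromOpposite mul_comm)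
  have _ : IsCentralScalar k L := ⟨fun r m => rfl⟩
  change (TensorAlgebra.toTrivSqZeroExt (1 : TensorAlgebra k L)).snd = 0
  rw [map_one, TrivSqZeroExt.snd_one]

theorem cogenerator_ι_mul (x : L) (t : TensorAlgebra k L) :
    cogenerator k L (TensorAlgebra.ι k x * t) = TensorAlgebra.algebraMapInv t • x := by
  let _ : Module kᵐᵒᵖ L := Module.compHom _ ((RingHom.id k).fromOpposite mul_comm)
  have _ : IsCentralScalar k L := ⟨fun r m => rfl⟩
  have h : (TrivSqZeroExt.fstHom k k L).comp TensorAlgebra.toTrivSqZeroExt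
      = TensorAlgebra.algebraMapInv (R := k) (M := L) := by
    apply TensorAlgebra.hom_ext
    ext y
    simp [TensorAlgebra.algebraMapInv]
  change (TensorAlgebra.toTrivSqZeroExt (TensorAlgebra.ι k x * t)).snd = _
  rw [map_mul, TensorAlgebra.toTrivSqZeroExt_ι, TrivSqZeroExt.snd_mul, TrivSqZeroExt.fst_inr,
    zero_smul, zero_add, TrivSqZeroExt.snd_inr, op_smul_eq_smul, ← h]
  rfl

theorem counit_deconcatenation_word (l : List L) :
    TensorProduct.map (TensorAlgebra.algebraMapInv (R := k) (M := L)).toLinearMap LinearMap.id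
      (deconcatenation k L (word l)) = 1 ⊗ₜ[k] word l := by
  cases l with
  | nil => simp [word_nil, deconcatenation_one]
  | cons x l =>
    rw [word_cons, deconcatenation_ι_mul, map_add]
    have h : ∀ z : TensorAlgebra k L ⊗[k] TensorAlgebra k L,
        TensorProduct.map (TensorAlgebra.algebraMapInv (R := k) (M := L)).toLinearMap LinearMap.id
          ((TensorAlgebra.ι k x ⊗ₜ[k] 1) * z) = 0 := by
      intro z
      induction z using TensorProduct.induction_on with
      | zero => simp
      | tmul a b => simp [TensorAlgebra.algebraMapInv]
      | add a b ha hb => rw [mul_add, map_add, ha, hb, add_zero]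
    rw [h]
    simp

theorem lengthTwo_word_nil : lengthTwo k L (word []) = 0 := by
  rw [word_nil, lengthTwo, LinearMap.comp_apply, deconcatenation_one]
  simp [cogenerator_one]

theorem lengthTwo_word_cons (x : L) (l : List L) :
    lengthTwo k L (word (x :: l)) = x ⊗ₜ[k] cogenerator k L (word l) := by
  rw [word_cons, lengthTwo, LinearMap.comp_apply, deconcatenation_ι_mul, map_add,
    TensorProduct.map_tmul, cogenerator_one, TensorProduct.zero_tmul, zero_add]
  have h : ∀ z : TensorAlgebra k L ⊗[k] TensorAlgebra k L,
      TensorProduct.map (cogenerator k L) (cogenerator k L) ((TensorAlgebra.ι k x ⊗ₜ[k] 1) * z) =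
        TensorProduct.map (LinearMap.toSpanSingleton k L x) (cogenerator k L)
          (TensorProduct.map (TensorAlgebra.algebraMapInv (R := k) (M := L)).toLinearMap
            LinearMap.id z) := by
    intro z
    induction z using TensorProduct.induction_on with
    | zero => simp
    | tmul a b => simp [cogenerator_ι_mul]
    | add a b ha hb => rw [mul_add, map_add, map_add, map_add, ha, hb]
  rw [h, counit_deconcatenation_word]
  simp

theorem cogenerator_word_cons_cons (x y : L) (l : List L) :
    cogenerator k L (word (x :: y :: l)) = 0 := by
  rw [word_cons, cogenerator_ι_mul, word_cons]
  simp [TensorAlgebra.algebraMapInv]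

theorem cogenerator_word_singleton (x : L) : cogenerator k L (word [x]) = x := by
  rw [word_cons, cogenerator_ι_mul, word_nil]
  simp

theorem cogeneratingMap_word_nil : cogeneratingMap A (word []) = 0 := by
  rw [cogeneratingMap, LinearMap.sub_apply, LinearMap.smul_apply, LinearMap.comp_apply,
    LinearMap.comp_apply, lengthTwo_word_nil, word_nil, cogenerator_one]
  simp

theorem cogeneratingMap_word_singleton (x : L) : cogeneratingMap A (word [x]) = -A.d x := by
  rw [cogeneratingMap, LinearMap.sub_apply, LinearMap.smul_apply, LinearMap.comp_apply,
    LinearMap.comp_apply, lengthTwo_word_cons, cogenerator_word_singleton, word_nil,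
    cogenerator_one]
  simp

theorem cogeneratingMap_word_pair (x y : L) :
    cogeneratingMap A (word [x, y]) = (2 : k)⁻¹ • A.bracket (A.parity x) y := by
  rw [cogeneratingMap, LinearMap.sub_apply, LinearMap.smul_apply, LinearMap.comp_apply,
    LinearMap.comp_apply, lengthTwo_word_cons, cogenerator_word_singleton,
    cogenerator_word_cons_cons]
  simp

theorem cogeneratingMap_word_long (x y z : L) (l : List L) :
    cogeneratingMap A (word (x :: y :: z :: l)) = 0 := by
  rw [cogeneratingMap, LinearMap.sub_apply, LinearMap.smul_apply, LinearMap.comp_apply,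
    LinearMap.comp_apply, lengthTwo_word_cons, cogenerator_word_cons_cons,
    cogenerator_word_cons_cons]
  simp

theorem parity_eq_sum (x : L) :
    A.parity x = DirectSum.toModule k ℤ L (fun i => (i.negOnePow : ℤ) • (A.deg i).subtype)
      (A.decompose x) := rfl

theorem parity_of_mem (i : ℤ) (x : L) (hx : x ∈ A.deg i) :
    A.parity x = (i.negOnePow : ℤ) • x := by
  have h : A.decompose x = DirectSum.lof k ℤ (fun i => A.deg i) i ⟨x, hx⟩ := by
    rw [DGLieAlgebra.decompose, LinearEquiv.symm_apply_eq]
    exact (DirectSum.coeLinearMap_lof A.deg i ⟨x, hx⟩).symm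
  rw [parity_eq_sum, h, DirectSum.toModule_lof]
  simp

theorem parity_mem (F : CompleteFiltration A) (p : ℕ) (x : L) (hx : x ∈ F.F p) :
    A.parity x ∈ F.F p := by
  classical
  rw [parity_eq_sum]
  have h := F.homogeneous p x hx
  rw [DirectSum.toModule, DFinsupp.lsum_apply_apply, DFinsupp.sumAddHom_apply]
  refine Submodule.sum_mem _ fun i _ => ?_
  exact zsmul_mem (h i) _

theorem signedSwap_of_mem [CharZero k] (i j : ℤ) (x y : L) (hx : x ∈ A.deg i) (hy : y ∈ A.deg j) :
    signedSwap A (x ⊗ₜ[k] y) = (((i - 1) * (j - 1)).negOnePow : ℤ) • (y ⊗ₜ[k] x) := by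
  have h2 : (2 : k) ≠ 0 := two_ne_zero
  simp only [signedSwap, suspendedParity, LinearMap.comp_apply, LinearMap.smul_apply,
    LinearMap.sub_apply, LinearMap.add_apply, TensorProduct.map_tmul, LinearMap.neg_apply,
    parity_of_mem i x hx, parity_of_mem j y hy, LinearMap.id_apply]
  rcases Int.even_or_odd i with hi | hi <;> rcases Int.even_or_odd j with hj | hj
  · have h3 : Odd ((i - 1) * (j - 1)) := (hi.sub_odd odd_one).mul (hj.sub_odd odd_one)
    rw [Int.negOnePow_even _ hi, Int.negOnePow_even _ hj, Int.negOnePow_odd _ h3]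
    simp only [Units.val_one, Units.val_neg, one_smul, neg_smul, neg_neg, TensorProduct.neg_tmul,
      TensorProduct.tmul_neg, LinearEquiv.coe_coe, map_smul, map_add, map_sub, map_neg,
      TensorProduct.comm_tmul]
    match_scalars
    field_simp
    norm_num
  · have h3 : Even ((i - 1) * (j - 1)) := (hj.sub_odd odd_one).mul_left _
    rw [Int.negOnePow_even _ hi, Int.negOnePow_odd _ hj, Int.negOnePow_even _ h3]
    simp only [Units.val_one, Units.val_neg, one_smul, neg_smul, neg_neg, TensorProduct.neg_tmul,
      TensorProduct.tmul_neg, LinearEquiv.coe_coe, map_smul, map_add, map_sub, map_neg,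
      TensorProduct.comm_tmul]
    match_scalars
    field_simp
    norm_num
  · have h3 : Even ((i - 1) * (j - 1)) := (hi.sub_odd odd_one).mul_right _
    rw [Int.negOnePow_odd _ hi, Int.negOnePow_even _ hj, Int.negOnePow_even _ h3]
    simp only [Units.val_one, Units.val_neg, one_smul, neg_smul, neg_neg, TensorProduct.neg_tmul,
      TensorProduct.tmul_neg, LinearEquiv.coe_coe, map_smul, map_add, map_sub, map_neg,
      TensorProduct.comm_tmul]
    match_scalars
    field_simp
    norm_num
  · have h3 : Even ((i - 1) * (j - 1)) := (hi.sub_odd odd_one).mul_right _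
    rw [Int.negOnePow_odd _ hi, Int.negOnePow_odd _ hj, Int.negOnePow_even _ h3]
    simp only [Units.val_one, Units.val_neg, one_smul, neg_smul, neg_neg, TensorProduct.neg_tmul,
      TensorProduct.tmul_neg, LinearEquiv.coe_coe, map_smul, map_add, map_sub, map_neg,
      TensorProduct.comm_tmul]
    match_scalars
    field_simp
    norm_num

theorem coderivation_word (l : List L) :
    coderivation A (word l) ∈ Submodule.span k
      {t | ∃ l₁ l₂ l₃ : List L, l₁ ++ (l₂ ++ l₃) = l ∧
        t = word (l₁.map (suspendedParity A)) *
          (TensorAlgebra.ι k (cogeneratingMap A (word l₂)) * word l₃)} := by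
  have h := Submodule.mem_map_of_mem
    (f := (LinearMap.mul' k (TensorAlgebra k L)).comp
      (TensorProduct.map (tensorParity A)
      ((LinearMap.mul' k (TensorAlgebra k L)).comp
        (TensorProduct.map ((TensorAlgebra.ι k).comp (cogeneratingMap A)) LinearMap.id))))
    (deconcatenation₃_word (k := k) l)
  rw [Submodule.map_span] at h
  refine Submodule.span_mono (R := k) ?_ h
  rintro _ ⟨_, ⟨l₁, l₂, l₃, hl, rfl⟩, rfl⟩
  refine ⟨l₁, l₂, l₃, hl, ?_⟩
  have h1 : tensorParity A (word l₁) = word (l₁.map (suspendedParity A)) := by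
    simp [tensorParity, word, map_list_prod, Function.comp_def]
  rw [← h1]
  simp

theorem coderivation_mem (F : CompleteFiltration A) (m : ℕ) :
    (tensorCoalgebraFiltration F).F (m + 1) ≤
      ((tensorCoalgebraFiltration F).F m).comap (coderivation A) := by
  refine Submodule.span_le.2 ?_
  rintro t ⟨l, hl, hm, rfl⟩
  refine (Submodule.span_le.2 ?_ : _ ≤ (tensorCoalgebraFiltration F).F m)
    (coderivation_word (A := A) (l.map Prod.fst))
  rintro t ⟨l₁, l₂, l₃, h, rfl⟩
  obtain ⟨l₁, l', rfl, rfl, h'⟩ := List.map_eq_append_iff.1 h.symm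
  obtain ⟨l₂, l₃, rfl, rfl, rfl⟩ := List.map_eq_append_iff.1 h'
  simp only [List.mem_append, List.map_append, List.sum_append, List.length_append] at hl hm
  have key : ∀ (x : L) (p : ℕ), x ∈ F.F p →
      (l₂.map Prod.snd).sum ≤ p → l₂.length ≤ 2 →
      word ((l₁.map Prod.fst).map (suspendedParity A)) *
        (TensorAlgebra.ι k x * word (l₃.map Prod.fst)) ∈ (tensorCoalgebraFiltration F).F m := by
    intro x p hx hp hlen
    refine Submodule.subset_span ⟨l₁.map (fun a => (suspendedParity A a.1, a.2)) ++ ((x, p) :: l₃),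
      ?_, ?_, ?_⟩
    · intro a ha
      simp only [List.mem_append, List.mem_map, List.mem_cons] at ha
      rcases ha with ⟨b, hb, rfl⟩ | rfl | ha
      · exact neg_mem (parity_mem F _ _ (hl b (Or.inl hb)))
      · exact hx
      · exact hl a (Or.inr (Or.inr ha))
    · simp only [List.map_append, List.map_map, List.map_cons, List.sum_append, List.sum_cons,
        List.length_append, List.length_map, List.length_cons]
      have he : (Prod.snd ∘ fun a : L × ℕ => (suspendedParity A a.1, a.2)) = Prod.snd := rfl
      rw [he]
      omega
    · simp [word_append, word_cons, Function.comp_def]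
  match l₂, hl, hm, key with
  | [], _, _, _ =>
    rw [List.map_nil, cogeneratingMap_word_nil]
    simp
  | [a], hl, _, key =>
    rw [List.map_cons, List.map_nil, cogeneratingMap_word_singleton]
    refine key _ a.2 (neg_mem (F.d_mem _ _ (hl a (Or.inr (Or.inl (by simp)))))) (by simp) (by simp)
  | [a, b], hl, _, key =>
    rw [List.map_cons, List.map_cons, List.map_nil, cogeneratingMap_word_pair]
    refine key _ (a.2 + b.2) (Submodule.smul_mem _ _ (F.bracket_mem _ _ _
      (parity_mem F _ _ (hl a (Or.inr (Or.inl (by simp))))) _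
      (hl b (Or.inr (Or.inl (by simp)))))) (by simp) (by simp)
  | a :: b :: c :: l, _, _, _ =>
    rw [List.map_cons, List.map_cons, List.map_cons, cogeneratingMap_word_long]
    simp

theorem deconcatenation_mem (F : CompleteFiltration A) (m : ℕ) :
    (tensorCoalgebraFiltration F).F m ≤
      ((tensorFiltration (tensorCoalgebraFiltration F) (tensorCoalgebraFiltration F)).F m).comap
        (deconcatenation k L) := by
  refine Submodule.span_le.2 ?_
  rintro t ⟨l, hl, hm, rfl⟩
  refine (Submodule.span_le.2 ?_ : _ ≤ (tensorFiltration (tensorCoalgebraFiltration F)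
    (tensorCoalgebraFiltration F)).F m) (deconcatenation_word (k := k) (l.map Prod.fst))
  rintro t ⟨l₁, l₂, h, rfl⟩
  obtain ⟨l₁, l₂, rfl, rfl, rfl⟩ := List.map_eq_append_iff.1 h.symm
  simp only [List.mem_append, List.map_append, List.sum_append, List.length_append] at hl hm
  rcases hm with hm | hm
  · exact Submodule.subset_span ⟨_, _, hm,
      _, Submodule.subset_span ⟨l₁, fun a ha => hl a (Or.inl ha), Or.inl le_rfl, rfl⟩,
      _, Submodule.subset_span ⟨l₂, fun a ha => hl a (Or.inr ha), Or.inl le_rfl, rfl⟩, rfl⟩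
  · exact Submodule.subset_span ⟨_, _, hm,
      _, Submodule.subset_span ⟨l₁, fun a ha => hl a (Or.inl ha), Or.inr le_rfl, rfl⟩,
      _, Submodule.subset_span ⟨l₂, fun a ha => hl a (Or.inr ha), Or.inr le_rfl, rfl⟩, rfl⟩

/-! ### The completed tensor coalgebra and `Ĉ(L)` -/

/-- The space underlying the completed tensor coalgebra `T̂^c(sL)`. -/
abbrev CompletedTensorSpace (F : CompleteFiltration A) : Type (max u v) :=
  completion (tensorCoalgebraFiltration F)

theorem toCompletion_mem {M : Type*} [AddCommGroup M] [Module k M] (B : Filtration k M) (p : ℕ) :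
    B.F p ≤ ((completionFiltration B).F p).comap (toCompletion B) := by
  intro x hx
  exact (Submodule.Quotient.mk_eq_zero _).2 hx

theorem algebraMapInv_mem (F : CompleteFiltration A) :
    (tensorCoalgebraFiltration F).F 1 ≤
      LinearMap.ker (TensorAlgebra.algebraMapInv (R := k) (M := L)).toLinearMap := by
  refine Submodule.span_le.2 ?_
  rintro t ⟨l, -, hl, rfl⟩
  match l, hl with
  | [], hl => simp at hl
  | a :: l, _ => simp [word_cons, TensorAlgebra.algebraMapInv]

/-- The completed tensor coalgebra `T̂^c(sL)`, with the extension by continuity of the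
deconcatenation and of the coderivation.  (The latter has square zero on the graded symmetric
tensors.) -/
def completedTensorCoalgebra (F : CompleteFiltration A) :
    DGCoalgebraData k (CompletedTensorSpace F) where
  deg i :=
    { carrier := {x | ∀ m, ∃ t ∈ tensorDeg A i, x.1 m = Submodule.mkQ _ t}
      add_mem' := by
        intro x y hx hy m
        obtain ⟨s, hs, hs'⟩ := hx m
        obtain ⟨t, ht, ht'⟩ := hy m
        exact ⟨s + t, add_mem hs ht, by rw [map_add, ← hs', ← ht']; rfl⟩
      zero_mem' := fun m => ⟨0, zero_mem _, by rw [map_zero]; rfl⟩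
      smul_mem' := by
        intro c x hx m
        obtain ⟨s, hs, hs'⟩ := hx m
        exact ⟨c • s, Submodule.smul_mem _ _ hs, by rw [map_smul, ← hs']; rfl⟩ }
  fil := completionFiltration (tensorCoalgebraFiltration F)
  d := completionMap _ _ (coderivation A) 1 (coderivation_mem F)
  counit := (Submodule.liftQ _ (TensorAlgebra.algebraMapInv (R := k) (M := L)).toLinearMap
    (algebraMapInv_mem F)).comp ((LinearMap.proj 1).comp (Submodule.subtype _))
  comul := completionMap _ _
    ((TensorProduct.map (toCompletion (tensorCoalgebraFiltration F))
      (toCompletion (tensorCoalgebraFiltration F))).comp (deconcatenation k L)) 0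
    (fun p => (deconcatenation_mem F p).trans
      (Submodule.comap_mono (tensorFiltration_map _ _ _ _ _ _ (toCompletion_mem _)
        (toCompletion_mem _) p)))

/-- `x ∈ Ĉ(L)`: the completion of `C(L) = S^c(sL)`, which is the closed sub-coalgebra of
`T̂^c(sL)` of limits of graded symmetric tensors. -/
def MemC (F : CompleteFiltration A) (x : CompletedTensorSpace F) : Prop :=
  ∀ m, ∃ t ∈ symmetricTensors A, x.1 m = Submodule.mkQ _ t

/-- The component of length one of `x` lies in `F_p L`. -/
def CogeneratorMem (F : CompleteFiltration A) (p : ℕ) (x : CompletedTensorSpace F) : Prop :=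
  ∀ m, ∃ t : TensorAlgebra k L, cogenerator k L t ∈ F.F p ∧ x.1 m = Submodule.mkQ _ t

/-- A filtered map of dg coalgebras `f : C → Ĉ(L)`, "filtered" meaning that the composite
`π f : C → L` preserves filtrations. -/
structure FilteredMap {X : Type w} [AddCommGroup X] [Module k X] (C : DGCoalgebraData k X)
    (F : CompleteFiltration A) extends DGCoalgebraMap C (completedTensorCoalgebra F) where
  mem_C : ∀ x, MemC F (toLin x)
  filtered : ∀ p, ∀ x ∈ C.fil.F p, CogeneratorMem F p (toLin x)

/-- Two points `f, g : k → Ĉ(L)` are joined by a filtered homotopy `h : k ⊗̂ J = J → Ĉ(L)`, with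
`f 1 = h (t_0)` and `g 1 = h (∑ t_i)`. -/
def Homotopic {F : CompleteFiltration A} (f g : FilteredMap (point k) F) : Prop :=
  ∃ h : FilteredMap (interval k) F,
    h.toLin (tElt 0) = f.toLin 1 ∧ h.toLin (fun _ => 1, 0) = g.toLin 1

/-- The set of filtered homotopy classes of dg coalgebra maps `k → Ĉ(L)`. -/
def HomotopyClasses (F : CompleteFiltration A) : Type (max u v) :=
  Quot (Homotopic (F := F))

/-- The element `1 + sp + sp ⊗ sp + ...` of `T̂^c(sL)`. -/
def groupLike (F : CompleteFiltration A) (p : L) : CompletedTensorSpace F :=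
  ⟨fun m => Submodule.mkQ _ (∑ n ∈ Finset.range m, TensorAlgebra.ι k p ^ n), by
    intro m n h
    rw [Submodule.factor_mk, ← sub_eq_zero, ← map_sub, Submodule.mkQ_apply,
      Submodule.Quotient.mk_eq_zero, ← Finset.sum_range_add_sum_Ico _ h, add_sub_cancel_left]
    refine Submodule.sum_mem _ fun i hi => ?_
    refine Submodule.subset_span ⟨List.replicate i (p, 0), ?_, Or.inr ?_, ?_⟩
    · intro a ha
      rw [List.eq_of_mem_replicate ha, F.F_zero]
      exact Submodule.mem_top
    · simpa using (Finset.mem_Ico.1 hi).1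
    · simp [word]⟩

/-- `f` is the classifying map `χ(p)`, that is, `f 1 = 1 + sp + sp ⊗ sp + ...`. -/
def IsClassifyingMap {F : CompleteFiltration A} (p : MaurerCartan A)
    (f : FilteredMap (point k) F) : Prop :=
  f.toLin 1 = groupLike F p.1

end Tensor

end HomotopyModuli

end

/-!
A map of coalgebras into `Ĉ(L)` is determined by its component of length one. If `C` has a basis
`e_γ` with `Δ e_γ = ∑ e_α ⊗ e_β` over `α + β = γ`, then `f : C → Ĉ(L)` sends `e_γ` to the
coefficient at `γ` of the geometric series `1 + x + x² + ⋯` of `x = ∑ x_γ e^γ`, where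
`x_γ = π (f e_γ)`, and `f` commutes with the differentials if and only if `x` satisfies the
Maurer-Cartan equation. For `C = k` this says that `f = χ(p)` with `p ∈ V_L`. For `C = J` it says
that `x` is a pair `P(t) + B(t) dt` such that `P(t)` is a Maurer-Cartan element for all `t` and
`P' = [B, P] - dB`: the path `d + P(t)` follows the flow of `ad B(t)`. Hence `χ(p)` and `χ(q)` are
homotopic if and only if such a path leads from `p` to `q`.

If `d + q = exp b (d + p)`, then `exp (t b) (d + p)` is a path from `d + p` to `d + q`. Conversely
the solution of the flow of `B` is `exp a(t) (d + p)`, where `a` is determined, one coefficient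
after the other, by `∑ (ad a)^n a' / (n + 1)! = B`, and `b = a(1)` converges because
`B_n ∈ F_n L`. The same logarithm, taken of the flow `exp (t a) exp (t b)`, shows that lying in the
same orbit is transitive.
-/

noncomputable section

namespace HomotopyModuli

open Finset

/-! ### Sums over antidiagonals -/

section Antidiagonal

section General

variable {Γ : Type*} [AddCommMonoid Γ] [HasAntidiagonal Γ] {M : Type*} [AddCommMonoid M]

theorem sum_antidiagonal_eq_right {f : Γ × Γ → M} (hf : ∀ ab, ab.2 ≠ 0 → f ab = 0) (γ : Γ) :
    ∑ ab ∈ antidiagonal γ, f ab = f (γ, 0) := by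
  refine sum_eq_single _ (fun ab hab hne => hf ab fun h => hne ?_) fun h =>
    absurd (HasAntidiagonal.mem_antidiagonal.2 (add_zero γ)) h
  rw [HasAntidiagonal.mem_antidiagonal, h, add_zero] at hab
  exact Prod.ext hab h

theorem sum_antidiagonal_swap (f : Γ × Γ → M) (γ : Γ) :
    ∑ ab ∈ antidiagonal γ, f ab.swap = ∑ ab ∈ antidiagonal γ, f ab :=
  sum_equiv (Equiv.prodComm Γ Γ) (by simp [HasAntidiagonal.mem_antidiagonal, add_comm])
    fun _ _ => rfl

theorem sum_antidiagonal_eq_left {f : Γ × Γ → M} (hf : ∀ ab, ab.1 ≠ 0 → f ab = 0) (γ : Γ) :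
    ∑ ab ∈ antidiagonal γ, f ab = f (0, γ) := by
  rw [← sum_antidiagonal_swap]
  exact sum_antidiagonal_eq_right (f := f ∘ Prod.swap) (fun ab => hf ab.swap) γ

end General

theorem sum_antidiagonal_assoc {Γ M : Type*} [AddCommMonoid Γ] [HasAntidiagonal Γ]
    [AddCommMonoid M] (f : Γ → Γ → Γ → M) (n : Γ) :
    ∑ ab ∈ antidiagonal n, ∑ cd ∈ antidiagonal ab.2, f ab.1 cd.1 cd.2 =
      ∑ ab ∈ antidiagonal n, ∑ cd ∈ antidiagonal ab.1, f cd.1 cd.2 ab.2 := by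
  rw [sum_sigma', sum_sigma']
  refine sum_nbij' (fun x => ⟨(x.1.1 + x.2.1, x.2.2), (x.1.1, x.2.1)⟩)
    (fun x => ⟨(x.2.1, x.2.2 + x.1.2), (x.2.2, x.1.2)⟩) ?_ ?_ ?_ ?_ fun _ _ => rfl
  all_goals
    rintro ⟨⟨a, b⟩, ⟨c, d⟩⟩ h
    simp only [mem_sigma, HasAntidiagonal.mem_antidiagonal] at h ⊢
  · exact ⟨by rw [add_assoc, h.2, h.1], trivial⟩
  · exact ⟨by rw [← add_assoc, h.2, h.1], trivial⟩
  · rw [h.2]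
  · rw [h.2]

theorem antidiagonal_apply_zero {Γ : Type*} [AddCommMonoid Γ] [PartialOrder Γ]
    [CanonicallyOrderedAdd Γ] [HasAntidiagonal Γ] : antidiagonal (0 : Γ) = {(0, 0)} := by
  ext ⟨a, b⟩
  simp

instance : HasAntidiagonal PUnit where
  antidiagonal _ := {(PUnit.unit, PUnit.unit)}
  mem_antidiagonal := by simp

instance : HasAntidiagonal (ℕ × ℕ) where
  antidiagonal n := (antidiagonal n.1 ×ˢ antidiagonal n.2).map
    (Equiv.prodProdProdComm ℕ ℕ ℕ ℕ).toEmbedding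
  mem_antidiagonal := by
    rintro ⟨n, e⟩ ⟨⟨i, a⟩, ⟨j, b⟩⟩
    simp only [mem_map_equiv, mem_product, HasAntidiagonal.mem_antidiagonal,
      Equiv.prodProdProdComm_symm, Equiv.prodProdProdComm_apply, Prod.mk_add_mk, Prod.mk.injEq]

variable {M : Type*} [AddCommMonoid M]

theorem sum_antidiagonal_prod (f : (ℕ × ℕ) × (ℕ × ℕ) → M) (n e : ℕ) :
    ∑ ab ∈ antidiagonal (n, e), f ab =
      ∑ ij ∈ antidiagonal n, ∑ cd ∈ antidiagonal e, f ((ij.1, cd.1), (ij.2, cd.2)) := by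
  rw [← sum_product']
  exact sum_map _ _ _

theorem sum_antidiagonal_prod_zero (f : (ℕ × ℕ) × (ℕ × ℕ) → M) (n : ℕ) :
    ∑ ab ∈ antidiagonal (n, 0), f ab = ∑ ij ∈ antidiagonal n, f ((ij.1, 0), (ij.2, 0)) := by
  simp [sum_antidiagonal_prod]

theorem sum_antidiagonal_prod_one (f : (ℕ × ℕ) × (ℕ × ℕ) → M) (n : ℕ) :
    ∑ ab ∈ antidiagonal (n, 1), f ab =
      ∑ ij ∈ antidiagonal n, (f ((ij.1, 0), (ij.2, 1)) + f ((ij.1, 1), (ij.2, 0))) := by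
  simp [sum_antidiagonal_prod, Nat.sum_antidiagonal_succ]

end Antidiagonal

/-! ### Formal flows -/

section Sums

variable {k : Type*} [Field k] {M : Type*} [AddCommGroup M] [Module k M]

theorem succ_smul_sum_antidiagonal_succ (f : ℕ → ℕ → M) (n : ℕ) :
    ((n : k) + 1) • ∑ ij ∈ antidiagonal (n + 1), f ij.1 ij.2 =
      ∑ ij ∈ antidiagonal n, (((ij.1 : k) + 1) • f (ij.1 + 1) ij.2
        + ((ij.2 : k) + 1) • f ij.1 (ij.2 + 1)) := by
  have hsplit : ((n : k) + 1) • ∑ ij ∈ antidiagonal (n + 1), f ij.1 ij.2 =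
      ∑ ij ∈ antidiagonal (n + 1), ((ij.1 : k) • f ij.1 ij.2 + (ij.2 : k) • f ij.1 ij.2) := by
    rw [smul_sum]
    refine sum_congr rfl fun ij hij => ?_
    rw [← add_smul, ← Nat.cast_add, mem_antidiagonal.1 hij, Nat.cast_succ]
  rw [hsplit, sum_add_distrib, sum_add_distrib, Nat.sum_antidiagonal_succ,
    Nat.sum_antidiagonal_succ']
  simp

variable (k) in
/-- The divided power `φ ^ n / n!` of an operator, the coefficient of `t ^ n` in `exp (t φ)`. -/
def dividedPow (φ : Module.End k M) (n : ℕ) : Module.End k M := (n.factorial : k)⁻¹ • φ ^ n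

theorem dividedPow_apply (φ : Module.End k M) (n : ℕ) (x : M) :
    dividedPow k φ n x = (n.factorial : k)⁻¹ • (φ ^ n) x := rfl

@[simp]
theorem dividedPow_zero_apply (φ : Module.End k M) (x : M) : dividedPow k φ 0 x = x := by
  simp [dividedPow]

variable [CharZero k]

theorem flow_unique (φ : ℕ → Module.End k M) {v w : ℕ → M} (h0 : v 0 = w 0)
    (hv : ∀ n : ℕ, ((n : k) + 1) • v (n + 1) = ∑ ij ∈ antidiagonal n, φ ij.1 (v ij.2))
    (hw : ∀ n : ℕ, ((n : k) + 1) • w (n + 1) = ∑ ij ∈ antidiagonal n, φ ij.1 (w ij.2)) (n : ℕ) :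
    v n = w n := by
  induction n using Nat.strong_induction_on with
  | _ n ih =>
    cases n with
    | zero => exact h0
    | succ n =>
      refine (smul_right_inj (n.cast_add_one_ne_zero (R := k))).1 ?_
      rw [hv, hw]
      refine sum_congr rfl fun ij hij => ?_
      have hij := mem_antidiagonal.1 hij
      rw [ih ij.2 (by omega)]

theorem succ_smul_dividedPow (φ : Module.End k M) (n : ℕ) (x : M) :
    ((n : k) + 1) • dividedPow k φ (n + 1) x = φ (dividedPow k φ n x) := by
  rw [dividedPow_apply, dividedPow_apply, pow_succ', Module.End.mul_apply, map_smul, smul_smul,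
    Nat.factorial_succ, Nat.cast_mul, Nat.cast_succ, mul_inv_rev, mul_comm (_ + 1 : k),
    inv_mul_cancel_right₀ n.cast_add_one_ne_zero]

theorem sum_antidiagonal_dividedPow {M' N : Type*} [AddCommGroup M'] [Module k M']
    [AddCommGroup N] [Module k N] {φ : Module.End k M} {φ' : Module.End k M'}
    {ψ : Module.End k N} {Q : M →ₗ[k] M' →ₗ[k] N} {S : Submodule k M} {S' : Submodule k M'}
    (hφ : ∀ x ∈ S, φ x ∈ S) (hφ' : ∀ y ∈ S', φ' y ∈ S')
    (hQ : ∀ x ∈ S, ∀ y ∈ S', ψ (Q x y) = Q (φ x) y + Q x (φ' y))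
    {x : M} {y : M'} (hx : x ∈ S) (hy : y ∈ S') (n : ℕ) :
    ∑ ij ∈ antidiagonal n, Q (dividedPow k φ ij.1 x) (dividedPow k φ' ij.2 y) =
      dividedPow k ψ n (Q x y) := by
  have hmem (i : ℕ) : dividedPow k φ i x ∈ S := by
    exact S.smul_mem _ (Module.End.pow_apply_mem_of_forall_mem i hφ x hx)
  have hmem' (j : ℕ) : dividedPow k φ' j y ∈ S' := by
    exact S'.smul_mem _ (Module.End.pow_apply_mem_of_forall_mem j hφ' y hy)
  induction n with
  | zero => simp
  | succ n ih =>
    refine (smul_right_inj (n.cast_add_one_ne_zero (R := k))).1 ?_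
    rw [succ_smul_dividedPow, ← ih, map_sum, succ_smul_sum_antidiagonal_succ
      (fun i j => Q (dividedPow k φ i x) (dividedPow k φ' j y))]
    refine sum_congr rfl fun ij _ => ?_
    rw [hQ _ (hmem _) _ (hmem' _), ← succ_smul_dividedPow, ← succ_smul_dividedPow, map_smul,
      map_smul, LinearMap.smul_apply]

end Sums

/-! ### The derivative of the exponential -/

section Exponential

variable {R : Type*} [Ring R] [Algebra ℚ R]

/-- The operator `x ↦ a * x - x * a` of an associative algebra. -/
def commutator (a : R) : Module.End ℚ R := LinearMap.mulLeft ℚ a - LinearMap.mulRight ℚ a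

theorem commutator_apply (a b : R) : commutator a b = a * b - b * a := rfl

theorem isNilpotent_commutator {a : R} (ha : IsNilpotent a) : IsNilpotent (commutator a) :=
  (LinearMap.commute_mulLeft_right a a).isNilpotent_sub
    ((LinearMap.isNilpotent_mulLeft_iff ℚ a).2 ha)
    ((LinearMap.isNilpotent_mulRight_iff ℚ a).2 ha)

theorem exp_commutator_apply_mul_exp {a : R} (ha : IsNilpotent a) (b : R) :
    IsNilpotent.exp (commutator a) b * IsNilpotent.exp a = IsNilpotent.exp a * b := by
  have hleft : IsNilpotent.exp (LinearMap.mulLeft ℚ a) =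
      LinearMap.mulLeft ℚ (IsNilpotent.exp a) :=
    (IsNilpotent.map_exp ha (Algebra.lmul ℚ R)).symm
  have hright : IsNilpotent.exp (LinearMap.mulRight ℚ (-a)) =
      LinearMap.mulRight ℚ (IsNilpotent.exp (-a)) := by
    obtain ⟨n, hn⟩ := ha.neg
    rw [IsNilpotent.exp_eq_sum hn, IsNilpotent.exp_eq_sum (k := n)
      (by rw [LinearMap.pow_mulRight, hn, LinearMap.mulRight_zero_eq_zero])]
    ext x
    simp [LinearMap.pow_mulRight, mul_sum]
  have hadd : commutator a = LinearMap.mulLeft ℚ a + LinearMap.mulRight ℚ (-a) := by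
    ext x
    simp [commutator_apply, sub_eq_add_neg]
  rw [hadd, IsNilpotent.exp_add_of_commute (LinearMap.commute_mulLeft_right a (-a))
    ((LinearMap.isNilpotent_mulLeft_iff ℚ a).2 ha)
    ((LinearMap.isNilpotent_mulRight_iff ℚ (-a)).2 ha.neg), hleft, hright]
  simp [mul_assoc, IsNilpotent.exp_neg_mul_exp_self ha]

/- In `End R` one has `[a, D] = -D a`, so that `exp [a, ·]` sends `D` to `D - Y` with `Y` the sum
below; evaluating `exp [a, ·] D * exp a = exp a * D` at `1` gives the claim. -/
theorem derivation_exp (D : Module.End ℚ R) (hD : ∀ x y, D (x * y) = D x * y + x * D y) {a : R}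
    (ha : IsNilpotent a) {N : ℕ} (hN : (commutator a ^ N) (D a) = 0) :
    D (IsNilpotent.exp a) = (∑ i ∈ range N, ((i + 1).factorial : ℚ)⁻¹ • (commutator a ^ i) (D a)) *
      IsNilpotent.exp a := by
  let lmul := Algebra.lmul ℚ R
  have hone : D 1 = 0 := by simpa using hD 1 1
  have hcomm (x : R) : commutator (lmul a) (lmul x) = lmul (commutator a x) := by
    simp [commutator_apply]
  have hpow (i : ℕ) : (commutator (lmul a) ^ (i + 1)) D = -lmul ((commutator a ^ i) (D a)) := by
    induction i with
    | zero =>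
      ext x
      simp [lmul, commutator_apply, hD]
    | succ i ih =>
      rw [pow_succ', Module.End.mul_apply, ih, map_neg, hcomm, pow_succ' (commutator a),
        Module.End.mul_apply]
  have hlmul : IsNilpotent (lmul a) := ha.map lmul
  have hexp : IsNilpotent.exp (commutator (lmul a)) D =
      D - lmul (∑ i ∈ range N, ((i + 1).factorial : ℚ)⁻¹ • (commutator a ^ i) (D a)) := by
    rw [← Module.End.smul_def, IsNilpotent.exp_smul_eq_sum (k := N + 1)
      (by rw [Module.End.smul_def, hpow, hN, map_zero, neg_zero])
      (isNilpotent_commutator hlmul), sum_range_succ']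
    simp only [Module.End.smul_def, hpow, smul_neg, sum_neg_distrib, map_sum, map_smul]
    simp [sub_eq_neg_add]
  have h := LinearMap.congr_fun (exp_commutator_apply_mul_exp hlmul D) 1
  rw [hexp, ← IsNilpotent.map_exp ha lmul, Module.End.mul_apply, Module.End.mul_apply, hone,
    map_zero] at h
  exact sub_eq_zero.1 (by simpa [lmul, sum_mul] using h)

theorem isNilpotent_of_coeff_mem {k R : Type*} [Field k] [Ring R] [Algebra k R]
    {S : Submodule k R} {N : ℕ} (hS : S ^ N = ⊥) {p : Polynomial R} (hp : ∀ n, p.coeff n ∈ S) :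
    IsNilpotent p := by
  have hpow (i : ℕ) : ∀ n, (p ^ i).coeff n ∈ S ^ i := by
    induction i with
    | zero =>
      intro n
      rw [pow_zero, pow_zero, Polynomial.coeff_one]
      split_ifs
      exacts [Submodule.one_le.1 le_rfl, zero_mem _]
    | succ i ih =>
      intro n
      rw [pow_succ, pow_succ, Polynomial.coeff_mul]
      exact Submodule.sum_mem _ fun jl _ => Submodule.mul_mem_mul (ih _) (hp _)
  refine ⟨N, Polynomial.ext fun n => ?_⟩
  have h := hpow N n
  rwa [hS, Submodule.mem_bot] at h

end Exponential

/-! ### Logarithms of formal flows -/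

theorem exists_fixedPoint_of_causal {M : Type*} [Zero M] (Θ : (ℕ → M) → ℕ → M)
    (S : ℕ → Set M) (h0 : ∀ n, 0 ∈ S n) (hS : ∀ x, (∀ n, x n ∈ S n) → ∀ n, Θ x n ∈ S n)
    (hΘ : ∀ n x y, (∀ i < n, x i = y i) → Θ x n = Θ y n) :
    ∃ x, (∀ n, x n ∈ S n) ∧ ∀ n, x n = Θ x n := by
  have hstable : ∀ n a b, n < a → n < b → Θ^[a] 0 n = Θ^[b] 0 n := by
    intro n
    induction n using Nat.strong_induction_on with
    | _ n ih =>
      intro a b ha hb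
      obtain ⟨a, rfl⟩ := Nat.exists_eq_add_of_lt ha
      obtain ⟨b, rfl⟩ := Nat.exists_eq_add_of_lt hb
      rw [Function.iterate_succ_apply', Function.iterate_succ_apply']
      exact hΘ n _ _ fun i hi => ih i hi _ _ (by omega) (by omega)
  have hmem (m : ℕ) : ∀ n, Θ^[m] 0 n ∈ S n := by
    induction m with
    | zero => exact h0
    | succ m ih => rw [Function.iterate_succ_apply']; exact hS _ ih
  refine ⟨fun n => Θ^[n + 1] 0 n, fun n => hmem _ _, fun n => ?_⟩
  change Θ^[n + 1] 0 n = _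
  rw [Function.iterate_succ_apply']
  exact hΘ n _ _ fun i hi => hstable i _ _ hi i.lt_succ_self

section Logarithm

variable {k : Type*} [Field k] {M : Type*} [AddCommGroup M] [Module k M]

/-- The extension of a bilinear bracket to formal power series, given by their coefficients. -/
def seriesBracket (β : M →ₗ[k] M →ₗ[k] M) (x y : ℕ → M) (n : ℕ) : M :=
  ∑ ij ∈ antidiagonal n, β (x ij.1) (y ij.2)

variable (k) in
/-- The coefficients of the primitive, without constant term, of a formal power series. -/
def seriesIntegral (x : ℕ → M) : ℕ → M
  | 0 => 0
  | n + 1 => ((n : k) + 1)⁻¹ • x n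

variable {β : M →ₗ[k] M →ₗ[k] M}

theorem iterate_seriesBracket_mem {G : ℕ → Submodule k M}
    (hG : ∀ i j, ∀ x ∈ G i, ∀ y ∈ G j, β x y ∈ G (i + j)) {x y : ℕ → M} (hx : ∀ n, x n ∈ G n)
    (hy : ∀ n, y n ∈ G (n + 1)) (i n : ℕ) : (seriesBracket β x)^[i] y n ∈ G (n + 1) := by
  induction i generalizing n with
  | zero => exact hy n
  | succ i ih =>
    rw [Function.iterate_succ_apply']
    refine Submodule.sum_mem _ fun jl hjl => ?_
    rw [← mem_antidiagonal.1 hjl, add_assoc]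
    exact hG _ _ _ (hx _) _ (ih _)

theorem seriesIntegral_mem {G : ℕ → Submodule k M} {x : ℕ → M} (hx : ∀ n, x n ∈ G (n + 1)) :
    ∀ n, seriesIntegral k x n ∈ G n
  | 0 => zero_mem _
  | n + 1 => Submodule.smul_mem _ _ (hx n)

theorem seriesIntegral_congr {x y : ℕ → M} {n : ℕ} (h : ∀ i < n, x i = y i) :
    ∀ j < n + 1, seriesIntegral k x j = seriesIntegral k y j
  | 0, _ => rfl
  | j + 1, hj => by rw [seriesIntegral, seriesIntegral, h j (by omega)]

theorem seriesBracket_congr {x x' y y' : ℕ → M} {n : ℕ} (hx0 : x 0 = 0)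
    (hx : ∀ i < n + 1, x i = x' i) (hy : ∀ i < n, y i = y' i) {j : ℕ} (hj : j < n + 1) :
    seriesBracket β x y j = seriesBracket β x' y' j := by
  refine sum_congr rfl fun ab hab => ?_
  have hab := mem_antidiagonal.1 hab
  rw [← hx _ (by omega)]
  by_cases h0 : ab.1 = 0
  · rw [h0, hx0, map_zero, LinearMap.zero_apply, LinearMap.zero_apply]
  · rw [hy _ (by omega)]

theorem iterate_seriesBracket_eq_zero {x : ℕ → M} (hx : x 0 = 0) (y : ℕ → M) {i n : ℕ}
    (h : n < i) : (seriesBracket β x)^[i] y n = 0 := by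
  induction i generalizing n with
  | zero => omega
  | succ i ih =>
    rw [Function.iterate_succ_apply']
    refine sum_eq_zero fun ab hab => ?_
    have hab := mem_antidiagonal.1 hab
    by_cases h0 : ab.1 = 0
    · rw [h0, hx, map_zero, LinearMap.zero_apply]
    · rw [ih (by omega), map_zero]

theorem iterate_seriesBracket_integral_congr {x y : ℕ → M} {n : ℕ} (h : ∀ i < n, x i = y i)
    (i : ℕ) {j : ℕ} (hj : j < n + 1) :
    (seriesBracket β (seriesIntegral k x))^[i + 1] x j =
      (seriesBracket β (seriesIntegral k y))^[i + 1] y j := by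
  induction i generalizing j with
  | zero => exact seriesBracket_congr rfl (seriesIntegral_congr h) h hj
  | succ i ih =>
    rw [Function.iterate_succ_apply', Function.iterate_succ_apply' (n := i + 1)]
    exact seriesBracket_congr rfl (seriesIntegral_congr h) (fun j hj => ih (by omega)) hj

/- For `c = ∫ x`, the sum is the logarithmic derivative `c' + [c, c'] / 2! + ...` of `exp c`. Its
`n`-th coefficient is `x n` plus terms in which only the `x i` with `i < n` occur. -/
theorem exists_series_logDeriv_eq {G : ℕ → Submodule k M}
    (hG : ∀ i j, ∀ x ∈ G i, ∀ y ∈ G j, β x y ∈ G (i + j)) {b : ℕ → M}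
    (hb : ∀ n, b n ∈ G (n + 1)) :
    ∃ x : ℕ → M, (∀ n, x n ∈ G (n + 1)) ∧ ∀ n, b n = ∑ i ∈ range (n + 1),
      ((i + 1).factorial : k)⁻¹ • (seriesBracket β (seriesIntegral k x))^[i] x n := by
  let Θ (x : ℕ → M) (n : ℕ) : M := b n - ∑ i ∈ range n,
    ((i + 2).factorial : k)⁻¹ • (seriesBracket β (seriesIntegral k x))^[i + 1] x n
  obtain ⟨x, hx, hfix⟩ := exists_fixedPoint_of_causal Θ (fun n => (G (n + 1) : Set M))
    (fun n => zero_mem _)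
    (fun x hx n => sub_mem (hb n) (Submodule.sum_mem _ fun i _ => Submodule.smul_mem _ _
      (iterate_seriesBracket_mem hG (seriesIntegral_mem hx) hx _ n)))
    (fun n x y h => by
      simp only [Θ]
      rw [sum_congr rfl fun i _ => by
        rw [iterate_seriesBracket_integral_congr h i n.lt_succ_self]])
  refine ⟨x, hx, fun n => ?_⟩
  rw [sum_range_succ', ← eq_sub_iff_add_eq'.1 (hfix n)]
  simp

end Logarithm

/-! ### The gauge action -/

section Gauge

variable {k : Type*} [Field k] {L : Type*} [AddCommGroup L] [Module k L]
variable {A : DGLieAlgebra k L}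

/-- The quotient of `L[d] = L ⊕ k d` by `F_m L`. On it, elements of positive filtration act
nilpotently, so that their exponentials are finite sums. -/
def Level (F : CompleteFiltration A) (m : ℕ) : Type _ :=
  (L × k) ⧸ (F.F m).prod (⊥ : Submodule k k)

variable (F : CompleteFiltration A) (m : ℕ)

instance : AddCommGroup (Level F m) := inferInstanceAs (AddCommGroup ((L × k) ⧸ _))

instance : Module k (Level F m) := inferInstanceAs (Module k ((L × k) ⧸ _))

/-- The projection of `L[d]` onto its quotient by `F_m L`. -/
def levelMk : L × k →ₗ[k] Level F m := Submodule.mkQ _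

variable {F m} in
theorem levelMk_eq_iff {x y : L × k} :
    levelMk F m x = levelMk F m y ↔ x.2 = y.2 ∧ x.1 - y.1 ∈ F.F m := by
  refine (Submodule.Quotient.eq _).trans ?_
  rw [Submodule.mem_prod, Submodule.mem_bot, Prod.snd_sub, sub_eq_zero, Prod.fst_sub, and_comm]

/-- The operator induced by `ad b` on the quotient of `L[d]` by `F_m L`. -/
def levelAd : L →ₗ[k] Module.End k (Level F m) where
  toFun b := Submodule.mapQ _ _ (adIncorporated A b) fun x hx => by
    obtain ⟨hx, hx'⟩ := Submodule.mem_prod.1 hx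
    rw [Submodule.mem_bot] at hx'
    refine Submodule.mem_prod.2 ⟨?_, rfl⟩
    have h := F.bracket_mem 0 m b (F.F_zero ▸ Submodule.mem_top) _ hx
    simpa [adIncorporated, hx'] using h
  map_add' a b := Submodule.linearMap_qext _ <| LinearMap.ext fun x =>
    congrArg (levelMk F m) <| by ext <;> simp [adIncorporated, add_sub_add_comm]
  map_smul' c b := Submodule.linearMap_qext _ <| LinearMap.ext fun x =>
    congrArg (levelMk F m) <| by ext <;> simp [adIncorporated, smul_sub, smul_comm c]

theorem levelAd_levelMk (b : L) (x : L × k) :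
    levelAd F m b (levelMk F m x) = levelMk F m (adIncorporated A b x) := rfl

variable {F m}

theorem level_hom_ext {φ ψ : Module.End k (Level F m)}
    (h : ∀ x, φ (levelMk F m x) = ψ (levelMk F m x)) : φ = ψ :=
  Submodule.linearMap_qext _ (LinearMap.ext h)

theorem levelAd_pow_levelMk (b : L) (n : ℕ) (x : L × k) :
    (levelAd F m b ^ n) (levelMk F m x) = levelMk F m ((adIncorporated A b ^ n) x) := by
  induction n with
  | zero => rfl
  | succ n ih =>
    rw [pow_succ', Module.End.mul_apply, ih, levelAd_levelMk, pow_succ', Module.End.mul_apply]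

theorem levelAd_eq_zero {b : L} (hb : b ∈ F.F m) : levelAd F m b = 0 :=
  level_hom_ext fun x => by
    rw [levelAd_levelMk, LinearMap.zero_apply, ← map_zero (levelMk F m), levelMk_eq_iff]
    refine ⟨rfl, ?_⟩
    have h := F.bracket_mem m 0 b hb x.1 (F.F_zero ▸ Submodule.mem_top)
    simpa [adIncorporated] using sub_mem h (Submodule.smul_mem _ x.2 (F.d_mem m b hb))

theorem levelAd_bracket {a b : L} (ha : a ∈ A.deg 0) (hb : b ∈ A.deg 0) :
    levelAd F m (A.bracket a b) =
      levelAd F m a * levelAd F m b - levelAd F m b * levelAd F m a := by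
  refine level_hom_ext fun x => ?_
  rw [LinearMap.sub_apply, Module.End.mul_apply, Module.End.mul_apply]
  simp only [levelAd_levelMk, ← map_sub]
  congr 1
  have hjac := A.jacobi 0 0 a ha b hb x.1
  have hleib := A.leibniz 0 a ha b
  have hskew := A.bracket_skew 1 0 _ (A.d_mem 0 a ha) b hb
  simp only [mul_zero, Int.negOnePow_zero, one_smul] at hjac hleib hskew
  ext
  · simp only [adIncorporated, LinearMap.coe_mk, AddHom.coe_mk, Prod.fst_sub, map_sub, map_smul,
      hjac, hleib, hskew]
    module
  · simp [adIncorporated]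

variable (F m) in
/-- The operators of positive filtration on the quotient of `L[d]` by `F_m L`. -/
def positiveOperators : Submodule k (Module.End k (Level F m)) := (F.F 1).map (levelAd F m)

theorem levelAd_mem_positiveOperators {b : L} (hb : b ∈ A.deg 0) :
    levelAd F m b ∈ positiveOperators F m :=
  Submodule.mem_map_of_mem (F.deg_zero_le hb)

theorem apply_mem_of_mem_positiveOperators_pow {n : ℕ} :
    ∀ φ ∈ positiveOperators F m ^ (n + 1), ∀ v,
      φ v ∈ ((F.F (n + 1)).prod (⊥ : Submodule k k)).map (levelMk F m) := by
  induction n with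
  | zero =>
    intro φ hφ v
    rw [zero_add, pow_one] at hφ
    obtain ⟨b, hb, rfl⟩ := hφ
    obtain ⟨x, rfl⟩ := Submodule.mkQ_surjective _ v
    refine Submodule.mem_map_of_mem (Submodule.mem_prod.2 ⟨?_, rfl⟩)
    have h := F.bracket_mem 1 0 b hb x.1 (F.F_zero ▸ Submodule.mem_top)
    exact sub_mem h (Submodule.smul_mem _ x.2 (F.d_mem 1 b hb))
  | succ n ih =>
    intro φ hφ v
    rw [pow_succ'] at hφ
    induction hφ using Submodule.mul_induction_on' with
    | mem_mul_mem φ hφ ψ hψ =>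
      obtain ⟨b, hb, rfl⟩ := hφ
      obtain ⟨x, hx, hxv⟩ := ih ψ hψ v
      obtain ⟨hx, hx'⟩ := Submodule.mem_prod.1 hx
      rw [Submodule.mem_bot] at hx'
      rw [Module.End.mul_apply, ← hxv, levelAd_levelMk]
      refine Submodule.mem_map_of_mem (Submodule.mem_prod.2 ⟨?_, rfl⟩)
      have h := F.bracket_mem 1 (n + 1) b hb _ hx
      rw [add_comm] at h
      simpa [adIncorporated, hx'] using h
    | add φ _ ψ _ hφ hψ => exact add_mem hφ hψ

theorem positiveOperators_pow_eq_bot : positiveOperators F m ^ (m + 1) = ⊥ := by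
  refine (Submodule.eq_bot_iff _).2 fun φ hφ => LinearMap.ext fun v => ?_
  obtain ⟨x, hx, hxv⟩ := apply_mem_of_mem_positiveOperators_pow φ hφ v
  obtain ⟨hx, hx'⟩ := Submodule.mem_prod.1 hx
  rw [← hxv, LinearMap.zero_apply, ← map_zero (levelMk F m), levelMk_eq_iff]
  exact ⟨hx', by simpa using F.anti m.le_succ hx⟩

theorem levelAd_pow_eq_zero {b : L} (hb : b ∈ A.deg 0) : levelAd F m b ^ (m + 1) = 0 := by
  have h := Submodule.pow_mem_pow _ (levelAd_mem_positiveOperators (F := F) (m := m) hb) (m + 1)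
  rwa [positiveOperators_pow_eq_bot, Submodule.mem_bot] at h

theorem isNilpotent_levelAd {b : L} (hb : b ∈ A.deg 0) : IsNilpotent (levelAd F m b) :=
  ⟨m + 1, levelAd_pow_eq_zero hb⟩

variable [CharZero k]

instance : Module ℚ (Level F m) := Module.compHom _ (algebraMap ℚ k)

instance : IsScalarTower ℚ k (Level F m) where
  smul_assoc q c v := by
    rw [Algebra.smul_def, mul_smul]
    rfl

theorem exp_levelAd_levelMk {b : L} (hb : b ∈ A.deg 0) (p : L) {n : ℕ} (hn : m < n) :
    IsNilpotent.exp (levelAd F m b) (levelMk F m (p, 1)) =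
      levelMk F m (expPartialSum A b p n) := by
  rw [IsNilpotent.exp_eq_sum (pow_eq_zero_of_le hn (levelAd_pow_eq_zero hb)), expPartialSum,
    map_sum, LinearMap.sum_apply]
  refine sum_congr rfl fun i _ => ?_
  rw [inv_natCast_smul_eq ℚ k, LinearMap.smul_apply, levelAd_pow_levelMk, map_smul]

theorem gaugeAct_iff {b p q : L} (hb : b ∈ A.deg 0) :
    GaugeAct F b p q ↔ ∀ m, IsNilpotent.exp (levelAd F m b) (levelMk F m (p, 1)) =
      levelMk F m (q, 1) := by
  refine forall_congr' fun m => ⟨fun ⟨n₀, h⟩ => ?_, fun h => ⟨m + 1, fun n hn => ?_⟩⟩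
  · have hn := h (max n₀ (m + 1)) (le_max_left _ _)
    rwa [exp_levelAd_levelMk hb p (le_max_right n₀ (m + 1)), levelMk_eq_iff]
  · rwa [exp_levelAd_levelMk hb p hn, levelMk_eq_iff] at h

variable (F) in
theorem gaugeEquivalent_refl (p : MaurerCartan A) : GaugeEquivalent F p p :=
  ⟨0, zero_mem _, (gaugeAct_iff (zero_mem _)).2 fun m => by simp⟩

theorem GaugeEquivalent.symm {p q : MaurerCartan A} (h : GaugeEquivalent F p q) :
    GaugeEquivalent F q p := by
  obtain ⟨b, hb, h⟩ := h
  rw [gaugeAct_iff hb] at h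
  refine ⟨-b, neg_mem hb, (gaugeAct_iff (neg_mem hb)).2 fun m => ?_⟩
  rw [← h, map_neg, ← Module.End.mul_apply, IsNilpotent.exp_neg_mul_exp_self
    (isNilpotent_levelAd hb), Module.End.one_apply]

/-! ### Flows integrate to gauge transformations -/

variable (F) in
/-- The series of the `c n` converges to `y` in the topology of the filtration. -/
def SumsTo (c : ℕ → L) (y : L) : Prop :=
  ∀ m, ∃ n₀, ∀ n ≥ n₀, ∑ i ∈ range n, c i - y ∈ F.F m

omit [CharZero k] in
theorem exists_sumsTo {i : ℤ} {c : ℕ → L} (hc : ∀ n, c n ∈ A.deg i) {w : ℕ → ℕ}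
    (hw : Monotone w) (hcw : ∀ m, ∀ n ≥ w m, c n ∈ F.F m) : ∃ y ∈ A.deg i, SumsTo F c y := by
  have hdiff {m a b : ℕ} (ha : w m ≤ a) (hab : a ≤ b) :
      ∑ i ∈ range b, c i - ∑ i ∈ range a, c i ∈ F.F m := by
    rw [← sum_range_add_sum_Ico _ hab, add_sub_cancel_left]
    exact Submodule.sum_mem _ fun j hj => hcw m j (ha.trans (mem_Ico.1 hj).1)
  obtain ⟨y, hy, h⟩ := F.complete i (fun m => ∑ n ∈ range (w m), c n)
    (fun m => Submodule.sum_mem _ fun n _ => hc n) (fun m => hdiff le_rfl (hw m.le_succ))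
  refine ⟨y, hy, fun m => ⟨w m, fun n hn => ?_⟩⟩
  simpa using sub_mem (hdiff le_rfl hn) (h m)

variable (F m) in
/-- The polynomial with coefficients `levelAd (x n)` for `n < N`. -/
def levelPolynomial (N : ℕ) (x : ℕ → L) : Polynomial (Module.End k (Level F m)) :=
  ∑ n ∈ range N, Polynomial.monomial n (levelAd F m (x n))

omit [CharZero k] in
theorem coeff_levelPolynomial {N : ℕ} {x : ℕ → L} (hx : ∀ n ≥ N, x n ∈ F.F m) (n : ℕ) :
    (levelPolynomial F m N x).coeff n = levelAd F m (x n) := by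
  simp only [levelPolynomial, Polynomial.finsetSum_coeff, Polynomial.coeff_monomial,
    sum_ite_eq', mem_range]
  split_ifs with h
  · rfl
  · rw [levelAd_eq_zero (hx n (not_lt.1 h))]

theorem coeff_commutator_iterate {c y : ℕ → L} (hc : ∀ n, c n ∈ A.deg 0)
    (hy : ∀ n, y n ∈ A.deg 0) {C Y : Polynomial (Module.End k (Level F m))}
    (hC : ∀ n, C.coeff n = levelAd F m (c n)) (hY : ∀ n, Y.coeff n = levelAd F m (y n)) (i n : ℕ) :
    ((commutator C ^ i) Y).coeff n = levelAd F m ((seriesBracket A.bracket c)^[i] y n) := by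
  have hmem := iterate_seriesBracket_mem (G := fun _ => A.deg 0) (β := A.bracket)
    (fun _ _ x hx y hy => A.bracket_mem 0 0 x hx y hy) hc hy
  induction i generalizing n with
  | zero => exact hY n
  | succ i ih =>
    rw [pow_succ', Module.End.mul_apply, commutator_apply, Polynomial.coeff_sub,
      Polynomial.coeff_mul, Polynomial.coeff_mul, ← Nat.sum_antidiagonal_swap (n := n)
        (f := fun jl => ((commutator C ^ i) Y).coeff jl.1 * C.coeff jl.2),
      ← sum_sub_distrib, Function.iterate_succ_apply', seriesBracket, map_sum]
    refine sum_congr rfl fun jl _ => ?_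
    rw [Prod.fst_swap, Prod.snd_swap, hC, ih, levelAd_bracket (hc _) (hmem _ _)]

theorem derivative_exp_levelPolynomial {b x c : ℕ → L} (hx : ∀ n, x n ∈ A.deg 0)
    (hc : c = seriesIntegral k x) (hb : ∀ n, b n = ∑ i ∈ range (n + 1),
      ((i + 1).factorial : k)⁻¹ • (seriesBracket A.bracket c)^[i] x n)
    {C : Polynomial (Module.End k (Level F m))} (hC : ∀ n, C.coeff n = levelAd F m (c n))
    (hCnil : IsNilpotent C) (n : ℕ) :
    (Polynomial.derivative (IsNilpotent.exp C)).coeff n =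
      ∑ ij ∈ antidiagonal n, levelAd F m (b ij.1) * (IsNilpotent.exp C).coeff ij.2 := by
  let D : Module.End ℚ (Polynomial (Module.End k (Level F m))) :=
    Polynomial.derivative.toAddMonoidHom.toRatLinearMap
  have hc0 : c 0 = 0 := by rw [hc]; rfl
  have hmem : ∀ n, c n ∈ A.deg 0 := by
    rw [hc]
    exact seriesIntegral_mem (G := fun _ => A.deg 0) hx
  have hDC (n : ℕ) : (D C).coeff n = levelAd F m (x n) := by
    change (Polynomial.derivative C).coeff n = _
    have hcast : ((n : Module.End k (Level F m)) + 1) = ((n : k) + 1) • 1 := by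
      rw [add_smul, one_smul, Nat.cast_smul_eq_nsmul, nsmul_one]
    rw [Polynomial.coeff_derivative, hC, hc, seriesIntegral, map_smul, hcast, smul_mul_smul_comm,
      mul_one, inv_mul_cancel₀ n.cast_add_one_ne_zero, one_smul]
  obtain ⟨M, hM⟩ := isNilpotent_commutator hCnil
  have hN : (commutator C ^ (n + 1 + M)) (D C) = 0 := by
    rw [pow_add, hM, mul_zero, LinearMap.zero_apply]
  have h := congrArg (Polynomial.coeff · n) (derivation_exp D
    (fun _ _ => Polynomial.derivative_mul) hCnil hN)
  refine h.trans ?_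
  rw [Polynomial.coeff_mul]
  refine sum_congr rfl fun ij hij => ?_
  have hij := mem_antidiagonal.1 hij
  simp only [Polynomial.finsetSum_coeff, Polynomial.coeff_smul, inv_natCast_smul_eq ℚ k,
    coeff_commutator_iterate hmem hx hC hDC, hb, map_sum, map_smul]
  congr 1
  refine (sum_subset (range_subset_range.2 (by omega)) fun i _ hi => ?_).symm
  rw [iterate_seriesBracket_eq_zero hc0 _ (by simpa using hi), map_zero, smul_zero]

/-- Evaluation at `1` of polynomials with noncommuting coefficients. -/
def evalOne (R : Type*) [Ring R] : Polynomial R →+* R :=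
  Polynomial.eval₂RingHom' (RingHom.id R) 1 fun _ => Commute.one_right _

theorem evalOne_monomial {R : Type*} [Ring R] (n : ℕ) (a : R) :
    evalOne R (Polynomial.monomial n a) = a := by
  simp [evalOne]

theorem evalOne_eq_sum {R : Type*} [Ring R] (p : Polynomial R) {N : ℕ} (h : p.natDegree < N) :
    evalOne R p = ∑ n ∈ range N, p.coeff n :=
  (Polynomial.eval_eq_sum_range' h 1).trans (by simp)

variable (F) in
omit [CharZero k] in
theorem exists_series_logarithm {b : ℕ → L} (hb : ∀ n, b n ∈ A.deg 0) (hbF : ∀ n, b n ∈ F.F n) :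
    ∃ x : ℕ → L, (∀ n, x n ∈ A.deg 0 ⊓ F.F ((n + 1 + 1) / 2)) ∧ ∀ n, b n = ∑ i ∈ range (n + 1),
      ((i + 1).factorial : k)⁻¹ • (seriesBracket A.bracket (seriesIntegral k x))^[i] x n := by
  have hG (i j : ℕ) : ∀ x ∈ A.deg 0 ⊓ F.F ((i + 1) / 2), ∀ y ∈ A.deg 0 ⊓ F.F ((j + 1) / 2),
      A.bracket x y ∈ A.deg 0 ⊓ F.F ((i + j + 1) / 2) := fun x hx y hy =>
    ⟨A.bracket_mem 0 0 x hx.1 y hy.1,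
      F.anti (by omega) (F.bracket_mem _ _ x hx.2 y hy.2)⟩
  refine exists_series_logDeriv_eq hG fun n => ⟨hb n, ?_⟩
  rcases n.eq_zero_or_pos with rfl | hn
  · exact F.deg_zero_le (hb 0)
  · exact F.anti (by omega) (hbF n)

variable (F) in
theorem exists_exp_levelAd_eq_of_flow {b : ℕ → L} (hb : ∀ n, b n ∈ A.deg 0)
    (hbF : ∀ n, b n ∈ F.F n) :
    ∃ y ∈ A.deg 0, ∀ m, ∃ U : Polynomial (Module.End k (Level F m)), U.coeff 0 = 1 ∧
      (∀ n, (Polynomial.derivative U).coeff n =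
        ∑ ij ∈ antidiagonal n, levelAd F m (b ij.1) * U.coeff ij.2) ∧
      evalOne _ U = IsNilpotent.exp (levelAd F m y) := by
  obtain ⟨x, hx, hbx⟩ := exists_series_logarithm F hb hbF
  set c := seriesIntegral k x with hc
  have hcG : ∀ n, c n ∈ A.deg 0 ⊓ F.F ((n + 1) / 2) :=
    seriesIntegral_mem (G := fun n => A.deg 0 ⊓ F.F ((n + 1) / 2)) hx
  have hcF (m : ℕ) : ∀ n ≥ 2 * m, c n ∈ F.F m := fun n hn => F.anti (by omega) (hcG n).2
  obtain ⟨y, hy, hsum⟩ := exists_sumsTo (fun n => (hcG n).1)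
    (monotone_mul_left_of_nonneg (Nat.zero_le 2)) hcF
  refine ⟨y, hy, fun m => ?_⟩
  obtain ⟨n₀, hn₀⟩ := hsum m
  let N := max n₀ (2 * m)
  have hC := coeff_levelPolynomial (N := N) fun n hn => hcF m n ((le_max_right _ _).trans hn)
  have hCnil : IsNilpotent (levelPolynomial F m N c) :=
    isNilpotent_of_coeff_mem positiveOperators_pow_eq_bot fun n => by
      rw [hC]
      exact levelAd_mem_positiveOperators (hcG n).1
  refine ⟨IsNilpotent.exp (levelPolynomial F m N c), ?_,
    derivative_exp_levelPolynomial (fun n => (hx n).1) hc hbx hC hCnil, ?_⟩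
  · have hC0 : Polynomial.constantCoeff (levelPolynomial F m N c) = 0 := by
      rw [Polynomial.constantCoeff_apply, hC, hc, seriesIntegral, map_zero]
    rw [← Polynomial.constantCoeff_apply, IsNilpotent.map_exp hCnil, hC0, IsNilpotent.exp_zero]
  · rw [IsNilpotent.map_exp hCnil, levelPolynomial, map_sum, ← sub_eq_zero.1
      ((map_sub (levelAd F m) _ _).symm.trans (levelAd_eq_zero (hn₀ N (le_max_left _ _)))), map_sum]
    simp only [evalOne_monomial]

omit [CharZero k] in
theorem coeff_derivative_eq_smul (U : Polynomial (Module.End k (Level F m))) (n : ℕ) :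
    (Polynomial.derivative U).coeff n = ((n : k) + 1) • U.coeff (n + 1) := by
  rw [Polynomial.coeff_derivative, ← Nat.cast_succ, ← Nat.cast_succ, ← nsmul_eq_mul',
    Nat.cast_smul_eq_nsmul]

variable (F) in
theorem exists_gaugeAct_of_flow {b : ℕ → L} (hb : ∀ n, b n ∈ A.deg 0) (hbF : ∀ n, b n ∈ F.F n)
    {v : ℕ → L × k} {p q : L} (hv0 : v 0 = (p, 1))
    (hflow : ∀ n : ℕ, ((n : k) + 1) • v (n + 1) =
      ∑ ij ∈ antidiagonal n, adIncorporated A (b ij.1) (v ij.2))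
    (hsum : ∀ m, ∃ n₀, ∀ n ≥ n₀, levelMk F m (∑ i ∈ range n, v i) = levelMk F m (q, 1)) :
    ∃ y ∈ A.deg 0, GaugeAct F y p q := by
  obtain ⟨y, hy, hU⟩ := exists_exp_levelAd_eq_of_flow F hb hbF
  refine ⟨y, hy, (gaugeAct_iff hy).2 fun m => ?_⟩
  obtain ⟨U, hU0, hU', hU1⟩ := hU m
  obtain ⟨n₀, hn₀⟩ := hsum m
  have hvU : ∀ n, levelMk F m (v n) = U.coeff n (levelMk F m (p, 1)) := by
    refine flow_unique (fun n => levelAd F m (b n)) (by rw [hv0, hU0]; rfl) (fun n => ?_)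
      (fun n => ?_)
    · rw [← map_smul, hflow, map_sum]
      rfl
    · rw [← LinearMap.smul_apply, ← coeff_derivative_eq_smul, hU', LinearMap.sum_apply]
      rfl
  rw [← hU1, evalOne_eq_sum U (Nat.lt_of_lt_of_le U.natDegree.lt_succ_self (le_max_right n₀ _)),
    LinearMap.sum_apply, ← hn₀ _ (le_max_left _ (U.natDegree + 1)), map_sum]
  exact sum_congr rfl fun n _ => (hvU n).symm

theorem commutator_monomial_one_pow {R : Type*} [Ring R] [Algebra ℚ R] (a b : R) (i : ℕ) :
    (commutator (Polynomial.monomial 1 a) ^ i) (Polynomial.C b) =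
      Polynomial.monomial i ((commutator a ^ i) b) := by
  induction i with
  | zero => rfl
  | succ i ih =>
    rw [pow_succ', Module.End.mul_apply, ih, commutator_apply, Polynomial.monomial_mul_monomial,
      Polynomial.monomial_mul_monomial, add_comm 1 i, ← map_sub, pow_succ' (commutator a),
      Module.End.mul_apply, commutator_apply]

theorem isNilpotent_monomial_one {R : Type*} [Ring R] {a : R} (ha : IsNilpotent a) :
    IsNilpotent (Polynomial.monomial 1 a) := by
  obtain ⟨n, hn⟩ := ha
  exact ⟨n, by rw [Polynomial.monomial_pow, hn, map_zero]⟩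

theorem coeff_exp_commutator_monomial_one {R : Type*} [Ring R] [Algebra ℚ R] {a : R}
    (ha : IsNilpotent a) (b : R) (n : ℕ) :
    (IsNilpotent.exp (commutator (Polynomial.monomial 1 a)) (Polynomial.C b)).coeff n =
      (n.factorial : ℚ)⁻¹ • (commutator a ^ n) b := by
  have hnil := isNilpotent_commutator (isNilpotent_monomial_one ha)
  obtain ⟨N, hN⟩ := hnil
  rw [← Module.End.smul_def, IsNilpotent.exp_smul_eq_sum (k := N + (n + 1))
    (by rw [pow_add, hN, zero_mul, zero_smul]) ⟨N, hN⟩]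
  simp only [Module.End.smul_def, commutator_monomial_one_pow, Polynomial.finsetSum_coeff,
    Polynomial.coeff_smul, Polynomial.coeff_monomial, smul_ite, smul_zero]
  rw [sum_ite_eq', if_pos (mem_range.2 (by omega))]

theorem derivative_exp_monomial_one {R : Type*} [Ring R] [Algebra ℚ R] {a : R}
    (ha : IsNilpotent a) : Polynomial.derivative (IsNilpotent.exp (Polynomial.monomial 1 a)) =
      Polynomial.C a * IsNilpotent.exp (Polynomial.monomial 1 a) := by
  have hderiv : Polynomial.derivative (Polynomial.monomial 1 a) = Polynomial.C a := by
    simp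
  have h := derivation_exp Polynomial.derivative.toAddMonoidHom.toRatLinearMap
    (fun _ _ => Polynomial.derivative_mul) (isNilpotent_monomial_one ha) (N := 1) (by
      change (commutator _ ^ 1) (Polynomial.derivative (Polynomial.monomial 1 a)) = 0
      rw [hderiv, commutator_monomial_one_pow, pow_one, commutator_apply, sub_self, map_zero])
  refine h.trans ?_
  change (∑ i ∈ range 1, _ • (commutator _ ^ i) (Polynomial.derivative _)) * _ = _
  simp [hderiv]

theorem coeff_zero_exp_monomial_one {R : Type*} [Ring R] [Algebra ℚ R] {a : R}
    (ha : IsNilpotent a) : (IsNilpotent.exp (Polynomial.monomial 1 a)).coeff 0 = 1 := by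
  rw [← Polynomial.constantCoeff_apply, IsNilpotent.map_exp (isNilpotent_monomial_one ha)]
  simp

theorem derivative_exp_mul_exp {R : Type*} [Ring R] [Algebra ℚ R] {a b : R} (ha : IsNilpotent a)
    (hb : IsNilpotent b) :
    Polynomial.derivative (IsNilpotent.exp (Polynomial.monomial 1 a) *
        IsNilpotent.exp (Polynomial.monomial 1 b)) =
      (Polynomial.C a + IsNilpotent.exp (commutator (Polynomial.monomial 1 a)) (Polynomial.C b)) *
        (IsNilpotent.exp (Polynomial.monomial 1 a) *
          IsNilpotent.exp (Polynomial.monomial 1 b)) := by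
  rw [Polynomial.derivative_mul, derivative_exp_monomial_one ha, derivative_exp_monomial_one hb,
    add_mul, ← mul_assoc (IsNilpotent.exp (commutator _) _),
    exp_commutator_apply_mul_exp (isNilpotent_monomial_one ha), mul_assoc, mul_assoc]

theorem levelAd_bracket_pow {a b : L} (ha : a ∈ A.deg 0) (hb : b ∈ A.deg 0) (n : ℕ) :
    levelAd F m ((A.bracket a ^ n) b) = (commutator (levelAd F m a) ^ n) (levelAd F m b) := by
  induction n with
  | zero => rfl
  | succ n ih =>
    have hmem : (A.bracket a ^ n) b ∈ A.deg 0 := Module.End.pow_apply_mem_of_forall_mem n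
      (fun x hx => A.bracket_mem 0 0 a ha x hx) b hb
    rw [pow_succ', Module.End.mul_apply, levelAd_bracket ha hmem, ih, pow_succ' (commutator _),
      Module.End.mul_apply, commutator_apply]

omit [CharZero k] in
theorem bracket_pow_mem_filtration {a b : L} (ha : a ∈ A.deg 0) (hb : b ∈ A.deg 0) :
    ∀ n, (A.bracket a ^ n) b ∈ A.deg 0 ⊓ F.F (n + 1)
  | 0 => ⟨hb, F.deg_zero_le hb⟩
  | n + 1 => by
    obtain ⟨hdeg, hfil⟩ := bracket_pow_mem_filtration ha hb n
    rw [pow_succ', Module.End.mul_apply]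
    exact ⟨A.bracket_mem 0 0 a ha _ hdeg,
      F.anti (by omega) (F.bracket_mem 1 (n + 1) a (F.deg_zero_le ha) _ hfil)⟩

variable (A) in
/-- The coefficients of the logarithmic derivative of `exp (t a) exp (t b)`. -/
def productLogDeriv (a b : L) (n : ℕ) : L :=
  (if n = 0 then a else 0) + dividedPow k (A.bracket a) n b

omit [CharZero k] in
theorem productLogDeriv_mem {a b : L} (ha : a ∈ A.deg 0) (hb : b ∈ A.deg 0) (n : ℕ) :
    productLogDeriv A a b n ∈ A.deg 0 ⊓ F.F n := by
  obtain ⟨hdeg, hfil⟩ := bracket_pow_mem_filtration (F := F) ha hb n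
  refine add_mem ?_ (Submodule.smul_mem _ _ ⟨hdeg, F.anti n.le_succ hfil⟩)
  split_ifs with h
  · rw [h, F.F_zero]
    exact ⟨ha, Submodule.mem_top⟩
  · exact zero_mem _

theorem coeff_derivative_exp_mul_exp_levelAd {a b : L} (ha : a ∈ A.deg 0) (hb : b ∈ A.deg 0)
    {W : Polynomial (Module.End k (Level F m))}
    (hW : W = IsNilpotent.exp (Polynomial.monomial 1 (levelAd F m a)) *
      IsNilpotent.exp (Polynomial.monomial 1 (levelAd F m b))) (n : ℕ) :
    (Polynomial.derivative W).coeff n =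
      ∑ ij ∈ antidiagonal n, levelAd F m (productLogDeriv A a b ij.1) * W.coeff ij.2 := by
  have hanil := isNilpotent_levelAd (F := F) (m := m) ha
  rw [hW, derivative_exp_mul_exp hanil (isNilpotent_levelAd hb), ← hW, Polynomial.coeff_mul]
  refine sum_congr rfl fun ij _ => ?_
  rw [Polynomial.coeff_add, coeff_exp_commutator_monomial_one hanil, Polynomial.coeff_C,
    inv_natCast_smul_eq ℚ k, ← levelAd_bracket_pow ha hb, ← map_smul, productLogDeriv, map_add]
  split_ifs <;> simp [dividedPow_apply]

theorem exists_exp_levelAd_mul {a b : L} (ha : a ∈ A.deg 0) (hb : b ∈ A.deg 0) :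
    ∃ c ∈ A.deg 0, ∀ m, IsNilpotent.exp (levelAd F m a) * IsNilpotent.exp (levelAd F m b) =
      IsNilpotent.exp (levelAd F m c) := by
  have hB := productLogDeriv_mem (F := F) ha hb
  obtain ⟨c, hc, hU⟩ := exists_exp_levelAd_eq_of_flow F (fun n => (hB n).1) (fun n => (hB n).2)
  refine ⟨c, hc, fun m => ?_⟩
  obtain ⟨U, hU0, hU', hU1⟩ := hU m
  have hanil := isNilpotent_levelAd (F := F) (m := m) ha
  have hbnil := isNilpotent_levelAd (F := F) (m := m) hb
  obtain ⟨W, hW⟩ : ∃ W, W = IsNilpotent.exp (Polynomial.monomial 1 (levelAd F m a)) *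
    IsNilpotent.exp (Polynomial.monomial 1 (levelAd F m b)) := ⟨_, rfl⟩
  have hW0 : W.coeff 0 = 1 := by
    rw [hW, Polynomial.mul_coeff_zero, coeff_zero_exp_monomial_one hanil,
      coeff_zero_exp_monomial_one hbnil, one_mul]
  have hW' := coeff_derivative_exp_mul_exp_levelAd ha hb hW
  have hUW : U = W := Polynomial.ext <| flow_unique
    (fun n => LinearMap.mulLeft k (levelAd F m (productLogDeriv A a b n))) (hU0.trans hW0.symm)
    (fun n => (coeff_derivative_eq_smul U n).symm.trans (hU' n))
    (fun n => (coeff_derivative_eq_smul W n).symm.trans (hW' n))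
  rw [← hU1, hUW, hW, map_mul, IsNilpotent.map_exp (isNilpotent_monomial_one hanil),
    IsNilpotent.map_exp (isNilpotent_monomial_one hbnil), evalOne_monomial, evalOne_monomial]

theorem GaugeEquivalent.trans {p q r : MaurerCartan A} (hpq : GaugeEquivalent F p q)
    (hqr : GaugeEquivalent F q r) : GaugeEquivalent F p r := by
  obtain ⟨b, hb, hpq⟩ := hpq
  obtain ⟨a, ha, hqr⟩ := hqr
  rw [gaugeAct_iff hb] at hpq
  rw [gaugeAct_iff ha] at hqr
  obtain ⟨c, hc, hexp⟩ := exists_exp_levelAd_mul (F := F) ha hb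
  exact ⟨c, hc, (gaugeAct_iff hc).2 fun m => by
    rw [← hexp, Module.End.mul_apply, hpq, hqr]⟩

variable (F) in
theorem gaugeEquivalent_equivalence : Equivalence (GaugeEquivalent F) :=
  ⟨gaugeEquivalent_refl F, .symm, .trans⟩

end Gauge

/-! ### Paths of Maurer-Cartan elements -/

section Paths

variable {k : Type*} [Field k] {L : Type*} [AddCommGroup L] [Module k L]
variable {A : DGLieAlgebra k L} {F : CompleteFiltration A}

variable (F) in
/-- The degree one elements `∑ P_n t^n + ∑ B_n t^n dt` of the completed tensor product of `L` with
the polynomial forms on the line which satisfy the Maurer-Cartan equation; its components along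
`t^n` and `t^n dt` are the last two fields. -/
structure IsPath (P B : ℕ → L) : Prop where
  P_deg : ∀ n, P n ∈ A.deg 1
  P_mem : ∀ n, P n ∈ F.F n
  B_deg : ∀ n, B n ∈ A.deg 0
  B_mem : ∀ n, B n ∈ F.F n
  maurerCartan : ∀ n, A.d (P n) + (2 : k)⁻¹ • seriesBracket A.bracket P P n = 0
  flow : ∀ n : ℕ, ((n : k) + 1) • P (n + 1) = seriesBracket A.bracket B P n - A.d (B n)

variable (F) in
/-- The path `∑ P_n t^n` leads from `p` at `t = 0` to `q` at `t = 1`. -/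
structure PathJoins (P : ℕ → L) (p q : L) : Prop where
  zero : P 0 = p
  sum : SumsTo F P q

theorem SumsTo.sub_mem {c : ℕ → L} {y : L} (h : SumsTo F c y) (hc : ∀ n, c n ∈ F.F n) (N : ℕ) :
    ∑ i ∈ range N, c i - y ∈ F.F N := by
  obtain ⟨n₀, h⟩ := h N
  have htail : ∑ i ∈ Ico N (max n₀ N), c i ∈ F.F N :=
    Submodule.sum_mem _ fun i hi => F.anti (mem_Ico.1 hi).1 (hc i)
  have hsum := h _ (le_max_left n₀ N)
  rwa [← sum_range_add_sum_Ico _ (le_max_right n₀ N), add_sub_right_comm,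
    Submodule.add_mem_iff_left _ htail] at hsum

theorem mul_mem_deg_one {b x : L} (hb : b ∈ A.deg 0) (hx : x ∈ A.deg 1) :
    A.bracket b x ∈ A.deg 1 := by
  simpa using A.bracket_mem 0 1 b hb x hx

theorem d_mem_deg_one {b : L} (hb : b ∈ A.deg 0) : A.d b ∈ A.deg 1 := by
  simpa using A.d_mem 0 b hb

theorem bracket_comm_of_mem_deg_one {x y : L} (hx : x ∈ A.deg 1) (hy : y ∈ A.deg 1) :
    A.bracket x y = A.bracket y x := by
  simpa using A.bracket_skew 1 1 x hx y hy

theorem IsPath.exists_gaugeAct [CharZero k] {P B : ℕ → L} {p q : L} (h : IsPath F P B)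
    (hpq : PathJoins F P p q) : ∃ b ∈ A.deg 0, GaugeAct F b p q := by
  refine exists_gaugeAct_of_flow F h.B_deg h.B_mem (v := fun n => (P n, if n = 0 then 1 else 0))
    (by simp [hpq.zero]) (fun n => Prod.ext ?_ ?_) (fun m => ?_)
  · have hB : ∑ ij ∈ antidiagonal n, (if ij.2 = 0 then (1 : k) else 0) • A.d (B ij.1) =
        A.d (B n) :=
      (sum_antidiagonal_eq_right (fun ab hab => by rw [if_neg hab, zero_smul]) n).trans (by simp)
    rw [Prod.smul_fst, h.flow, Prod.fst_sum, seriesBracket, ← hB, ← sum_sub_distrib]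
    rfl
  · simp [Prod.snd_sum, adIncorporated]
  · obtain ⟨n₀, hn₀⟩ := hpq.sum m
    refine ⟨n₀ + 1, fun n hn => levelMk_eq_iff.2 ⟨?_, ?_⟩⟩
    · simp [Prod.snd_sum, Nat.ne_zero_of_lt hn]
    · rw [Prod.fst_sum]
      exact hn₀ n (Nat.le_of_succ_le hn)

variable (A) in
/-- The bracket of two elements `x + c d` and `y + e d` of degree one in `L[d] = L ⊕ k d`. On the
diagonal, at `c = 1`, it is twice the curvature `d x + [x, x] / 2`. -/
def incorporatedBracket : L × k →ₗ[k] L × k →ₗ[k] L :=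
  A.bracket.compl₁₂ (LinearMap.fst k L k) (LinearMap.fst k L k) +
    (LinearMap.lsmul k L).compl₁₂ (LinearMap.snd k L k) (A.d ∘ₗ LinearMap.fst k L k) +
    ((LinearMap.lsmul k L).compl₁₂ (LinearMap.snd k L k) (A.d ∘ₗ LinearMap.fst k L k)).flip

theorem incorporatedBracket_apply (x y : L × k) :
    incorporatedBracket A x y = A.bracket x.1 y.1 + x.2 • A.d y.1 + y.2 • A.d x.1 := rfl

theorem bracket_incorporatedBracket {b : L} (hb : b ∈ A.deg 0) {x y : L × k}
    (hx : x.1 ∈ A.deg 1) :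
    A.bracket b (incorporatedBracket A x y) =
      incorporatedBracket A (adIncorporated A b x) y +
        incorporatedBracket A x (adIncorporated A b y) := by
  have jacobi : A.bracket b (A.bracket x.1 y.1) =
      A.bracket (A.bracket b x.1) y.1 + A.bracket x.1 (A.bracket b y.1) := by
    simpa using A.jacobi 0 1 b hb x.1 hx y.1
  have leibniz (z : L) : A.d (A.bracket b z) = A.bracket (A.d b) z + A.bracket b (A.d z) := by
    simpa using A.leibniz 0 b hb z
  have comm := bracket_comm_of_mem_deg_one (d_mem_deg_one hb) hx
  simp only [incorporatedBracket_apply, adIncorporated, LinearMap.coe_mk, AddHom.coe_mk, map_add,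
    map_sub, map_smul, LinearMap.sub_apply, LinearMap.smul_apply, jacobi, leibniz, A.d_d, comm,
    smul_zero, zero_smul]
  module

theorem adIncorporated_pow_snd (b p : L) (n : ℕ) :
    ((adIncorporated A b ^ n) (p, (1 : k))).2 = if n = 0 then 1 else 0 := by
  cases n with
  | zero => rfl
  | succ n =>
    rw [pow_succ', Module.End.mul_apply]
    rfl

theorem adIncorporated_pow_mem {b p : L} (hb : b ∈ A.deg 0) (hp : p ∈ A.deg 1) (n : ℕ) :
    ((adIncorporated A b ^ n) (p, (1 : k))).1 ∈ A.deg 1 ⊓ F.F n := by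
  induction n with
  | zero => exact ⟨hp, F.F_zero ▸ Submodule.mem_top⟩
  | succ n ih =>
    have hbF := F.deg_zero_le hb
    rw [pow_succ', Module.End.mul_apply]
    refine Submodule.sub_mem _ ⟨mul_mem_deg_one hb ih.1,
      F.anti (Nat.add_comm n 1).le (F.bracket_mem 1 n b hbF _ ih.2)⟩ ?_
    rw [adIncorporated_pow_snd]
    split_ifs with hn
    · exact Submodule.smul_mem _ _ ⟨d_mem_deg_one hb, hn ▸ F.d_mem 1 b hbF⟩
    · simp

variable [CharZero k]

variable (A) in
/-- The coefficients of the path `exp (t b) (d + p) - d`, which leads from `p` to its image under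
`exp b`. -/
def gaugePath (b p : L) (n : ℕ) : L := (dividedPow k (adIncorporated A b) n (p, 1)).1

omit [CharZero k] in
theorem dividedPow_adIncorporated (b p : L) (n : ℕ) :
    dividedPow k (adIncorporated A b) n (p, 1) = (gaugePath A b p n, if n = 0 then 1 else 0) := by
  refine Prod.ext rfl ?_
  rw [dividedPow_apply, Prod.smul_snd, adIncorporated_pow_snd]
  split_ifs with hn <;> simp [hn]

omit [CharZero k] in
theorem gaugePath_mem {b p : L} (hb : b ∈ A.deg 0) (hp : p ∈ A.deg 1) (n : ℕ) :
    gaugePath A b p n ∈ A.deg 1 ⊓ F.F n :=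
  Submodule.smul_mem _ _ (adIncorporated_pow_mem hb hp n)

theorem succ_smul_gaugePath (b p : L) (n : ℕ) :
    ((n : k) + 1) • gaugePath A b p (n + 1) =
      A.bracket b (gaugePath A b p n) - if n = 0 then A.d b else 0 := by
  refine (congrArg Prod.fst (succ_smul_dividedPow (adIncorporated A b) n (p, 1))).trans ?_
  rw [dividedPow_adIncorporated]
  simp [adIncorporated]

theorem maurerCartan_gaugePath {b p : L} (hb : b ∈ A.deg 0) (hp : p ∈ A.deg 1)
    (hmc : A.d p + (2 : k)⁻¹ • A.bracket p p = 0) (n : ℕ) :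
    A.d (gaugePath A b p n) +
      (2 : k)⁻¹ • seriesBracket A.bracket (gaugePath A b p) (gaugePath A b p) n = 0 := by
  have hQ : incorporatedBracket A (p, (1 : k)) (p, 1) = 0 := by
    have h2 := congrArg ((2 : k) • ·) hmc
    simp only [smul_add, smul_zero, smul_inv_smul₀ (two_ne_zero' k), two_smul] at h2
    rw [incorporatedBracket_apply, one_smul, ← h2]
    abel
  have hsum := sum_antidiagonal_dividedPow (Q := incorporatedBracket A)
    (S := (A.deg 1).prod ⊤) (S' := ⊤) (φ' := adIncorporated A b)
    (fun x hx => ⟨sub_mem (mul_mem_deg_one hb hx.1)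
      (Submodule.smul_mem _ _ (d_mem_deg_one hb)), Submodule.mem_top⟩)
    (fun _ _ => Submodule.mem_top)
    (fun x hx y _ => bracket_incorporatedBracket hb hx.1 (y := y))
    (x := (p, 1)) (y := (p, 1)) ⟨hp, Submodule.mem_top⟩ Submodule.mem_top n
  have hleft : ∑ ij ∈ antidiagonal n, (if ij.1 = 0 then (1 : k) else 0) •
      A.d (gaugePath A b p ij.2) = A.d (gaugePath A b p n) :=
    (sum_antidiagonal_eq_left (fun ab hab => by rw [if_neg hab, zero_smul]) n).trans (by simp)
  have hright : ∑ ij ∈ antidiagonal n, (if ij.2 = 0 then (1 : k) else 0) •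
      A.d (gaugePath A b p ij.1) = A.d (gaugePath A b p n) :=
    (sum_antidiagonal_eq_right (fun ab hab => by rw [if_neg hab, zero_smul]) n).trans (by simp)
  simp only [dividedPow_adIncorporated, incorporatedBracket_apply, sum_add_distrib, hleft, hright,
    hQ, map_zero, add_assoc, ← two_smul k] at hsum
  rw [← inv_smul_smul₀ (two_ne_zero' k) (A.d _), ← smul_add, add_comm]
  exact (congrArg _ hsum).trans (smul_zero _)

theorem isPath_gaugePath {b p : L} (hb : b ∈ A.deg 0) (hp : p ∈ A.deg 1)
    (hmc : A.d p + (2 : k)⁻¹ • A.bracket p p = 0) :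
    IsPath F (gaugePath A b p) fun n => if n = 0 then b else 0 where
  P_deg n := (gaugePath_mem (F := F) hb hp n).1
  P_mem n := (gaugePath_mem hb hp n).2
  B_deg n := by
    split_ifs
    exacts [hb, zero_mem _]
  B_mem n := by
    split_ifs with hn
    · exact hn ▸ F.F_zero ▸ Submodule.mem_top
    · exact zero_mem _
  maurerCartan := maurerCartan_gaugePath hb hp hmc
  flow n := by
    rw [succ_smul_gaugePath, seriesBracket,
      sum_antidiagonal_eq_left fun ab hab => by rw [if_neg hab, map_zero, LinearMap.zero_apply]]
    congr 1
    split_ifs <;> simp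

omit [CharZero k] in
theorem pathJoins_gaugePath {b p q : L} (h : GaugeAct F b p q) :
    PathJoins F (gaugePath A b p) p q where
  zero := by simp [gaugePath]
  sum m := by
    obtain ⟨n₀, hn₀⟩ := h m
    refine ⟨n₀, fun n hn => ?_⟩
    have hq := (hn₀ n hn).2
    rwa [expPartialSum, Prod.fst_sum] at hq

theorem gaugeEquivalent_iff_exists_path {p q : MaurerCartan A} :
    GaugeEquivalent F p q ↔ ∃ P B : ℕ → L, IsPath F P B ∧ PathJoins F P p.1 q.1 :=
  ⟨fun ⟨_, hb, h⟩ => ⟨_, _, isPath_gaugePath hb p.2.1 p.2.2, pathJoins_gaugePath h⟩,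
    fun ⟨_, _, hP, hpq⟩ => hP.exists_gaugeAct hpq⟩

end Paths

/-! ### Convolution on the tensor coalgebra -/

section TensorMaps

variable {k : Type*} [Field k] {L : Type*} [AddCommGroup L] [Module k L]

theorem mem_span_word (t : TensorAlgebra k L) :
    t ∈ Submodule.span k (Set.range (word (k := k) (L := L))) := by
  induction t using TensorAlgebra.induction with
  | algebraMap r =>
    rw [Algebra.algebraMap_eq_smul_one]
    exact Submodule.smul_mem _ _ (Submodule.subset_span ⟨[], rfl⟩)
  | ι x => exact Submodule.subset_span ⟨[x], by simp [word]⟩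
  | mul a b ha hb =>
    have hab := Submodule.mul_mem_mul ha hb
    rw [Submodule.span_mul_span] at hab
    refine Submodule.span_mono ?_ hab
    rintro _ ⟨_, ⟨l, rfl⟩, _, ⟨l', rfl⟩, rfl⟩
    exact ⟨l ++ l', word_append l l'⟩
  | add a b ha hb => exact add_mem ha hb

theorem linearMap_ext_word {M : Type*} [AddCommGroup M] [Module k M]
    {f g : TensorAlgebra k L →ₗ[k] M} (h : ∀ l, f (word l) = g (word l)) : f = g :=
  LinearMap.ext_on (Submodule.eq_top_iff'.2 mem_span_word) (by rintro _ ⟨l, rfl⟩; exact h l)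

theorem linearMap_ext_ι_mul {M : Type*} [AddCommGroup M] [Module k M]
    {f g : TensorAlgebra k L →ₗ[k] M} (h1 : f 1 = g 1)
    (h : ∀ x t, f t = g t → f (TensorAlgebra.ι k x * t) = g (TensorAlgebra.ι k x * t)) : f = g :=
  linearMap_ext_word fun l => by
    induction l with
    | nil => exact h1
    | cons x l ih => exact h x _ ih

theorem counit_ι_mul (x : L) (t : TensorAlgebra k L) :
    TensorAlgebra.algebraMapInv (R := k) (TensorAlgebra.ι k x * t) = 0 := by
  simp [TensorAlgebra.algebraMapInv]

theorem lengthTwo_one : lengthTwo k L 1 = 0 := lengthTwo_word_nil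

theorem lengthTwo_ι_mul (x : L) (t : TensorAlgebra k L) :
    lengthTwo k L (TensorAlgebra.ι k x * t) = x ⊗ₜ[k] cogenerator k L t :=
  LinearMap.congr_fun (f := lengthTwo k L ∘ₗ LinearMap.mulLeft k (TensorAlgebra.ι k x))
    (g := TensorProduct.mk k L L x ∘ₗ cogenerator k L)
    (linearMap_ext_word fun l => lengthTwo_word_cons x l) t

section Convolution

variable {R : Type*} [Ring R] [Algebra k R]

/-- The convolution product of linear maps from the tensor coalgebra to an algebra. -/
def convolution (f g : TensorAlgebra k L →ₗ[k] R) : TensorAlgebra k L →ₗ[k] R :=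
  LinearMap.mul' k R ∘ₗ TensorProduct.map f g ∘ₗ deconcatenation k L

variable (f g : TensorAlgebra k L →ₗ[k] R)

theorem convolution_one : convolution f g 1 = f 1 * g 1 := by
  simp [convolution, deconcatenation_one]

theorem convolution_ι_mul (x : L) (t : TensorAlgebra k L) :
    convolution f g (TensorAlgebra.ι k x * t) = f 1 * g (TensorAlgebra.ι k x * t) +
      convolution (f ∘ₗ LinearMap.mulLeft k (TensorAlgebra.ι k x)) g t := by
  have hmul : TensorProduct.map f g ∘ₗ LinearMap.mulLeft k (TensorAlgebra.ι k x ⊗ₜ[k] 1) =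
      TensorProduct.map (f ∘ₗ LinearMap.mulLeft k (TensorAlgebra.ι k x)) g :=
    TensorProduct.ext' fun a b => by simp
  simp only [convolution, LinearMap.comp_apply, deconcatenation_ι_mul, map_add, ← hmul]
  simp

theorem convolution_add_left (f' : TensorAlgebra k L →ₗ[k] R) :
    convolution (f + f') g = convolution f g + convolution f' g := by
  rw [convolution, TensorProduct.map_add_left, LinearMap.add_comp, LinearMap.comp_add]
  rfl

theorem convolution_smul_left (c : k) : convolution (c • f) g = c • convolution f g := by
  rw [convolution, TensorProduct.map_smul_left, LinearMap.smul_comp, LinearMap.comp_smul]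
  rfl

theorem convolution_mulLeft_comp (a : R) :
    convolution (LinearMap.mulLeft k a ∘ₗ f) g = LinearMap.mulLeft k a ∘ₗ convolution f g := by
  have hmul : LinearMap.mul' k R ∘ₗ TensorProduct.map (LinearMap.mulLeft k a ∘ₗ f) g =
      LinearMap.mulLeft k a ∘ₗ LinearMap.mul' k R ∘ₗ TensorProduct.map f g :=
    TensorProduct.ext' fun b c => by simp [mul_assoc]
  rw [convolution, ← LinearMap.comp_assoc, hmul]
  rfl

theorem convolution_counit : convolution (Algebra.linearMap k R ∘ₗ
    (TensorAlgebra.algebraMapInv (R := k) (M := L)).toLinearMap) g = g := by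
  refine linearMap_ext_ι_mul (by simp [convolution_one]) fun x t _ => ?_
  have hcounit : (Algebra.linearMap k R ∘ₗ TensorAlgebra.algebraMapInv.toLinearMap) ∘ₗ
      LinearMap.mulLeft k (TensorAlgebra.ι k x) = 0 :=
    LinearMap.ext fun t => by simp [counit_ι_mul]
  rw [convolution_ι_mul, hcounit]
  simp [convolution]

end Convolution

/-- The map that sends `x ⊗ w` to `φ x ⊗ w` for `x` of length one. -/
def mapFirst (φ : L →ₗ[k] L) : TensorAlgebra k L →ₗ[k] TensorAlgebra k L :=
  convolution (TensorAlgebra.ι k ∘ₗ φ ∘ₗ cogenerator k L) LinearMap.id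

theorem mapFirst_one (φ : L →ₗ[k] L) : mapFirst φ 1 = 0 := by
  simp [mapFirst, convolution_one, cogenerator_one]

theorem mapFirst_ι_mul (φ : L →ₗ[k] L) (x : L) (t : TensorAlgebra k L) :
    mapFirst φ (TensorAlgebra.ι k x * t) = TensorAlgebra.ι k (φ x) * t := by
  have hx : (TensorAlgebra.ι k ∘ₗ φ ∘ₗ cogenerator k L) ∘ₗ
      LinearMap.mulLeft k (TensorAlgebra.ι k x) =
      LinearMap.mulLeft k (TensorAlgebra.ι k (φ x)) ∘ₗ Algebra.linearMap k _ ∘ₗ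
        TensorAlgebra.algebraMapInv.toLinearMap := by
    ext t
    simp [cogenerator_ι_mul, ← Algebra.commutes, Algebra.smul_def]
  rw [mapFirst, convolution_ι_mul, hx, convolution_mulLeft_comp, convolution_counit]
  simp [cogenerator_one]

theorem mapFirst_id (t : TensorAlgebra k L) : mapFirst LinearMap.id t =
    t - algebraMap k _ (TensorAlgebra.algebraMapInv (R := k) (M := L) t) := by
  refine LinearMap.congr_fun (f := mapFirst LinearMap.id) (g := LinearMap.id -
    Algebra.linearMap k _ ∘ₗ TensorAlgebra.algebraMapInv.toLinearMap)
    (linearMap_ext_ι_mul ?_ fun x t _ => ?_) t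
  · simp [mapFirst_one]
  · simp [mapFirst_ι_mul, counit_ι_mul]

theorem counit_mapFirst (φ : L →ₗ[k] L) (t : TensorAlgebra k L) :
    TensorAlgebra.algebraMapInv (R := k) (mapFirst φ t) = 0 :=
  LinearMap.congr_fun (f := TensorAlgebra.algebraMapInv.toLinearMap ∘ₗ mapFirst φ) (g := 0)
    (linearMap_ext_ι_mul (by simp [mapFirst_one]) fun x t _ => by
      simp [mapFirst_ι_mul, counit_ι_mul]) t

theorem cogenerator_mapFirst (φ : L →ₗ[k] L) (t : TensorAlgebra k L) :
    cogenerator k L (mapFirst φ t) = φ (cogenerator k L t) :=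
  LinearMap.congr_fun (f := cogenerator k L ∘ₗ mapFirst φ) (g := φ ∘ₗ cogenerator k L)
    (linearMap_ext_ι_mul (by simp [mapFirst_one, cogenerator_one]) fun x t _ => by
      simp [mapFirst_ι_mul, cogenerator_ι_mul]) t

variable {A : DGLieAlgebra k L}

theorem cogeneratingMap_one : cogeneratingMap A 1 = 0 := cogeneratingMap_word_nil

theorem cogeneratingMap_ι_mul (x : L) (t : TensorAlgebra k L) :
    cogeneratingMap A (TensorAlgebra.ι k x * t) = (2 : k)⁻¹ • A.bracket (A.parity x)
      (cogenerator k L t) - TensorAlgebra.algebraMapInv t • A.d x := by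
  simp [cogeneratingMap, lengthTwo_ι_mul, cogenerator_ι_mul]

theorem coderivation_eq_convolution :
    coderivation A = convolution (tensorParity A)
      (convolution (TensorAlgebra.ι k ∘ₗ cogeneratingMap A) LinearMap.id) := by
  rw [coderivation, deconcatenation₃, ← LinearMap.comp_assoc (deconcatenation k L),
    ← TensorProduct.map_comp]
  rfl

theorem coderivation_one : coderivation A 1 = 0 := by
  simp [coderivation_eq_convolution, convolution_one, cogeneratingMap_one]

theorem convolution_cogeneratingMap_ι_mul (x : L) (t : TensorAlgebra k L) :
    convolution (TensorAlgebra.ι k ∘ₗ cogeneratingMap A) LinearMap.id (TensorAlgebra.ι k x * t) =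
      (2 : k)⁻¹ • mapFirst (A.bracket (A.parity x)) t - TensorAlgebra.ι k (A.d x) * t := by
  have hx : (TensorAlgebra.ι k ∘ₗ cogeneratingMap A) ∘ₗ
      LinearMap.mulLeft k (TensorAlgebra.ι k x) =
      (2 : k)⁻¹ • (TensorAlgebra.ι k ∘ₗ A.bracket (A.parity x) ∘ₗ cogenerator k L) +
        LinearMap.mulLeft k (TensorAlgebra.ι k (-A.d x)) ∘ₗ Algebra.linearMap k _ ∘ₗ
          TensorAlgebra.algebraMapInv.toLinearMap := by
    ext t
    simp [cogeneratingMap_ι_mul, ← Algebra.commutes, Algebra.smul_def, sub_eq_add_neg]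
  rw [convolution_ι_mul, hx, convolution_add_left, convolution_smul_left,
    convolution_mulLeft_comp, convolution_counit]
  simp [cogeneratingMap_one, mapFirst, sub_eq_add_neg]

theorem coderivation_ι_mul (x : L) (t : TensorAlgebra k L) :
    coderivation A (TensorAlgebra.ι k x * t) =
      TensorAlgebra.ι k (suspendedParity A x) * coderivation A t - TensorAlgebra.ι k (A.d x) * t +
        (2 : k)⁻¹ • mapFirst (A.bracket (A.parity x)) t := by
  have hx : tensorParity A ∘ₗ LinearMap.mulLeft k (TensorAlgebra.ι k x) =
      LinearMap.mulLeft k (TensorAlgebra.ι k (suspendedParity A x)) ∘ₗ tensorParity A := by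
    ext t
    simp [tensorParity]
  rw [coderivation_eq_convolution, convolution_ι_mul, hx, convolution_mulLeft_comp,
    convolution_cogeneratingMap_ι_mul]
  simp only [tensorParity, AlgHom.toLinearMap_apply, map_one, one_mul, LinearMap.comp_apply,
    LinearMap.mulLeft_apply]
  abel

theorem counit_coderivation (t : TensorAlgebra k L) :
    TensorAlgebra.algebraMapInv (R := k) (coderivation A t) = 0 :=
  LinearMap.congr_fun (f := TensorAlgebra.algebraMapInv.toLinearMap ∘ₗ coderivation A) (g := 0)
    (linearMap_ext_ι_mul (by simp [coderivation_one]) fun x t _ => by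
      simp [coderivation_ι_mul, counit_ι_mul, counit_mapFirst]) t

theorem cogenerator_coderivation (t : TensorAlgebra k L) :
    cogenerator k L (coderivation A t) = cogeneratingMap A t := by
  refine LinearMap.congr_fun (f := cogenerator k L ∘ₗ coderivation A)
    (linearMap_ext_ι_mul (by simp [coderivation_one, cogeneratingMap_one]) fun x t _ => ?_) t
  simp only [LinearMap.comp_apply, coderivation_ι_mul, cogeneratingMap_ι_mul, map_add, map_sub,
    map_smul, cogenerator_ι_mul, counit_coderivation, cogenerator_mapFirst, zero_smul, zero_sub]
  abel

end TensorMaps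

/-! ### Powers of a family of elements of `L` in the tensor coalgebra -/

section TensorPowers

variable {k : Type*} [Field k] {L : Type*} [AddCommGroup L] [Module k L]
variable {Γ : Type*} [AddCommMonoid Γ] [HasAntidiagonal Γ] [DecidableEq Γ]

variable (k) in
/-- The coefficients of the powers of the formal sum `∑ x_γ e^γ` with values in the tensor
algebra. -/
def tensorPow (x : Γ → L) : ℕ → Γ → TensorAlgebra k L
  | 0, γ => if γ = 0 then 1 else 0
  | r + 1, γ => ∑ ab ∈ antidiagonal γ, TensorAlgebra.ι k (x ab.1) * tensorPow x r ab.2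

variable (k) in
/-- The coefficients of the partial sums of the geometric series of `∑ x_γ e^γ`. -/
def tensorSum (x : Γ → L) (N : ℕ) (γ : Γ) : TensorAlgebra k L :=
  ∑ r ∈ range N, tensorPow k x r γ

variable (x : Γ → L)

theorem tensorPow_zero (γ : Γ) : tensorPow k x 0 γ = if γ = 0 then 1 else 0 := rfl

theorem tensorPow_succ (r : ℕ) (γ : Γ) : tensorPow k x (r + 1) γ =
    ∑ ab ∈ antidiagonal γ, TensorAlgebra.ι k (x ab.1) * tensorPow k x r ab.2 := rfl

theorem tensorSum_add_tensorPow (N : ℕ) (γ : Γ) :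
    tensorSum k x N γ + tensorPow k x N γ = tensorSum k x (N + 1) γ :=
  (sum_range_succ _ _).symm

theorem tensorSum_succ (N : ℕ) (γ : Γ) : tensorSum k x (N + 1) γ =
    (if γ = 0 then 1 else 0) +
      ∑ ab ∈ antidiagonal γ, TensorAlgebra.ι k (x ab.1) * tensorSum k x N ab.2 := by
  simp only [tensorSum, mul_sum]
  rw [sum_range_succ', add_comm, sum_comm]
  rfl

theorem tensorPow_apply_zero {Γ : Type*} [AddCommMonoid Γ] [PartialOrder Γ]
    [CanonicallyOrderedAdd Γ] [HasAntidiagonal Γ] [DecidableEq Γ] (x : Γ → L) (r : ℕ) :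
    tensorPow k x r 0 = TensorAlgebra.ι k (x 0) ^ r := by
  induction r with
  | zero => simp [tensorPow_zero]
  | succ r ih => rw [tensorPow_succ, antidiagonal_apply_zero, sum_singleton, ih, pow_succ']

theorem sum_antidiagonal_tensorPow_zero_tmul (f : Γ → TensorAlgebra k L) (γ : Γ) :
    ∑ ab ∈ antidiagonal γ, tensorPow k x 0 ab.1 ⊗ₜ[k] f ab.2 = 1 ⊗ₜ[k] f γ := by
  rw [sum_antidiagonal_eq_left
    (fun ab hab => by rw [tensorPow_zero, if_neg hab, TensorProduct.zero_tmul]), tensorPow_zero,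
    if_pos rfl]

theorem deconcatenation_tensorPow (r : ℕ) (γ : Γ) :
    deconcatenation k L (tensorPow k x r γ) = ∑ ac ∈ antidiagonal r, ∑ ab ∈ antidiagonal γ,
      tensorPow k x ac.1 ab.1 ⊗ₜ[k] tensorPow k x ac.2 ab.2 := by
  induction r generalizing γ with
  | zero =>
    rw [Nat.antidiagonal_zero, sum_singleton, sum_antidiagonal_tensorPow_zero_tmul,
      tensorPow_zero]
    split_ifs
    · exact deconcatenation_one
    · simp
  | succ r ih =>
    rw [Nat.sum_antidiagonal_succ, sum_antidiagonal_tensorPow_zero_tmul]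
    simp only [tensorPow_succ, map_sum, deconcatenation_ι_mul, sum_add_distrib,
      TensorProduct.tmul_sum]
    congr 1
    simp only [ih, mul_sum, Algebra.TensorProduct.tmul_mul_tmul, one_mul, TensorProduct.sum_tmul]
    rw [sum_comm]
    exact sum_congr rfl fun ac _ => sum_antidiagonal_assoc (fun a b c =>
      (TensorAlgebra.ι k (x a) * tensorPow k x ac.1 b) ⊗ₜ[k] tensorPow k x ac.2 c) γ

theorem counit_tensorSum {N : ℕ} (hN : N ≠ 0) (γ : Γ) :
    TensorAlgebra.algebraMapInv (R := k) (tensorSum k x N γ) = if γ = 0 then 1 else 0 := by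
  obtain ⟨N, rfl⟩ := Nat.exists_eq_succ_of_ne_zero hN
  rw [Nat.succ_eq_add_one, tensorSum_succ, map_add, map_sum,
    sum_eq_zero fun _ _ => counit_ι_mul _ _]
  split_ifs <;> simp

theorem sum_antidiagonal_ite_smul {M : Type*} [AddCommGroup M] [Module k M] (f : Γ → M) (γ : Γ) :
    ∑ ab ∈ antidiagonal γ, (if ab.2 = 0 then (1 : k) else 0) • f ab.1 = f γ :=
  (sum_antidiagonal_eq_right (fun ab hab => by rw [if_neg hab, zero_smul]) γ).trans (by simp)

theorem cogenerator_tensorPow (r : ℕ) (γ : Γ) :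
    cogenerator k L (tensorPow k x r γ) = if r = 1 then x γ else 0 := by
  rcases r with _ | _ | r
  · rw [tensorPow_zero]
    split_ifs <;> simp_all [cogenerator_one]
  · rw [tensorPow_succ, map_sum, if_pos rfl]
    simp only [cogenerator_ι_mul, tensorPow_zero,
      apply_ite (TensorAlgebra.algebraMapInv (R := k) (M := L)), map_one, map_zero]
    exact sum_antidiagonal_ite_smul x γ
  · simp [tensorPow_succ, cogenerator_ι_mul, counit_ι_mul]

theorem cogenerator_tensorSum {N : ℕ} (hN : 2 ≤ N) (γ : Γ) :
    cogenerator k L (tensorSum k x N γ) = x γ := by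
  simp only [tensorSum, map_sum, cogenerator_tensorPow]
  rw [sum_ite_eq_of_mem' _ _ _ (mem_range.2 hN)]

variable (A : DGLieAlgebra k L)

/-- The value `∑ 1/2 [(-1)^|x_a| x_a, x_b] - d x_γ` of `cogeneratingMap` on the geometric series
of a family. -/
def curvature (γ : Γ) : L :=
  (2 : k)⁻¹ • ∑ ab ∈ antidiagonal γ, A.bracket (A.parity (x ab.1)) (x ab.2) - A.d (x γ)

variable {A}

theorem cogeneratingMap_tensorSum {N : ℕ} (hN : 3 ≤ N) (γ : Γ) :
    cogeneratingMap A (tensorSum k x N γ) = curvature x A γ := by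
  obtain ⟨N, rfl⟩ := Nat.exists_eq_add_of_le' hN
  rw [tensorSum_succ, map_add, map_sum]
  simp only [cogeneratingMap_ι_mul, counit_tensorSum x (Nat.succ_ne_zero _),
    cogenerator_tensorSum x (by omega : 2 ≤ N + 2), sum_sub_distrib]
  rw [sum_antidiagonal_ite_smul (fun a => A.d (x a)), curvature, smul_sum]
  split_ifs <;> simp [cogeneratingMap_one]

theorem mapFirst_tensorSum_succ (φ : L →ₗ[k] L) (N : ℕ) (γ : Γ) :
    mapFirst φ (tensorSum k x (N + 1) γ) =
      ∑ ab ∈ antidiagonal γ, TensorAlgebra.ι k (φ (x ab.1)) * tensorSum k x N ab.2 := by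
  rw [tensorSum_succ, map_add, map_sum]
  simp only [mapFirst_ι_mul]
  split_ifs <;> simp [mapFirst_one]

theorem coderivation_tensorSum (N : ℕ) (γ : Γ) :
    coderivation A (tensorSum k x (N + 2) γ) =
      ∑ ab ∈ antidiagonal γ, TensorAlgebra.ι k (suspendedParity A (x ab.1)) *
        coderivation A (tensorSum k x (N + 1) ab.2) +
      ∑ ab ∈ antidiagonal γ, TensorAlgebra.ι k (curvature x A ab.1) * tensorSum k x N ab.2 -
      ∑ ab ∈ antidiagonal γ, TensorAlgebra.ι k (A.d (x ab.1)) * tensorPow k x N ab.2 := by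
  have hassoc := sum_antidiagonal_assoc (fun a b c =>
    TensorAlgebra.ι k (A.bracket (A.parity (x a)) (x b)) * tensorSum k x N c) γ
  have hone : coderivation A (if γ = 0 then 1 else 0) = 0 := by
    split_ifs <;> simp [coderivation_one]
  have hd : ∑ ab ∈ antidiagonal γ, TensorAlgebra.ι k (A.d (x ab.1)) * tensorSum k x (N + 1) ab.2 =
      ∑ ab ∈ antidiagonal γ, TensorAlgebra.ι k (A.d (x ab.1)) * tensorSum k x N ab.2 +
      ∑ ab ∈ antidiagonal γ, TensorAlgebra.ι k (A.d (x ab.1)) * tensorPow k x N ab.2 := by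
    simp only [← tensorSum_add_tensorPow, mul_add, sum_add_distrib]
  rw [tensorSum_succ, map_add, map_sum]
  simp only [coderivation_ι_mul, mapFirst_tensorSum_succ, sum_add_distrib, sum_sub_distrib,
    curvature, map_sub, map_smul, map_sum, sub_mul, smul_mul_assoc, sum_mul, ← smul_sum, ← hassoc,
    hone, zero_add, hd]
  abel

end TensorPowers

/-! ### Completions -/

section Completions

variable {k : Type*} [Field k] {M : Type*} [AddCommGroup M] [Module k M]

theorem mkQ_eq_mkQ {S : Submodule k M} {a b : M} :
    Submodule.mkQ S a = Submodule.mkQ S b ↔ a - b ∈ S := by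
  rw [Submodule.mkQ_apply, Submodule.mkQ_apply, Submodule.Quotient.eq]

theorem mkQ_eq_zero {S : Submodule k M} {a : M} : Submodule.mkQ S a = 0 ↔ a ∈ S :=
  Submodule.Quotient.mk_eq_zero S

variable {B : Filtration k M}

theorem completion_eq_mkQ (g : completion B) {m n : ℕ} (h : m ≤ n) {t : M}
    (ht : g.1 n = Submodule.mkQ _ t) : g.1 m = Submodule.mkQ _ t := by
  rw [← g.2 m n h, ht]
  rfl

theorem completion_ext {g g' : completion B} (h : ∀ m ≥ 2, g.1 m = g'.1 m) : g = g' := by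
  refine Subtype.ext (funext fun m => ?_)
  rw [← g.2 m (m + 2) (by omega), ← g'.2 m (m + 2) (by omega), h _ (by omega)]

theorem completionFiltration_zero (hB : B.F 0 = ⊤) : (completionFiltration B).F 0 = ⊤ := by
  refine eq_top_iff.2 fun g _ => ?_
  obtain ⟨t, ht⟩ := Submodule.mkQ_surjective _ (g.1 0)
  exact ht.symm.trans (mkQ_eq_zero.2 (hB ▸ Submodule.mem_top))

theorem completionMap_mem {N : Type*} [AddCommGroup N] [Module k N] {C : Filtration k N}
    {f : M →ₗ[k] N} {s : ℕ} (h : ∀ p, B.F (p + s) ≤ (C.F p).comap f) {p : ℕ} {g : completion B}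
    (hg : g ∈ (completionFiltration B).F (p + s)) :
    completionMap B C f s h g ∈ (completionFiltration C).F p := by
  have hg0 : g.1 (p + s) = 0 := hg
  change Submodule.mapQ _ _ f (h p) (g.1 (p + s)) = 0
  rw [hg0, map_zero]

theorem completedSquare_toCompletion {N : Type*} [AddCommGroup N] [Module k N]
    {C : Filtration k N} {f : M →ₗ[k] N} (hf : ∀ p, B.F p ≤ (C.F p).comap f) (z : M ⊗[k] M) :
    completedSquare B C f hf (toCompletion _ z) = toCompletion _ (TensorProduct.map f f z) := rfl

/-- The closure of the image of a subspace in the completion. -/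
def completionClosure (B : Filtration k M) (S : Submodule k M) : Submodule k (completion B) where
  carrier := {g | ∀ m, ∃ t ∈ S, g.1 m = Submodule.mkQ _ t}
  add_mem' := by
    intro g h hg hh m
    obtain ⟨s, hs, hs'⟩ := hg m
    obtain ⟨t, ht, ht'⟩ := hh m
    exact ⟨s + t, add_mem hs ht, by rw [map_add, ← hs', ← ht']; rfl⟩
  zero_mem' m := ⟨0, zero_mem _, (map_zero _).symm⟩
  smul_mem' := by
    intro c g hg m
    obtain ⟨t, ht, ht'⟩ := hg m
    exact ⟨c • t, S.smul_mem c ht, by rw [map_smul, ← ht']; rfl⟩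

theorem tmul_sub_tmul_mem {N : Type*} [AddCommGroup N] [Module k N] {C : Filtration k N}
    (hB : B.F 0 = ⊤) (hC : C.F 0 = ⊤) {n : ℕ} {a a' : M} {b b' : N} (ha : a - a' ∈ B.F n)
    (hb : b - b' ∈ C.F n) : a ⊗ₜ[k] b - a' ⊗ₜ[k] b' ∈ (tensorFiltration B C).F n := by
  have hsplit : a ⊗ₜ[k] b - a' ⊗ₜ[k] b' = (a - a') ⊗ₜ[k] b + a' ⊗ₜ[k] (b - b') := by
    rw [TensorProduct.sub_tmul, TensorProduct.tmul_sub, sub_add_sub_cancel]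
  rw [hsplit]
  exact add_mem
    (Submodule.subset_span ⟨n, 0, le_rfl, _, ha, _, hC ▸ Submodule.mem_top, rfl⟩)
    (Submodule.subset_span ⟨0, n, n.zero_add.ge, _, hB ▸ Submodule.mem_top, _, hb, rfl⟩)

theorem sum_sub_sum_mem {ι : Type*} {s : Finset ι} {f g : ι → M} {S : Submodule k M}
    (h : ∀ i ∈ s, f i - g i ∈ S) : ∑ i ∈ s, f i - ∑ i ∈ s, g i ∈ S :=
  sum_sub_distrib f g ▸ S.sum_mem h

theorem sum_range_sum_range_sub_mem (S : Submodule k M) (f : ℕ → ℕ → M) (N : ℕ)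
    (h : ∀ i j, N ≤ i + j → f i j ∈ S) :
    (∑ i ∈ range N, ∑ j ∈ range N, f i j) - ∑ n ∈ range N, ∑ ij ∈ antidiagonal n, f ij.1 ij.2
      ∈ S := by
  have hdiag : ∑ n ∈ range N, ∑ ij ∈ antidiagonal n, f ij.1 ij.2 =
      ∑ ij ∈ range N ×ˢ range N with ij.1 + ij.2 < N, f ij.1 ij.2 := by
    rw [← sum_fiberwise_of_maps_to (s := (range N ×ˢ range N).filter _) (t := range N)
      (g := fun ij => ij.1 + ij.2) (fun ij hij => mem_range.2 (mem_filter.1 hij).2)]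
    refine sum_congr rfl fun n hn => sum_congr ?_ fun _ _ => rfl
    ext ij
    simp only [HasAntidiagonal.mem_antidiagonal, mem_filter, mem_product, mem_range] at hn ⊢
    omega
  rw [hdiag, ← sum_product', ← sum_filter_add_sum_filter_not (range N ×ˢ range N)
    (fun ij => ij.1 + ij.2 < N), add_sub_cancel_left]
  exact Submodule.sum_mem _ fun ij hij => h _ _ (not_lt.1 (mem_filter.1 hij).2)

section SeriesMap

variable {g : ℕ → completion B} (hg : ∀ n, g n ∈ (completionFiltration B).F n)

include hg in
theorem sum_smul_apply_eq (a : ℕ → k) {m N : ℕ} (h : m ≤ N) :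
    ∑ n ∈ range N, a n • (g n).1 m = ∑ n ∈ range m, a n • (g n).1 m := by
  rw [← sum_range_add_sum_Ico _ h, add_eq_left]
  refine sum_eq_zero fun n hn => ?_
  have hgn : (g n).1 m = 0 := (completionFiltration B).anti (mem_Ico.1 hn).1 (hg n)
  rw [hgn, smul_zero]

/-- The map `a ↦ ∑ a_n g_n`, for a sequence `g` that tends to zero in the completion. -/
def seriesMap : (ℕ → k) →ₗ[k] completion B where
  toFun a := ⟨fun m => ∑ n ∈ range m, a n • (g n).1 m, fun m N h => by
    simp only [map_sum, map_smul, (g _).2 m N h, sum_smul_apply_eq hg a h]⟩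
  map_add' a b := Subtype.ext <| funext fun m => by
    simp only [Pi.add_apply, add_smul, sum_add_distrib]
    rfl
  map_smul' c a := Subtype.ext <| funext fun m => by
    simp only [Pi.smul_apply, smul_eq_mul, mul_smul, ← smul_sum]
    rfl

theorem seriesMap_apply (a : ℕ → k) (m : ℕ) :
    (seriesMap hg a).1 m = ∑ n ∈ range m, a n • (g n).1 m := rfl

theorem seriesMap_single (n : ℕ) : seriesMap hg (Pi.single n 1) = g n := by
  refine Subtype.ext (funext fun m => ?_)
  rw [seriesMap_apply, ← sum_smul_apply_eq hg _ (le_max_left m (n + 1)),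
    sum_eq_single_of_mem n (mem_range.2 (lt_max_of_lt_right n.lt_succ_self)) fun i _ hi => by
      rw [Pi.single_eq_of_ne hi, zero_smul], Pi.single_eq_same, one_smul]

theorem seriesMap_mem_completionClosure {S : Submodule k M} {a : ℕ → k}
    (h : ∀ n, a n • g n ∈ completionClosure B S) : seriesMap hg a ∈ completionClosure B S := by
  intro m
  choose t ht ht' using fun n => h n m
  refine ⟨∑ n ∈ range m, t n, S.sum_mem fun n _ => ht n, ?_⟩
  rw [map_sum, seriesMap_apply]
  exact sum_congr rfl fun n _ => ht' n

end SeriesMap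

end Completions

/-! ### Length, weight and degree of tensors -/

section TensorFiltrations

variable {k : Type*} [Field k] {L : Type*} [AddCommGroup L] [Module k L] {A : DGLieAlgebra k L}

variable (k L) in
/-- The tensors of length at least `r`. -/
def lengthFiltration (r : ℕ) : Submodule k (TensorAlgebra k L) :=
  Submodule.span k {t | ∃ l : List L, r ≤ l.length ∧ t = word l}

/-- The tensors of weight at least `n` for the filtration of `L`. -/
def weightFiltration (F : CompleteFiltration A) (n : ℕ) : Submodule k (TensorAlgebra k L) :=
  Submodule.span k {t | ∃ l : List (L × ℕ), (∀ a ∈ l, a.1 ∈ F.F a.2) ∧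
    n ≤ (l.map Prod.snd).sum ∧ t = word (l.map Prod.fst)}

theorem mul_mem_of_mem_span {R : Type*} [Semiring R] [Algebra k R] {s : Set R}
    {S : Submodule k R} (a : R) (h : ∀ t ∈ s, a * t ∈ S) {t : R} (ht : t ∈ Submodule.span k s) :
    a * t ∈ S :=
  (Submodule.span_le.2 h : Submodule.span k s ≤ S.comap (LinearMap.mulLeft k a)) ht

theorem ι_mul_mem_lengthFiltration (y : L) {r : ℕ} {t : TensorAlgebra k L}
    (ht : t ∈ lengthFiltration k L r) : TensorAlgebra.ι k y * t ∈ lengthFiltration k L (r + 1) := by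
  refine mul_mem_of_mem_span _ ?_ ht
  rintro _ ⟨l, hl, rfl⟩
  exact Submodule.subset_span ⟨y :: l, by simpa using hl, rfl⟩

theorem mem_lengthFiltration_zero (t : TensorAlgebra k L) : t ∈ lengthFiltration k L 0 := by
  refine Submodule.span_mono ?_ (mem_span_word t)
  rintro _ ⟨l, rfl⟩
  exact ⟨l, Nat.zero_le _, rfl⟩

theorem CompleteFiltration.mem_zero (F : CompleteFiltration A) (y : L) : y ∈ F.F 0 :=
  F.F_zero ▸ Submodule.mem_top

variable {F : CompleteFiltration A}

theorem lengthFiltration_le (m : ℕ) :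
    lengthFiltration k L m ≤ (tensorCoalgebraFiltration F).F m := by
  refine Submodule.span_mono ?_
  rintro _ ⟨l, hl, rfl⟩
  refine ⟨l.map fun y => (y, 0), ?_, Or.inr (by simpa using hl), by simp [Function.comp_def]⟩
  simpa using fun y _ => F.mem_zero y

theorem weightFiltration_le (m : ℕ) :
    weightFiltration F m ≤ (tensorCoalgebraFiltration F).F m := by
  refine Submodule.span_mono ?_
  rintro _ ⟨l, hl, hm, rfl⟩
  exact ⟨l, hl, Or.inl hm, rfl⟩

theorem ι_mul_mem_weightFiltration {y : L} {p n : ℕ} (hy : y ∈ F.F p) {t : TensorAlgebra k L}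
    (ht : t ∈ weightFiltration F n) : TensorAlgebra.ι k y * t ∈ weightFiltration F (p + n) := by
  refine mul_mem_of_mem_span _ ?_ ht
  rintro _ ⟨l, hl, hn, rfl⟩
  exact Submodule.subset_span
    ⟨(y, p) :: l, List.forall_mem_cons.2 ⟨hy, hl⟩, by simpa using hn, rfl⟩

theorem mem_weightFiltration_zero (t : TensorAlgebra k L) : t ∈ weightFiltration F 0 := by
  refine Submodule.span_mono ?_ (mem_span_word t)
  rintro _ ⟨l, rfl⟩
  refine ⟨l.map fun y => (y, 0), ?_, Nat.zero_le _, by simp [Function.comp_def]⟩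
  simpa using fun y _ => F.mem_zero y

theorem tensorCoalgebraFiltration_zero : (tensorCoalgebraFiltration F).F 0 = ⊤ :=
  eq_top_iff.2 fun t _ => weightFiltration_le 0 (mem_weightFiltration_zero t)

theorem ι_mul_mem_tensorCoalgebraFiltration (y : L) {m : ℕ} {t : TensorAlgebra k L}
    (ht : t ∈ (tensorCoalgebraFiltration F).F m) :
    TensorAlgebra.ι k y * t ∈ (tensorCoalgebraFiltration F).F m := by
  refine mul_mem_of_mem_span _ ?_ ht
  rintro _ ⟨l, hl, hm, rfl⟩
  refine Submodule.subset_span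
    ⟨(y, 0) :: l, List.forall_mem_cons.2 ⟨F.mem_zero y, hl⟩, ?_, rfl⟩
  simp only [List.map_cons, List.sum_cons, List.length_cons]
  omega

theorem ι_mul_mem_tensorDeg {y : L} {i m : ℤ} (hy : y ∈ A.deg i) {t : TensorAlgebra k L}
    (ht : t ∈ tensorDeg A m) : TensorAlgebra.ι k y * t ∈ tensorDeg A (i - 1 + m) := by
  refine mul_mem_of_mem_span _ ?_ ht
  rintro _ ⟨l, hl, hm, rfl⟩
  exact Submodule.subset_span
    ⟨(y, i) :: l, List.forall_mem_cons.2 ⟨hy, hl⟩, by simp [hm], rfl⟩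

theorem cogenerator_mem_of_mem_tensorDeg {m : ℤ} {t : TensorAlgebra k L}
    (ht : t ∈ tensorDeg A m) : cogenerator k L t ∈ A.deg (m + 1) := by
  refine (Submodule.span_le.2 ?_ : tensorDeg A m ≤ (A.deg (m + 1)).comap (cogenerator k L)) ht
  rintro _ ⟨l, hl, hm, rfl⟩
  change cogenerator k L _ ∈ A.deg _
  match l, hl, hm with
  | [], _, _ => simp [word_nil, cogenerator_one]
  | [a], hl, hm =>
    have ha : a.2 = m + 1 := by
      simp only [List.map_cons, List.map_nil, List.sum_cons, List.sum_nil] at hm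
      omega
    simpa only [List.map_cons, List.map_nil, cogenerator_word_singleton, ha] using
      hl a (List.mem_singleton_self a)
  | a :: b :: l, _, _ => simp [cogenerator_word_cons_cons]

theorem cogenerator_mem_of_mem_tensorCoalgebraFiltration {m : ℕ} (hm : 2 ≤ m)
    {t : TensorAlgebra k L} (ht : t ∈ (tensorCoalgebraFiltration F).F m) :
    cogenerator k L t ∈ F.F m := by
  refine (Submodule.span_le.2 ?_ :
    (tensorCoalgebraFiltration F).F m ≤ (F.F m).comap (cogenerator k L)) ht
  rintro _ ⟨l, hl, h, rfl⟩
  change cogenerator k L _ ∈ F.F m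
  match l, hl, h with
  | [], _, _ => simp [word_nil, cogenerator_one]
  | [a], hl, h =>
    have ha : m ≤ a.2 := by
      simp only [List.map_cons, List.map_nil, List.sum_cons, List.sum_nil, List.length_cons,
        List.length_nil] at h
      omega
    simpa only [List.map_cons, List.map_nil, cogenerator_word_singleton] using
      F.anti ha (hl a (List.mem_singleton_self a))
  | a :: b :: l, _, _ => simp [cogenerator_word_cons_cons]

section Powers

variable {Γ : Type*} [AddCommMonoid Γ] [HasAntidiagonal Γ] [DecidableEq Γ] {x : Γ → L}

variable (x) in
theorem tensorPow_mem_lengthFiltration (r : ℕ) (γ : Γ) :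
    tensorPow k x r γ ∈ lengthFiltration k L r := by
  induction r generalizing γ with
  | zero => exact mem_lengthFiltration_zero _
  | succ r ih => exact Submodule.sum_mem _ fun ab _ => ι_mul_mem_lengthFiltration _ (ih _)

theorem tensorPow_mem_weightFiltration (w : Γ →+ ℕ) (hx : ∀ γ, x γ ∈ F.F (w γ)) (r : ℕ) (γ : Γ) :
    tensorPow k x r γ ∈ weightFiltration F (w γ) := by
  induction r generalizing γ with
  | zero =>
    rw [tensorPow_zero]
    split_ifs with h
    · rw [h, map_zero]
      exact mem_weightFiltration_zero _
    · exact zero_mem _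
  | succ r ih =>
    refine Submodule.sum_mem _ fun ab hab => ?_
    rw [← HasAntidiagonal.mem_antidiagonal.1 hab, map_add]
    exact ι_mul_mem_weightFiltration (hx ab.1) (ih ab.2)

theorem tensorPow_mem_tensorDeg (e : Γ →+ ℕ) (hx : ∀ γ, x γ ∈ A.deg (1 - e γ)) (r : ℕ) (γ : Γ) :
    tensorPow k x r γ ∈ tensorDeg A (-e γ) := by
  induction r generalizing γ with
  | zero =>
    rw [tensorPow_zero]
    split_ifs with h
    · exact Submodule.subset_span ⟨[], by simp, by simp [h], rfl⟩
    · exact zero_mem _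
  | succ r ih =>
    refine Submodule.sum_mem _ fun ab hab => ?_
    have hdeg : -(e γ : ℤ) = 1 - e ab.1 - 1 + -e ab.2 := by
      rw [← HasAntidiagonal.mem_antidiagonal.1 hab, map_add, Nat.cast_add]
      ring
    exact hdeg ▸ ι_mul_mem_tensorDeg (hx ab.1) (ih ab.2)

theorem lengthTwo_tensorPow (r : ℕ) (γ : Γ) : lengthTwo k L (tensorPow k x r γ) =
    if r = 2 then ∑ ab ∈ antidiagonal γ, x ab.1 ⊗ₜ[k] x ab.2 else 0 := by
  rcases r with _ | r
  · rw [tensorPow_zero]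
    split_ifs <;> simp_all [lengthTwo_one]
  · rw [tensorPow_succ, map_sum]
    simp only [lengthTwo_ι_mul, cogenerator_tensorPow, Nat.reduceEqDiff]
    split_ifs <;> simp

theorem signedSwap_lengthTwo_tensorPow [CharZero k] (e : Γ →+ ℕ)
    (hx : ∀ γ, x γ ∈ A.deg (1 - e γ)) (r : ℕ) {γ : Γ} (hγ : e γ ≤ 1) :
    signedSwap A (lengthTwo k L (tensorPow k x r γ)) = lengthTwo k L (tensorPow k x r γ) := by
  rw [lengthTwo_tensorPow]
  split_ifs
  · rw [map_sum, ← sum_antidiagonal_swap (fun ab => x ab.1 ⊗ₜ[k] x ab.2)]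
    refine sum_congr rfl fun ab hab => ?_
    rw [← HasAntidiagonal.mem_antidiagonal.1 hab, map_add] at hγ
    have hparity : (1 - (e ab.1 : ℤ) - 1) * (1 - (e ab.2 : ℤ) - 1) = 0 := by
      rcases (by omega : e ab.1 = 0 ∨ e ab.2 = 0) with h | h <;> simp [h]
    rw [signedSwap_of_mem _ _ _ _ (hx _) (hx _), hparity]
    simp
  · exact map_zero _

theorem tensorPow_mem_symmetricTensors [CharZero k] (e : Γ →+ ℕ)
    (hx : ∀ γ, x γ ∈ A.deg (1 - e γ)) (r : ℕ) {γ : Γ} (hγ : e γ ≤ 1) :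
    tensorPow k x r γ ∈ symmetricTensors A := by
  rw [symmetricTensors, LinearMap.mem_ker, LinearMap.sub_apply, sub_eq_zero, LinearMap.comp_apply,
    adjacentPairs, deconcatenation₃, LinearMap.comp_apply, LinearMap.comp_apply,
    deconcatenation_tensorPow]
  simp only [map_sum, TensorProduct.map_tmul, deconcatenation_tensorPow, TensorProduct.tmul_sum,
    LinearMap.id_apply]
  refine sum_congr rfl fun ac _ => sum_congr rfl fun ab hab => sum_congr rfl fun _ _ =>
    sum_congr rfl fun cd hcd => ?_
  have hle : e cd.1 ≤ 1 := by
    rw [← HasAntidiagonal.mem_antidiagonal.1 hab, map_add,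
      ← HasAntidiagonal.mem_antidiagonal.1 hcd, map_add] at hγ
    omega
  rw [signedSwap_lengthTwo_tensorPow e hx _ hle]

theorem tensorSum_sub_tensorSum_mem {m N : ℕ} (h : m ≤ N) (γ : Γ) :
    tensorSum k x N γ - tensorSum k x m γ ∈ (tensorCoalgebraFiltration F).F m := by
  rw [tensorSum, tensorSum, ← sum_range_add_sum_Ico _ h, add_sub_cancel_left]
  exact Submodule.sum_mem _ fun r hr => (tensorCoalgebraFiltration F).anti (mem_Ico.1 hr).1
    (lengthFiltration_le r (tensorPow_mem_lengthFiltration x r γ))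

theorem deconcatenation_tensorSum_sub_mem (F : CompleteFiltration A) (x : Γ → L) (N : ℕ) (γ : Γ) :
    ∑ ab ∈ antidiagonal γ, tensorSum k x N ab.1 ⊗ₜ[k] tensorSum k x N ab.2 -
      deconcatenation k L (tensorSum k x N γ) ∈
        (tensorFiltration (tensorCoalgebraFiltration F) (tensorCoalgebraFiltration F)).F N := by
  convert sum_range_sum_range_sub_mem ((tensorFiltration (tensorCoalgebraFiltration F)
    (tensorCoalgebraFiltration F)).F N) (fun a c => ∑ ab ∈ antidiagonal γ,
      tensorPow k x a ab.1 ⊗ₜ[k] tensorPow k x c ab.2) N (fun a c hac =>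
        Submodule.sum_mem _ fun ab _ => Submodule.subset_span ⟨a, c, hac, _,
          lengthFiltration_le _ (tensorPow_mem_lengthFiltration x _ _), _,
          lengthFiltration_le _ (tensorPow_mem_lengthFiltration x _ _), rfl⟩) using 2
  · simp only [tensorSum, TensorProduct.sum_tmul, TensorProduct.tmul_sum]
    refine (sum_congr rfl fun _ _ => sum_comm).trans (sum_comm.trans ?_)
    exact sum_congr rfl fun _ _ => sum_comm
  · rw [tensorSum, map_sum]
    exact sum_congr rfl fun r _ => deconcatenation_tensorPow x r γ

end Powers

end TensorFiltrations

/-! ### The component of length one of an element of the completion -/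

section Levels

variable {k : Type*} [Field k] {L : Type*} [AddCommGroup L] [Module k L] {A : DGLieAlgebra k L}
variable (F : CompleteFiltration A)

/-- The multiplication by `sy`, `y ∈ L`, on the left of `T^c(sL) / G_m`. -/
def levelMul (m : ℕ) : L →ₗ[k] Module.End k
    (TensorAlgebra k L ⧸ (tensorCoalgebraFiltration F).F m) where
  toFun y := Submodule.mapQ _ _ (LinearMap.mulLeft k (TensorAlgebra.ι k y))
    fun _ ht => ι_mul_mem_tensorCoalgebraFiltration y ht
  map_add' y z := Submodule.linearMap_qext _ <| LinearMap.ext fun t =>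
    congrArg (Submodule.mkQ ((tensorCoalgebraFiltration F).F m)) (by simp [add_mul] :
      TensorAlgebra.ι k (y + z) * t = TensorAlgebra.ι k y * t + TensorAlgebra.ι k z * t)
  map_smul' c y := Submodule.linearMap_qext _ <| LinearMap.ext fun t =>
    congrArg (Submodule.mkQ ((tensorCoalgebraFiltration F).F m)) (by simp :
      TensorAlgebra.ι k (c • y) * t = c • (TensorAlgebra.ι k y * t))

theorem levelMul_mk (m : ℕ) (y : L) (t : TensorAlgebra k L) :
    levelMul F m y (Submodule.mkQ _ t) = Submodule.mkQ _ (TensorAlgebra.ι k y * t) := rfl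

variable {F}

theorem levelMul_eq_zero {m : ℕ} {y : L} (hy : y ∈ F.F m) : levelMul F m y = 0 := by
  refine Submodule.linearMap_qext _ (LinearMap.ext fun t => mkQ_eq_zero.2 ?_)
  simpa using weightFiltration_le _ <| ι_mul_mem_weightFiltration hy (mem_weightFiltration_zero t)

theorem eq_zero_of_recursion {Γ : Type*} [AddCommMonoid Γ] [HasAntidiagonal Γ] {x : Γ → L}
    {D : Set Γ} (hD : ∀ γ ∈ D, ∀ ab ∈ antidiagonal γ, ab.2 ∈ D) {m : ℕ}
    {E : Γ → TensorAlgebra k L ⧸ (tensorCoalgebraFiltration F).F m}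
    (hE : ∀ γ ∈ D, E γ = ∑ ab ∈ antidiagonal γ, levelMul F m (x ab.1) (E ab.2)) {γ : Γ}
    (hγ : γ ∈ D) : E γ = 0 := by
  have hmem (r : ℕ) : ∀ γ ∈ D, E γ ∈ (lengthFiltration k L r).map (Submodule.mkQ _) := by
    induction r with
    | zero =>
      intro γ _
      obtain ⟨t, ht⟩ := Submodule.mkQ_surjective _ (E γ)
      exact ⟨t, mem_lengthFiltration_zero t, ht⟩
    | succ r ih =>
      intro γ hγ
      rw [hE γ hγ]
      refine Submodule.sum_mem _ fun ab hab => ?_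
      obtain ⟨t, ht, ht'⟩ := ih _ (hD γ hγ ab hab)
      exact ⟨_, ι_mul_mem_lengthFiltration _ ht, by rw [← ht', levelMul_mk]⟩
  obtain ⟨t, ht, ht'⟩ := hmem m γ hγ
  rw [← ht', mkQ_eq_zero]
  exact lengthFiltration_le m ht

variable (F)

/-- The projection of the completion to `T^c(sL) / G_m`. -/
def levelProj (m : ℕ) : CompletedTensorSpace F →ₗ[k]
    TensorAlgebra k L ⧸ (tensorCoalgebraFiltration F).F m :=
  LinearMap.proj m ∘ₗ Submodule.subtype _

/-- The component of length one of an element of `T^c(sL) / G_m`, as an element of `L / F_m L`. -/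
def levelCogenerator {m : ℕ} (hm : 2 ≤ m) :
    (TensorAlgebra k L ⧸ (tensorCoalgebraFiltration F).F m) →ₗ[k] L ⧸ F.F m :=
  Submodule.mapQ _ _ (cogenerator k L) fun _ ht =>
    cogenerator_mem_of_mem_tensorCoalgebraFiltration hm ht

/-- The component of length one of `g` is `y`. The component of length one is well defined on
`T^c(sL) / G_m` for `m ≥ 2` only, and as `L` itself need not be complete, it need not exist. -/
def HasCogenerator (g : CompletedTensorSpace F) (y : L) : Prop :=
  ∀ (m : ℕ) (hm : 2 ≤ m), levelCogenerator F hm (levelProj F m g) = Submodule.mkQ _ y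

variable {F}

theorem exists_hasCogenerator {i : ℤ} {g : CompletedTensorSpace F}
    (hg : g ∈ (completedTensorCoalgebra F).deg i) : ∃ y ∈ A.deg (i + 1), HasCogenerator F g y := by
  choose t ht hgt using hg
  have hproj {m n : ℕ} (hm : 2 ≤ m) (h : m ≤ n) :
      levelCogenerator F hm (levelProj F m g) = Submodule.mkQ _ (cogenerator k L (t n)) :=
    congrArg (levelCogenerator F hm) (completion_eq_mkQ g h (hgt n))
  obtain ⟨y, hy, hyt⟩ := F.complete (i + 1) (fun p => cogenerator k L (t (p + 2)))
    (fun p => cogenerator_mem_of_mem_tensorDeg (ht _)) fun p => F.anti (by omega : p ≤ p + 2)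
      (mkQ_eq_mkQ.1 ((hproj (by omega) (by omega)).symm.trans (hproj (by omega) le_rfl)))
  exact ⟨y, hy, fun m hm => (hproj hm (by omega)).trans (mkQ_eq_mkQ.2 (hyt m)).symm⟩

namespace HasCogenerator

variable {g g' : CompletedTensorSpace F} {y z : L}

theorem unique {i : ℤ} (hy : y ∈ A.deg i) (hz : z ∈ A.deg i) (h : HasCogenerator F g y)
    (h' : HasCogenerator F g z) : y = z :=
  sub_eq_zero.1 <| F.separated i _ (sub_mem hy hz) fun p => F.anti (by omega : p ≤ p + 2) <|
    mkQ_eq_mkQ.1 ((h _ (by omega)).symm.trans (h' _ (by omega)))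

theorem mem (h : HasCogenerator F g y) {p : ℕ} (hg : CogeneratorMem F p g) : y ∈ F.F p := by
  obtain ⟨t, ht, hgt⟩ := hg (p + 2)
  have hsub : cogenerator k L t - y ∈ F.F (p + 2) :=
    mkQ_eq_mkQ.1 ((congrArg (levelCogenerator F (by omega)) hgt).symm.trans (h _ (by omega)))
  simpa using sub_mem ht (F.anti (by omega) hsub)

theorem zero : HasCogenerator F 0 0 := fun m hm => by simp only [map_zero]

theorem sub (h : HasCogenerator F g y) (h' : HasCogenerator F g' z) :
    HasCogenerator F (g - g') (y - z) := fun m hm => by simp only [map_sub, h m hm, h' m hm]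

theorem smul (c : k) (h : HasCogenerator F g y) : HasCogenerator F (c • g) (c • y) :=
  fun m hm => by simp only [map_smul, h m hm]

theorem sum {ι : Type*} (s : Finset ι) {g : ι → CompletedTensorSpace F} {y : ι → L}
    (h : ∀ i, HasCogenerator F (g i) (y i)) :
    HasCogenerator F (∑ i ∈ s, g i) (∑ i ∈ s, y i) := fun m hm => by
  simp only [map_sum, fun i => h i m hm]

end HasCogenerator

/-! ### The coproduct of the completed tensor coalgebra -/

theorem counit_level {g : CompletedTensorSpace F} {m : ℕ} (hm : 1 ≤ m) {t : TensorAlgebra k L}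
    (ht : g.1 m = Submodule.mkQ _ t) :
    (completedTensorCoalgebra F).counit g = TensorAlgebra.algebraMapInv (R := k) (M := L) t := by
  change Submodule.liftQ _ _ (algebraMapInv_mem F) (g.1 1) = _
  rw [completion_eq_mkQ g hm ht]
  rfl

theorem d_level {g : CompletedTensorSpace F} {m : ℕ} {t : TensorAlgebra k L}
    (ht : g.1 (m + 1) = Submodule.mkQ _ t) :
    ((completedTensorCoalgebra F).d g).1 m = Submodule.mkQ _ (coderivation A t) := by
  change Submodule.mapQ _ _ _ _ (g.1 (m + 1)) = _
  rw [ht]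
  rfl

theorem comul_level {g : CompletedTensorSpace F} {m : ℕ} {t : TensorAlgebra k L}
    (ht : g.1 m = Submodule.mkQ _ t) :
    ((completedTensorCoalgebra F).comul g).1 m = Submodule.mkQ _
      (TensorProduct.map (toCompletion (tensorCoalgebraFiltration F))
        (toCompletion (tensorCoalgebraFiltration F)) (deconcatenation k L t)) := by
  change Submodule.mapQ _ _ _ _ (g.1 m) = _
  rw [ht]
  rfl

theorem DGCoalgebraMap.comul_eq_toCompletion {X Y : Type*} [AddCommGroup X] [Module k X]
    [AddCommGroup Y] [Module k Y] {C : DGCoalgebraData k X} {D : DGCoalgebraData k Y}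
    (f : DGCoalgebraMap C D) {c : X} {z : X ⊗[k] X} (h : C.comul c = toCompletion _ z) :
    D.comul (f.toLin c) = toCompletion _ (TensorProduct.map f.toLin f.toLin z) := by
  rw [← f.map_comul, h, completedSquare_toCompletion]

variable (F)

/-- The map `g ⊗ g' ↦ s(π g) ⊗ g'`, with values in `T^c(sL) / G_m`. -/
def levelFirst {m : ℕ} (hm : 2 ≤ m) : CompletedTensorSpace F ⊗[k] CompletedTensorSpace F →ₗ[k]
    TensorAlgebra k L ⧸ (tensorCoalgebraFiltration F).F m :=
  TensorProduct.lift ((Submodule.liftQ _ (levelMul F m) (fun _ hy => levelMul_eq_zero hy) ∘ₗ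
    levelCogenerator F hm).compl₁₂ (levelProj F m) (levelProj F m))

variable {F}

theorem levelFirst_tmul {m : ℕ} (hm : 2 ≤ m) {g : CompletedTensorSpace F} {y : L}
    (h : HasCogenerator F g y) (g' : CompletedTensorSpace F) :
    levelFirst F hm (g ⊗ₜ[k] g') = levelMul F m y (g'.1 m) := by
  rw [levelFirst, TensorProduct.lift.tmul, LinearMap.compl₁₂_apply, LinearMap.comp_apply, h m hm]
  rfl

theorem levelFirst_map_toCompletion {m : ℕ} (hm : 2 ≤ m)
    (z : TensorAlgebra k L ⊗[k] TensorAlgebra k L) :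
    levelFirst F hm (TensorProduct.map (toCompletion _) (toCompletion _) z) =
      Submodule.mkQ _ (LinearMap.mul' k (TensorAlgebra k L) (TensorProduct.map
        (TensorAlgebra.ι k ∘ₗ LinearMap.id ∘ₗ cogenerator k L) LinearMap.id z)) := by
  induction z using TensorProduct.induction_on with
  | zero => simp only [map_zero]
  | tmul a b => rfl
  | add a b ha hb => simp only [map_add, ha, hb]

theorem tensorFiltration_le_ker_levelFirst {m : ℕ} (hm : 2 ≤ m) :
    (tensorFiltration (completionFiltration (tensorCoalgebraFiltration F))
      (completionFiltration (tensorCoalgebraFiltration F))).F (2 * m) ≤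
        LinearMap.ker (levelFirst F hm) := by
  refine Submodule.span_le.2 ?_
  rintro _ ⟨p, q, hpq, g, hg, g', hg', rfl⟩
  rw [SetLike.mem_coe, LinearMap.mem_ker, levelFirst, TensorProduct.lift.tmul,
    LinearMap.compl₁₂_apply]
  rcases (by omega : m ≤ p ∨ m ≤ q) with h | h
  · have hzero : levelProj F m g = 0 := (completionFiltration _).anti h hg
    rw [hzero, map_zero, LinearMap.zero_apply]
  · have hzero : levelProj F m g' = 0 := (completionFiltration _).anti h hg'
    rw [hzero, map_zero]

theorem level_eq_of_comul {g : CompletedTensorSpace F}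
    {z : CompletedTensorSpace F ⊗[k] CompletedTensorSpace F}
    (hz : (completedTensorCoalgebra F).comul g = toCompletion _ z) {m : ℕ} (hm : 2 ≤ m) :
    g.1 m = Submodule.mkQ _ (algebraMap k _ ((completedTensorCoalgebra F).counit g)) +
      levelFirst F hm z := by
  obtain ⟨t, ht⟩ := Submodule.mkQ_surjective _ (g.1 (2 * m))
  have hmem : TensorProduct.map (toCompletion (tensorCoalgebraFiltration F))
      (toCompletion (tensorCoalgebraFiltration F)) (deconcatenation k L t) - z ∈
      (tensorFiltration (completionFiltration (tensorCoalgebraFiltration F))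
        (completionFiltration (tensorCoalgebraFiltration F))).F (2 * m) :=
    mkQ_eq_mkQ.1 ((comul_level ht.symm).symm.trans (by rw [hz]; rfl))
  have hfirst := tensorFiltration_le_ker_levelFirst hm hmem
  rw [LinearMap.mem_ker, map_sub, sub_eq_zero, levelFirst_map_toCompletion] at hfirst
  have hid := mapFirst_id (k := k) t
  rw [mapFirst, convolution, LinearMap.comp_apply, LinearMap.comp_apply] at hid
  rw [← hfirst, hid, counit_level (by omega) ht.symm, ← map_add, add_sub_cancel]
  exact completion_eq_mkQ g (by omega) ht.symm

end Levels

/-! ### The geometric series of a family of elements of `L` -/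

section TensorSeries

variable {k : Type*} [Field k] {L : Type*} [AddCommGroup L] [Module k L] {A : DGLieAlgebra k L}
variable {Γ : Type*} [AddCommMonoid Γ] [HasAntidiagonal Γ] [DecidableEq Γ]
variable (F : CompleteFiltration A)

/-- The coefficients of the geometric series of `∑ x_γ e^γ`, in the completed tensor coalgebra. -/
def tensorSeries (x : Γ → L) (γ : Γ) : CompletedTensorSpace F :=
  ⟨fun m => Submodule.mkQ _ (tensorSum k x m γ), fun _ _ h =>
    mkQ_eq_mkQ.2 (tensorSum_sub_tensorSum_mem h γ)⟩

variable {F} (x : Γ → L)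

theorem tensorSeries_level {m N : ℕ} (h : m ≤ N) (γ : Γ) :
    (tensorSeries F x γ).1 m = Submodule.mkQ _ (tensorSum k x N γ) :=
  completion_eq_mkQ _ h rfl

theorem tensorSeries_recursion (m : ℕ) (γ : Γ) :
    (tensorSeries F x γ).1 m = Submodule.mkQ _ (if γ = 0 then 1 else 0) +
      ∑ ab ∈ antidiagonal γ, levelMul F m (x ab.1) ((tensorSeries F x ab.2).1 m) := by
  rw [tensorSeries_level x m.le_succ, tensorSum_succ, map_add, map_sum]
  rfl

theorem tensorSeries_zero {Γ : Type*} [AddCommMonoid Γ] [PartialOrder Γ]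
    [CanonicallyOrderedAdd Γ] [HasAntidiagonal Γ] [DecidableEq Γ] (x : Γ → L) :
    tensorSeries F x 0 = groupLike F (x 0) := by
  refine Subtype.ext (funext fun m => congrArg (Submodule.mkQ _) ?_)
  simp only [tensorSum, tensorPow_apply_zero]

variable {x} in
theorem tensorSeries_mem_completionClosure {S : Submodule k (TensorAlgebra k L)} {γ : Γ}
    (h : ∀ r, tensorPow k x r γ ∈ S) :
    tensorSeries F x γ ∈ completionClosure (tensorCoalgebraFiltration F) S :=
  fun _ => ⟨_, S.sum_mem fun r _ => h r, rfl⟩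

variable {x} in
theorem tensorSeries_mem_completionFiltration (w : Γ →+ ℕ) (hx : ∀ γ, x γ ∈ F.F (w γ)) (γ : Γ) :
    tensorSeries F x γ ∈ (completionFiltration (tensorCoalgebraFiltration F)).F (w γ) :=
  mkQ_eq_zero.2 <| Submodule.sum_mem _ fun r _ =>
    weightFiltration_le _ (tensorPow_mem_weightFiltration w hx r γ)

variable {x} in
theorem cogeneratorMem_tensorSeries {γ : Γ} {p : ℕ} (h : x γ ∈ F.F p) :
    CogeneratorMem F p (tensorSeries F x γ) :=
  tensorSeries_mem_completionClosure (S := (F.F p).comap (cogenerator k L)) fun r => by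
    rw [Submodule.mem_comap, cogenerator_tensorPow]
    split_ifs
    exacts [h, zero_mem _]

theorem hasCogenerator_tensorSeries (γ : Γ) : HasCogenerator F (tensorSeries F x γ) (x γ) :=
  fun _ hm => congrArg (Submodule.mkQ _) (cogenerator_tensorSum x hm γ)

theorem counit_tensorSeries (γ : Γ) :
    (completedTensorCoalgebra F).counit (tensorSeries F x γ) = if γ = 0 then 1 else 0 := by
  rw [counit_level le_rfl (tensorSeries_level x le_rfl γ), counit_tensorSum x one_ne_zero]

theorem tensorSeries_sub_toCompletion_mem (m : ℕ) (γ : Γ) :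
    tensorSeries F x γ - toCompletion (tensorCoalgebraFiltration F) (tensorSum k x m γ) ∈
      (completionFiltration (tensorCoalgebraFiltration F)).F m :=
  sub_self (Submodule.mkQ ((tensorCoalgebraFiltration F).F m) (tensorSum k x m γ))

theorem comul_tensorSeries (γ : Γ) :
    (completedTensorCoalgebra F).comul (tensorSeries F x γ) =
      toCompletion _
        (∑ ab ∈ antidiagonal γ, tensorSeries F x ab.1 ⊗ₜ[k] tensorSeries F x ab.2) := by
  have htop := completionFiltration_zero (tensorCoalgebraFiltration_zero (F := F))
  refine Subtype.ext (funext fun m => ?_)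
  rw [comul_level (tensorSeries_level x le_rfl γ)]
  refine Eq.symm (mkQ_eq_mkQ.2 ?_)
  have hsum := tensorFiltration_map _ _ _ _ _ _
    (toCompletion_mem (tensorCoalgebraFiltration F))
    (toCompletion_mem (tensorCoalgebraFiltration F)) m
    (deconcatenation_tensorSum_sub_mem F x m γ)
  rw [Submodule.mem_comap, map_sub, map_sum] at hsum
  have hterms := sum_sub_sum_mem (s := antidiagonal γ)
    (f := fun ab => tensorSeries F x ab.1 ⊗ₜ[k] tensorSeries F x ab.2)
    (g := fun ab => TensorProduct.map (toCompletion (tensorCoalgebraFiltration F))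
      (toCompletion (tensorCoalgebraFiltration F))
      (tensorSum k x m ab.1 ⊗ₜ[k] tensorSum k x m ab.2)) fun ab _ =>
    tmul_sub_tmul_mem htop htop (tensorSeries_sub_toCompletion_mem x m ab.1)
      (tensorSeries_sub_toCompletion_mem x m ab.2)
  have hadd := add_mem hterms hsum
  rwa [sub_add_sub_cancel] at hadd

theorem hasCogenerator_d_tensorSeries (γ : Γ) :
    HasCogenerator F ((completedTensorCoalgebra F).d (tensorSeries F x γ)) (curvature x A γ) := by
  intro m hm
  have hlevel := d_level (tensorSeries_level (F := F) x le_rfl γ) (m := m)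
  refine (congrArg (levelCogenerator F hm) hlevel).trans (congrArg (Submodule.mkQ _) ?_)
  rw [cogenerator_coderivation, cogeneratingMap_tensorSum x (by omega)]

theorem d_tensorSeries_recursion (m : ℕ) (γ : Γ) :
    ((completedTensorCoalgebra F).d (tensorSeries F x γ)).1 m =
      ∑ ab ∈ antidiagonal γ, levelMul F m (suspendedParity A (x ab.1))
        (((completedTensorCoalgebra F).d (tensorSeries F x ab.2)).1 m) +
      ∑ ab ∈ antidiagonal γ, levelMul F m (curvature x A ab.1) ((tensorSeries F x ab.2).1 m) := by
  have hlast : ∑ ab ∈ antidiagonal γ, TensorAlgebra.ι k (A.d (x ab.1)) * tensorPow k x m ab.2 ∈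
      (tensorCoalgebraFiltration F).F m :=
    Submodule.sum_mem _ fun ab _ => ι_mul_mem_tensorCoalgebraFiltration _
      (lengthFiltration_le m (tensorPow_mem_lengthFiltration x m ab.2))
  have hlevel (γ : Γ) := d_level (tensorSeries_level (F := F) x (le_refl (m + 1)) γ)
  rw [d_level (tensorSeries_level x (m + 1).le_succ γ), coderivation_tensorSum, map_sub,
    mkQ_eq_zero.2 hlast, sub_zero, map_add, map_sum, map_sum]
  simp only [hlevel]
  rfl

theorem d_tensorSeries_eq_zero {D : Set Γ}
    (hD : ∀ γ ∈ D, ∀ ab ∈ antidiagonal γ, ab.1 ∈ D ∧ ab.2 ∈ D)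
    (hx : ∀ γ ∈ D, curvature x A γ = 0) {γ : Γ} (hγ : γ ∈ D) :
    (completedTensorCoalgebra F).d (tensorSeries F x γ) = 0 :=
  completion_ext fun m _ => eq_zero_of_recursion (x := fun a => suspendedParity A (x a))
    (E := fun γ => ((completedTensorCoalgebra F).d (tensorSeries F x γ)).1 m)
    (fun γ hγ ab hab => (hD γ hγ ab hab).2) (fun γ hγ => by
      rw [d_tensorSeries_recursion, add_eq_left]
      exact sum_eq_zero fun ab hab => by
        rw [hx _ (hD γ hγ ab hab).1, map_zero, LinearMap.zero_apply]) hγ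

theorem eq_tensorSeries_of_comul {D : Set Γ}
    (hD : ∀ γ ∈ D, ∀ ab ∈ antidiagonal γ, ab.1 ∈ D ∧ ab.2 ∈ D) {H : Γ → CompletedTensorSpace F}
    (hcog : ∀ γ ∈ D, HasCogenerator F (H γ) (x γ))
    (hcounit : ∀ γ ∈ D, (completedTensorCoalgebra F).counit (H γ) = if γ = 0 then 1 else 0)
    (hcomul : ∀ γ ∈ D, (completedTensorCoalgebra F).comul (H γ) =
      toCompletion _ (∑ ab ∈ antidiagonal γ, H ab.1 ⊗ₜ[k] H ab.2)) {γ : Γ} (hγ : γ ∈ D) :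
    H γ = tensorSeries F x γ := by
  refine completion_ext fun m hm => sub_eq_zero.1 (eq_zero_of_recursion (x := x)
    (E := fun γ => (H γ).1 m - (tensorSeries F x γ).1 m)
    (fun γ hγ ab hab => (hD γ hγ ab hab).2) (fun γ hγ => ?_) hγ)
  have hfirst : levelFirst F hm (∑ ab ∈ antidiagonal γ, H ab.1 ⊗ₜ[k] H ab.2) =
      ∑ ab ∈ antidiagonal γ, levelMul F m (x ab.1) ((H ab.2).1 m) := by
    rw [map_sum]
    exact sum_congr rfl fun ab hab => levelFirst_tmul hm (hcog _ (hD γ hγ ab hab).1) _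
  rw [level_eq_of_comul (hcomul γ hγ) hm, hfirst, tensorSeries_recursion, hcounit γ hγ,
    apply_ite (algebraMap k (TensorAlgebra k L)), map_one, map_zero, add_sub_add_left_eq_sub,
    ← sum_sub_distrib]
  simp only [map_sub]

end TensorSeries

section GroupLike

variable {k : Type*} [Field k] {L : Type*} [AddCommGroup L] [Module k L] {A : DGLieAlgebra k L}
variable {F : CompleteFiltration A}

variable (F) in
theorem tensorSeries_const (p : L) (γ : PUnit) :
    tensorSeries F (fun _ => p) γ = groupLike F p :=
  tensorSeries_zero _

theorem hasCogenerator_groupLike (p : L) : HasCogenerator F (groupLike F p) p :=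
  tensorSeries_const F p 0 ▸ hasCogenerator_tensorSeries _ _

theorem eq_groupLike_of_comul {g : CompletedTensorSpace F} {p : L} (hcog : HasCogenerator F g p)
    (hcounit : (completedTensorCoalgebra F).counit g = 1)
    (hcomul : (completedTensorCoalgebra F).comul g = toCompletion _ (g ⊗ₜ[k] g)) :
    g = groupLike F p := by
  rw [← tensorSeries_const F p 0]
  exact eq_tensorSeries_of_comul (fun _ => p) (D := Set.univ) (H := fun _ => g)
    (fun _ _ _ _ => ⟨trivial, trivial⟩) (fun _ _ => hcog)
    (fun _ _ => hcounit.trans (if_pos rfl).symm)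
    (fun _ _ => hcomul.trans (congrArg _ (sum_singleton _ _).symm)) trivial

end GroupLike

/-! ### The unit interval coalgebra -/

section Interval

variable {k : Type*} [Field k]

variable (k) in
/-- The basis of the interval coalgebra: `t_i` at `(i, 0)` and `t_i u` at `(i, 1)`. Since `u² = 0`,
the remaining entries vanish. -/
def intervalElt (γ : ℕ × ℕ) : IntervalSpace k :=
  if γ.2 = 0 then tElt γ.1 else if γ.2 = 1 then tuElt γ.1 else 0

/-- The group-like element `∑ t_i` of the interval coalgebra, which is evaluation at `1`. -/
def intervalOne : IntervalSpace k := (fun _ => 1, 0)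

theorem intervalElt_mem_deg (γ : ℕ × ℕ) : intervalElt k γ ∈ (interval k).deg (-γ.2) := by
  rcases γ with ⟨n, _ | _ | e⟩
  · simp [intervalElt, interval, tElt]
  · simp [intervalElt, interval, tuElt]
  · exact zero_mem _

theorem counit_intervalElt (γ : ℕ × ℕ) :
    (interval k).counit (intervalElt k γ) = if γ = 0 then 1 else 0 := by
  rcases γ with ⟨_ | n, _ | _ | e⟩ <;> simp [intervalElt, interval, tElt, tuElt]

theorem d_tElt (n : ℕ) : (interval k).d (tElt n) = 0 :=
  Prod.ext (funext fun _ => mul_zero _) rfl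

theorem d_tuElt (n : ℕ) : (interval k).d (tuElt n) = ((n : k) + 1) • tElt (n + 1) := by
  refine Prod.ext (funext fun i => ?_) (by simp [interval, tElt])
  simp only [interval, tuElt, tElt, LinearMap.coe_mk, AddHom.coe_mk, Prod.smul_fst,
    Pi.smul_apply, smul_eq_mul]
  rcases i with _ | i
  · simp
  · by_cases hi : i = n
    · subst hi; simp
    · simp [hi]

theorem d_mem_intervalFiltration {p : ℕ} {a : IntervalSpace k}
    (ha : a ∈ (intervalFiltration k).F (p + 1)) :
    (interval k).d a ∈ (intervalFiltration k).F p := by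
  refine fun i hi => ⟨?_, rfl⟩
  change (i : k) * a.2 (i - 1) = 0
  rw [(ha (i - 1) (by omega)).2, mul_zero]

theorem comul_mem_completionFiltration {p : ℕ} {a : IntervalSpace k}
    (ha : a ∈ (intervalFiltration k).F p) : (interval k).comul a ∈
      (completionFiltration (tensorFiltration (intervalFiltration k) (intervalFiltration k))).F p :=
    by
  refine mkQ_eq_zero.2 (Submodule.sum_mem _ fun n hn => ?_)
  obtain ⟨h0, h1⟩ := ha n (mem_range.1 hn)
  have hterm : intervalComulTerm n a = 0 := by simp [intervalComulTerm, h0, h1]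
  exact hterm ▸ zero_mem _

theorem intervalComul_eq_toCompletion {a : IntervalSpace k} {n : ℕ}
    (h : ∀ r ≠ n, intervalComulTerm r a = 0) :
    intervalComul a = toCompletion _ (intervalComulTerm n a) := by
  refine Subtype.ext (funext fun p => mkQ_eq_mkQ.2 ?_)
  rw [sum_eq_ite n fun r _ hr => h r hr]
  split_ifs with hn
  · rw [sub_self]
    exact zero_mem _
  · rw [zero_sub, neg_mem_iff]
    exact (tensorFiltration _ _).anti (by simpa using hn) (intervalComulTerm_mem n a)

theorem comul_intervalElt {γ : ℕ × ℕ} (hγ : γ.2 ≤ 1) : (interval k).comul (intervalElt k γ) =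
    toCompletion _ (∑ ab ∈ antidiagonal γ, intervalElt k ab.1 ⊗ₜ[k] intervalElt k ab.2) := by
  obtain ⟨n, e⟩ := γ
  rcases Nat.le_one_iff_eq_zero_or_eq_one.1 hγ with rfl | rfl
  · rw [sum_antidiagonal_prod_zero]
    refine (intervalComul_eq_toCompletion (n := n) fun r hr => ?_).trans (congrArg _ ?_)
    · simp [intervalComulTerm, intervalElt, tElt, hr]
    · simp [intervalComulTerm, intervalElt, tElt]
  · rw [sum_antidiagonal_prod_one]
    refine (intervalComul_eq_toCompletion (n := n) fun r hr => ?_).trans (congrArg _ ?_)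
    · simp [intervalComulTerm, intervalElt, tuElt, hr]
    · simp [intervalComulTerm, intervalElt, tuElt, add_comm]

theorem sub_sum_mem_intervalFiltration (a : IntervalSpace k) (N : ℕ) :
    a - ∑ n ∈ range N, (a.1 n • tElt n + a.2 n • tuElt n) ∈ (intervalFiltration k).F N := by
  intro i hi
  simp [tElt, tuElt, Prod.fst_sum, Prod.snd_sum, Pi.single_apply, hi]

theorem intervalOne_sub_sum_mem (N : ℕ) :
    intervalOne - ∑ n ∈ range N, tElt n ∈ (intervalFiltration k).F N := by
  simpa [intervalOne] using sub_sum_mem_intervalFiltration (k := k) intervalOne N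

theorem comul_intervalOne :
    (interval k).comul intervalOne = toCompletion _ (intervalOne ⊗ₜ[k] intervalOne) := by
  have htop : (intervalFiltration k).F 0 = ⊤ :=
    eq_top_iff.2 fun _ _ i hi => absurd hi i.not_lt_zero
  refine Eq.symm (Subtype.ext (funext fun N => mkQ_eq_mkQ.2 ?_))
  have hsquare := tmul_sub_tmul_mem htop htop (intervalOne_sub_sum_mem (k := k) N)
    (intervalOne_sub_sum_mem N)
  have hsum := sum_range_sum_range_sub_mem
    ((tensorFiltration (intervalFiltration k) (intervalFiltration k)).F N)
    (fun i j => tElt i ⊗ₜ[k] tElt j) N fun i j hij =>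
      Submodule.subset_span ⟨i, j, hij, _, tElt_mem i, _, tElt_mem j, rfl⟩
  rw [TensorProduct.sum_tmul, sum_congr rfl fun i _ => TensorProduct.tmul_sum _ _ _] at hsquare
  have hadd := add_mem hsquare hsum
  rw [sub_add_sub_cancel] at hadd
  have hterm (n : ℕ) : intervalComulTerm n (intervalOne : IntervalSpace k) =
      ∑ ij ∈ antidiagonal n, tElt ij.1 ⊗ₜ[k] tElt ij.2 := by simp [intervalComulTerm, intervalOne]
  rwa [← sum_congr rfl fun n _ => hterm n] at hadd

theorem interval_hom_ext {M : Type*} [AddCommGroup M] [Module k M] {B : Filtration k M}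
    {f g : IntervalSpace k →ₗ[k] completion B}
    (hf : ∀ p, ∀ a ∈ (intervalFiltration k).F (p + 1), f a ∈ (completionFiltration B).F p)
    (hg : ∀ p, ∀ a ∈ (intervalFiltration k).F (p + 1), g a ∈ (completionFiltration B).F p)
    (h : ∀ γ : ℕ × ℕ, γ.2 ≤ 1 → f (intervalElt k γ) = g (intervalElt k γ)) : f = g := by
  refine LinearMap.ext fun a => Subtype.ext (funext fun p => sub_eq_zero.1 ?_)
  have ht (n : ℕ) : f (tElt n) = g (tElt n) := h (n, 0) zero_le_one
  have htu (n : ℕ) : f (tuElt n) = g (tuElt n) := h (n, 1) le_rfl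
  have hmem := sub_sum_mem_intervalFiltration a (p + 1)
  have hsub := sub_mem (hf p _ hmem) (hg p _ hmem)
  simp only [map_sub, map_sum, map_add, map_smul, ht, htu, sub_sub_sub_cancel_right] at hsub
  exact hsub

end Interval

/-! ### Paths and maps from the interval coalgebra -/

section Curvature

variable {k : Type*} [Field k] {L : Type*} [AddCommGroup L] [Module k L] {A : DGLieAlgebra k L}

theorem curvature_mem_deg {Γ : Type*} [AddCommMonoid Γ] [HasAntidiagonal Γ] {x : Γ → L}
    (e : Γ →+ ℕ) (hx : ∀ γ, x γ ∈ A.deg (1 - e γ)) (γ : Γ) :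
    curvature x A γ ∈ A.deg (2 - e γ) := by
  refine sub_mem (Submodule.smul_mem _ _ <| Submodule.sum_mem _ fun ab hab => ?_) ?_
  · rw [parity_of_mem _ _ (hx ab.1), map_zsmul, LinearMap.smul_apply]
    convert zsmul_mem (A.bracket_mem _ _ _ (hx ab.1) _ (hx ab.2)) _ using 2
    rw [← HasAntidiagonal.mem_antidiagonal.1 hab, map_add]
    push_cast
    ring
  · convert A.d_mem _ _ (hx γ) using 2
    ring

variable {x : ℕ × ℕ → L} (hx : ∀ γ, x γ ∈ A.deg (1 - γ.2))

include hx

theorem parity_of_snd_eq_zero (n : ℕ) : A.parity (x (n, 0)) = -x (n, 0) := by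
  simpa using parity_of_mem _ _ (hx (n, 0))

theorem parity_of_snd_eq_one (n : ℕ) : A.parity (x (n, 1)) = x (n, 1) := by
  simpa using parity_of_mem _ _ (hx (n, 1))

theorem curvature_zero (n : ℕ) : curvature x A (n, 0) = -(A.d (x (n, 0)) +
    (2 : k)⁻¹ • seriesBracket A.bracket (fun i => x (i, 0)) (fun i => x (i, 0)) n) := by
  rw [curvature, sum_antidiagonal_prod_zero]
  simp only [parity_of_snd_eq_zero hx, map_neg, LinearMap.neg_apply, sum_neg_distrib, smul_neg]
  rw [neg_add', sub_eq_add_neg, add_comm, ← sub_eq_add_neg]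
  rfl

theorem curvature_one [CharZero k] (n : ℕ) : curvature x A (n, 1) =
    seriesBracket A.bracket (fun i => x (i, 1)) (fun i => x (i, 0)) n - A.d (x (n, 1)) := by
  have hskew (i j : ℕ) : -A.bracket (x (i, 0)) (x (j, 1)) = A.bracket (x (j, 1)) (x (i, 0)) := by
    simpa using (A.bracket_skew _ _ _ (hx (j, 1)) _ (hx (i, 0))).symm
  have hswap : ∑ ij ∈ antidiagonal n, A.bracket (x (ij.2, 1)) (x (ij.1, 0)) =
      seriesBracket A.bracket (fun i => x (i, 1)) (fun i => x (i, 0)) n :=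
    sum_antidiagonal_swap (fun ij : ℕ × ℕ => A.bracket (x (ij.1, 1)) (x (ij.2, 0))) n
  rw [curvature, sum_antidiagonal_prod_one]
  simp only [parity_of_snd_eq_zero hx, parity_of_snd_eq_one hx, map_neg, LinearMap.neg_apply,
    hskew, sum_add_distrib]
  rw [hswap, seriesBracket, ← two_smul k, smul_smul, inv_mul_cancel₀ two_ne_zero, one_smul]

end Curvature

section FromMaps

variable {k : Type*} [Field k] {L : Type*} [AddCommGroup L] [Module k L]
variable {A : DGLieAlgebra k L} {F : CompleteFiltration A} {x : ℕ × ℕ → L}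

namespace FilteredMap

theorem map_intervalElt (h : FilteredMap (interval k) F)
    (hcog : ∀ γ, HasCogenerator F (h.toLin (intervalElt k γ)) (x γ)) {γ : ℕ × ℕ} (hγ : γ.2 ≤ 1) :
    h.toLin (intervalElt k γ) = tensorSeries F x γ := by
  refine eq_tensorSeries_of_comul x (D := {γ | γ.2 ≤ 1})
    (H := fun γ => h.toLin (intervalElt k γ)) (fun γ hγ ab hab => ?_) (fun γ _ => hcog γ)
    (fun γ _ => (h.map_counit _).trans (counit_intervalElt γ)) (fun γ hγ => ?_) hγ
  · have hsnd : ab.1.2 + ab.2.2 = γ.2 :=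
      congrArg Prod.snd (HasAntidiagonal.mem_antidiagonal.1 hab)
    exact ⟨(Nat.le_add_right _ _).trans (hsnd.trans_le hγ),
      (Nat.le_add_left _ _).trans (hsnd.trans_le hγ)⟩
  · rw [h.comul_eq_toCompletion (comul_intervalElt hγ), map_sum]
    rfl

theorem isPath [CharZero k] (h : FilteredMap (interval k) F)
    (hx : ∀ γ, x γ ∈ A.deg (1 - γ.2))
    (hcog : ∀ γ, HasCogenerator F (h.toLin (intervalElt k γ)) (x γ)) :
    IsPath F (fun n => x (n, 0)) (fun n => x (n, 1)) where
  P_deg n := by simpa using hx (n, 0)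
  P_mem n := (hcog (n, 0)).mem (h.filtered n _ (tElt_mem n))
  B_deg n := by simpa using hx (n, 1)
  B_mem n := (hcog (n, 1)).mem (h.filtered n _ (tuElt_mem n))
  maurerCartan n := by
    have hd := hasCogenerator_d_tensorSeries (F := F) x (n, 0)
    rw [← h.map_intervalElt hcog zero_le_one, ← h.map_d,
      show intervalElt k (n, 0) = tElt n from rfl, d_tElt, map_zero] at hd
    have hcurv := hd.unique (curvature_mem_deg (AddMonoidHom.snd ℕ ℕ) hx (n, 0)) (zero_mem _) .zero
    rwa [curvature_zero hx, neg_eq_zero] at hcurv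
  flow n := by
    have hd := hasCogenerator_d_tensorSeries (F := F) x (n, 1)
    rw [← h.map_intervalElt hcog le_rfl, ← h.map_d,
      show intervalElt k (n, 1) = tuElt n from rfl, d_tuElt, map_smul] at hd
    rw [← curvature_one hx]
    refine ((hcog (n + 1, 0)).smul _).unique (i := 1) (Submodule.smul_mem _ _ ?_) ?_ hd
    · simpa using hx (n + 1, 0)
    · simpa using curvature_mem_deg (AddMonoidHom.snd ℕ ℕ) hx (n, 1)

theorem pathJoins (h : FilteredMap (interval k) F) (hx : ∀ γ, x γ ∈ A.deg (1 - γ.2))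
    (hcog : ∀ γ, HasCogenerator F (h.toLin (intervalElt k γ)) (x γ)) {p q : L} (hp : p ∈ A.deg 1)
    (h0 : h.toLin (tElt 0) = groupLike F p) (h1 : h.toLin intervalOne = groupLike F q) :
    PathJoins F (fun n => x (n, 0)) p q where
  zero := (hcog (0, 0)).unique (i := 1) (by simpa using hx (0, 0)) hp
    (h0 ▸ hasCogenerator_groupLike p : HasCogenerator F (h.toLin (tElt 0)) p)
  sum m := by
    refine ⟨m, fun n hn => F.anti hn ?_⟩
    have hq : HasCogenerator F (h.toLin intervalOne) q := h1 ▸ hasCogenerator_groupLike q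
    have hsub := hq.sub (.sum (range n) fun i => hcog (i, 0))
    rw [← map_sum, ← map_sub] at hsub
    rw [← neg_mem_iff, neg_sub]
    exact hsub.mem (h.filtered n _ (intervalOne_sub_sum_mem n))

theorem exists_path [CharZero k] (h : FilteredMap (interval k) F) {p q : L} (hp : p ∈ A.deg 1)
    (h0 : h.toLin (tElt 0) = groupLike F p) (h1 : h.toLin intervalOne = groupLike F q) :
    ∃ P B : ℕ → L, IsPath F P B ∧ PathJoins F P p q := by
  choose x hx hcog using fun γ =>
    exists_hasCogenerator (h.map_deg _ _ (intervalElt_mem_deg (k := k) γ))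
  simp only [neg_add_eq_sub] at hx
  exact ⟨_, _, h.isPath hx hcog, h.pathJoins hx hcog hp h0 h1⟩

end FilteredMap

end FromMaps

section ToMaps

variable {k : Type*} [Field k] {L : Type*} [AddCommGroup L] [Module k L]
variable {A : DGLieAlgebra k L} {F : CompleteFiltration A}

section Differential

variable {x : ℕ × ℕ → L} (hx : ∀ γ, x γ ∈ A.deg (1 - γ.2))
  (h : IsPath F (fun n => x (n, 0)) (fun n => x (n, 1)))

include hx h

theorem d_tensorSeries_of_snd_eq_zero (n : ℕ) :
    (completedTensorCoalgebra F).d (tensorSeries F x (n, 0)) = 0 := by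
  refine d_tensorSeries_eq_zero x (D := {γ | γ.2 = 0}) (fun γ hγ ab hab => ?_) ?_ rfl
  · have hsnd : ab.1.2 + ab.2.2 = γ.2 :=
      congrArg Prod.snd (HasAntidiagonal.mem_antidiagonal.1 hab)
    exact Nat.add_eq_zero_iff.1 (hsnd.trans hγ)
  · rintro ⟨i, _⟩ rfl
    rw [curvature_zero hx, h.maurerCartan, neg_zero]

theorem d_tensorSeries_of_snd_eq_one [CharZero k] (n : ℕ) :
    (completedTensorCoalgebra F).d (tensorSeries F x (n, 1)) =
      ((n : k) + 1) • tensorSeries F x (n + 1, 0) := by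
  refine completion_ext fun m _ => sub_eq_zero.1 <| eq_zero_of_recursion
    (x := fun i => x (i, 0)) (D := Set.univ) (E := fun n =>
      ((completedTensorCoalgebra F).d (tensorSeries F x (n, 1))).1 m -
        ((n : k) + 1) • (tensorSeries F x (n + 1, 0)).1 m)
    (fun _ _ _ _ => trivial) (fun n _ => ?_) (Set.mem_univ n)
  have hd : ((completedTensorCoalgebra F).d (tensorSeries F x (n, 1))).1 m =
      ∑ ij ∈ antidiagonal n, (levelMul F m (x (ij.1, 0))
        (((completedTensorCoalgebra F).d (tensorSeries F x (ij.2, 1))).1 m) +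
          levelMul F m (curvature x A (ij.1, 1)) ((tensorSeries F x (ij.2, 0)).1 m)) := by
    have hparity (i : ℕ) : suspendedParity A (x (i, 0)) = x (i, 0) := by
      rw [suspendedParity, LinearMap.neg_apply, parity_of_snd_eq_zero hx, neg_neg]
    have hcurv (i : ℕ) : curvature x A (i, 0) = 0 := by
      rw [curvature_zero hx, h.maurerCartan, neg_zero]
    have hzero : (0 : CompletedTensorSpace F).1 m = 0 := rfl
    simp only [d_tensorSeries_recursion x m (n, 1), sum_antidiagonal_prod_one, hparity, hcurv,
      d_tensorSeries_of_snd_eq_zero hx h, hzero, map_zero, LinearMap.zero_apply, add_zero,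
      zero_add, sum_add_distrib]
  have hS : ((n : k) + 1) • (tensorSeries F x (n + 1, 0)).1 m =
      ∑ ij ∈ antidiagonal n, (levelMul F m (curvature x A (ij.1, 1))
        ((tensorSeries F x (ij.2, 0)).1 m) + levelMul F m (x (ij.1, 0))
          (((ij.2 : k) + 1) • (tensorSeries F x (ij.2 + 1, 0)).1 m)) := by
    rw [tensorSeries_recursion, if_neg (by simp), map_zero, zero_add, sum_antidiagonal_prod_zero,
      succ_smul_sum_antidiagonal_succ
        (fun i j => levelMul F m (x (i, 0)) ((tensorSeries F x (j, 0)).1 m))]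
    simp only [curvature_one hx, ← h.flow, map_smul, LinearMap.smul_apply]
  rw [hd, hS, ← sum_sub_distrib]
  exact sum_congr rfl fun ij _ => by rw [map_sub]; abel

end Differential

/-- The path `P`, `B` as a family indexed by the basis of the interval coalgebra: `P_i` at `(i, 0)`
and `B_i` at `(i, 1)`. -/
def pathFamily (P B : ℕ → L) (γ : ℕ × ℕ) : L :=
  if γ.2 = 0 then P γ.1 else if γ.2 = 1 then B γ.1 else 0

variable {P B : ℕ → L} (h : IsPath F P B)

include h in
theorem pathFamily_mem (γ : ℕ × ℕ) : pathFamily P B γ ∈ F.F γ.1 := by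
  rw [pathFamily]
  split_ifs
  exacts [h.P_mem _, h.B_mem _, zero_mem _]

include h in
theorem pathFamily_mem_deg (γ : ℕ × ℕ) : pathFamily P B γ ∈ A.deg (1 - γ.2) := by
  rcases γ with ⟨n, _ | _ | e⟩
  · simpa [pathFamily] using h.P_deg n
  · simpa [pathFamily] using h.B_deg n
  · exact zero_mem _

include h in
theorem tensorSeries_pathFamily_mem (γ : ℕ × ℕ) : tensorSeries F (pathFamily P B) γ ∈
    (completionFiltration (tensorCoalgebraFiltration F)).F γ.1 :=
  tensorSeries_mem_completionFiltration (AddMonoidHom.fst ℕ ℕ) (pathFamily_mem h) γ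

/-- The linear map from the interval coalgebra that sends the basis to the geometric series of a
path. -/
def pathLinearMap : IntervalSpace k →ₗ[k] CompletedTensorSpace F :=
  (seriesMap fun n => tensorSeries_pathFamily_mem h (n, 0)).coprod
    (seriesMap fun n => tensorSeries_pathFamily_mem h (n, 1))

theorem pathLinearMap_apply (a : IntervalSpace k) : pathLinearMap h a =
    seriesMap (fun n => tensorSeries_pathFamily_mem h (n, 0)) a.1 +
      seriesMap (fun n => tensorSeries_pathFamily_mem h (n, 1)) a.2 :=
  rfl

theorem pathLinearMap_intervalElt {γ : ℕ × ℕ} (hγ : γ.2 ≤ 1) :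
    pathLinearMap h (intervalElt k γ) = tensorSeries F (pathFamily P B) γ := by
  obtain ⟨n, e⟩ := γ
  rcases Nat.le_one_iff_eq_zero_or_eq_one.1 hγ with rfl | rfl
  · rw [pathLinearMap_apply, show (intervalElt k (n, 0)).1 = Pi.single n 1 from rfl,
      show (intervalElt k (n, 0)).2 = 0 from rfl, map_zero, add_zero, seriesMap_single]
  · rw [pathLinearMap_apply, show (intervalElt k (n, 1)).1 = 0 from rfl,
      show (intervalElt k (n, 1)).2 = Pi.single n 1 from rfl, map_zero, zero_add, seriesMap_single]

theorem pathLinearMap_level (a : IntervalSpace k) (m : ℕ) : (pathLinearMap h a).1 m =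
    ∑ n ∈ range m, (a.1 n • (tensorSeries F (pathFamily P B) (n, 0)).1 m +
      a.2 n • (tensorSeries F (pathFamily P B) (n, 1)).1 m) := by
  rw [sum_add_distrib]
  rfl

theorem pathLinearMap_mem {p : ℕ} {a : IntervalSpace k} (ha : a ∈ (intervalFiltration k).F p) :
    pathLinearMap h a ∈ (completionFiltration (tensorCoalgebraFiltration F)).F p :=
  (pathLinearMap_level h a p).trans <| sum_eq_zero fun n hn => by
    rw [(ha n (mem_range.1 hn)).1, (ha n (mem_range.1 hn)).2, zero_smul, zero_smul, add_zero]

theorem pathLinearMap_mem_completionClosure {S : Submodule k (TensorAlgebra k L)}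
    {a : IntervalSpace k}
    (h0 : ∀ n, a.1 n • tensorSeries F (pathFamily P B) (n, 0) ∈ completionClosure _ S)
    (h1 : ∀ n, a.2 n • tensorSeries F (pathFamily P B) (n, 1) ∈ completionClosure _ S) :
    pathLinearMap h a ∈ completionClosure _ S :=
  add_mem (seriesMap_mem_completionClosure (fun n => tensorSeries_pathFamily_mem h (n, 0)) h0)
    (seriesMap_mem_completionClosure (fun n => tensorSeries_pathFamily_mem h (n, 1)) h1)

theorem pathLinearMap_mem_deg {i : ℤ} {a : IntervalSpace k} (ha : a ∈ (interval k).deg i) :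
    pathLinearMap h a ∈ (completedTensorCoalgebra F).deg i := by
  have hdeg (γ : ℕ × ℕ) := tensorSeries_mem_completionClosure (F := F) (γ := γ)
    fun r => tensorPow_mem_tensorDeg (AddMonoidHom.snd ℕ ℕ) (pathFamily_mem_deg h) r γ
  change a ∈ (ite _ _ (ite _ _ _) : Submodule k (IntervalSpace k)) at ha
  split_ifs at ha with hi hi
  · have ha2 : a.2 = 0 := ha
    refine pathLinearMap_mem_completionClosure h (S := tensorDeg A i) (fun n => ?_) fun n => ?_
    · exact Submodule.smul_mem _ _ (by simpa [hi] using hdeg (n, 0))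
    · rw [ha2, Pi.zero_apply, zero_smul]
      exact zero_mem _
  · have ha1 : a.1 = 0 := ha
    refine pathLinearMap_mem_completionClosure h (S := tensorDeg A i) (fun n => ?_) fun n => ?_
    · rw [ha1, Pi.zero_apply, zero_smul]
      exact zero_mem _
    · exact Submodule.smul_mem _ _ (by simpa [hi] using hdeg (n, 1))
  · rw [(Submodule.mem_bot k).1 ha, map_zero]
    exact zero_mem _

theorem cogeneratorMem_pathLinearMap {p : ℕ} {a : IntervalSpace k}
    (ha : a ∈ (intervalFiltration k).F p) : CogeneratorMem F p (pathLinearMap h a) := by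
  have hmem (c : k) (γ : ℕ × ℕ) (hc : γ.1 < p → c = 0) : c • tensorSeries F (pathFamily P B) γ ∈
      completionClosure (tensorCoalgebraFiltration F) ((F.F p).comap (cogenerator k L)) := by
    by_cases hγ : γ.1 < p
    · rw [hc hγ, zero_smul]
      exact zero_mem _
    · exact Submodule.smul_mem _ _
        (cogeneratorMem_tensorSeries (F.anti (not_lt.1 hγ) (pathFamily_mem h γ)))
  exact pathLinearMap_mem_completionClosure h (S := (F.F p).comap (cogenerator k L))
    (fun n => hmem _ (n, 0) fun hn => (ha n hn).1) fun n => hmem _ (n, 1) fun hn => (ha n hn).2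

theorem memC_pathLinearMap [CharZero k] (a : IntervalSpace k) : MemC F (pathLinearMap h a) := by
  have hmem {γ : ℕ × ℕ} (hγ : γ.2 ≤ 1) := tensorSeries_mem_completionClosure (F := F)
    fun r => tensorPow_mem_symmetricTensors (AddMonoidHom.snd ℕ ℕ) (pathFamily_mem_deg h) r hγ
  exact pathLinearMap_mem_completionClosure h (S := symmetricTensors A)
    (fun n => Submodule.smul_mem _ _ (hmem zero_le_one))
    fun n => Submodule.smul_mem _ _ (hmem le_rfl)

theorem pathLinearMap_d [CharZero k] (a : IntervalSpace k) : pathLinearMap h ((interval k).d a) =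
    (completedTensorCoalgebra F).d (pathLinearMap h a) := by
  refine LinearMap.congr_fun (f := pathLinearMap h ∘ₗ (interval k).d)
    (g := (completedTensorCoalgebra F).d ∘ₗ pathLinearMap h) (interval_hom_ext (fun p a ha => ?_)
      (fun p a ha => ?_) fun γ hγ => ?_) a
  · exact pathLinearMap_mem h (d_mem_intervalFiltration ha)
  · exact completionMap_mem (coderivation_mem F) (pathLinearMap_mem h ha)
  · obtain ⟨n, e⟩ := γ
    rw [LinearMap.comp_apply, LinearMap.comp_apply, pathLinearMap_intervalElt h hγ]
    rcases Nat.le_one_iff_eq_zero_or_eq_one.1 hγ with rfl | rfl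
    · rw [d_tensorSeries_of_snd_eq_zero (pathFamily_mem_deg h) h, intervalElt, if_pos rfl, d_tElt,
        map_zero]
    · rw [d_tensorSeries_of_snd_eq_one (pathFamily_mem_deg h) h, ← pathLinearMap_intervalElt h
        zero_le_one, ← map_smul]
      exact congrArg (pathLinearMap h) (d_tuElt n)

theorem pathLinearMap_counit (a : IntervalSpace k) :
    (completedTensorCoalgebra F).counit (pathLinearMap h a) = (interval k).counit a := by
  have hlevel : (pathLinearMap h a).1 1 = Submodule.mkQ _
      (a.1 0 • tensorSum k (pathFamily P B) 1 (0, 0) +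
        a.2 0 • tensorSum k (pathFamily P B) 1 (0, 1)) :=
    (pathLinearMap_level h a 1).trans (sum_range_one _)
  rw [counit_level le_rfl hlevel, map_add, map_smul, map_smul, counit_tensorSum _ one_ne_zero,
    counit_tensorSum _ one_ne_zero]
  simp [interval]

theorem map_pathLinearMap_sum_intervalElt {γ : ℕ × ℕ} (hγ : γ.2 ≤ 1) :
    TensorProduct.map (pathLinearMap h) (pathLinearMap h)
      (∑ ab ∈ antidiagonal γ, intervalElt k ab.1 ⊗ₜ[k] intervalElt k ab.2) =
    ∑ ab ∈ antidiagonal γ,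
      tensorSeries F (pathFamily P B) ab.1 ⊗ₜ[k] tensorSeries F (pathFamily P B) ab.2 := by
  rw [map_sum]
  refine sum_congr rfl fun ab hab => ?_
  have hsnd : ab.1.2 + ab.2.2 = γ.2 :=
    congrArg Prod.snd (HasAntidiagonal.mem_antidiagonal.1 hab)
  rw [TensorProduct.map_tmul, pathLinearMap_intervalElt h (by omega),
    pathLinearMap_intervalElt h (by omega)]

theorem pathLinearMap_comul (a : IntervalSpace k) :
    completedSquare _ _ (pathLinearMap h) (fun _ _ => pathLinearMap_mem h)
      ((interval k).comul a) = (completedTensorCoalgebra F).comul (pathLinearMap h a) := by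
  refine LinearMap.congr_fun (f := completedSquare _ _ (pathLinearMap h)
      (fun _ _ => pathLinearMap_mem h) ∘ₗ (interval k).comul)
    (g := (completedTensorCoalgebra F).comul ∘ₗ pathLinearMap h) (interval_hom_ext
      (fun p a ha => ?_) (fun p a ha => ?_) fun γ hγ => ?_) a
  · exact completionMap_mem _ (comul_mem_completionFiltration
      ((intervalFiltration k).anti p.le_succ ha))
  · exact completionMap_mem _ (pathLinearMap_mem h ((intervalFiltration k).anti p.le_succ ha))
  · exact (congrArg (completedSquare _ _ (pathLinearMap h) fun _ _ => pathLinearMap_mem h)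
      (comul_intervalElt hγ)).trans <| (completedSquare_toCompletion _ _).trans <|
      (congrArg (toCompletion _) (map_pathLinearMap_sum_intervalElt h hγ)).trans <|
      (comul_tensorSeries _ γ).symm.trans
        (congrArg (completedTensorCoalgebra F).comul (pathLinearMap_intervalElt h hγ).symm)

/-- The filtered map from the interval coalgebra that a path defines. -/
def pathMap [CharZero k] : FilteredMap (interval k) F where
  toLin := pathLinearMap h
  map_deg _ _ := pathLinearMap_mem_deg h
  map_fil _ _ := pathLinearMap_mem h
  map_d := pathLinearMap_d h
  map_counit := pathLinearMap_counit h
  map_comul := pathLinearMap_comul h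
  mem_C := memC_pathLinearMap h
  filtered _ _ := cogeneratorMem_pathLinearMap h

theorem pathMap_tElt_zero [CharZero k] : (pathMap h).toLin (tElt 0) = groupLike F (P 0) :=
  (pathLinearMap_intervalElt h (γ := 0) zero_le_one).trans (tensorSeries_zero _)

theorem hasCogenerator_pathLinearMap_intervalOne {q : L} (hq : SumsTo F P q) :
    HasCogenerator F (pathLinearMap h intervalOne) q := by
  intro m hm
  have hlevel : levelProj F m (pathLinearMap h intervalOne) =
      ∑ n ∈ range m, levelProj F m (tensorSeries F (pathFamily P B) (n, 0)) := by
    refine (pathLinearMap_level h _ m).trans ?_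
    simp only [intervalOne, one_smul, Pi.zero_apply, zero_smul, add_zero]
    rfl
  rw [hlevel, map_sum, sum_congr rfl fun n _ => hasCogenerator_tensorSeries _ (n, 0) m hm,
    ← map_sum]
  exact mkQ_eq_mkQ.2 (hq.sub_mem h.P_mem m)

theorem pathMap_intervalOne [CharZero k] {q : L} (hq : SumsTo F P q) :
    (pathMap h).toLin intervalOne = groupLike F q :=
  eq_groupLike_of_comul (hasCogenerator_pathLinearMap_intervalOne h hq)
    ((pathMap h).map_counit _) ((pathMap h).comul_eq_toCompletion comul_intervalOne)

end ToMaps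

/-! ### Classifying maps and homotopy classes -/

section Classification

variable {k : Type*} [Field k] {L : Type*} [AddCommGroup L] [Module k L]
variable {A : DGLieAlgebra k L} {F : CompleteFiltration A}

theorem FilteredMap.point_ext {f g : FilteredMap (point k) F} (h : f.toLin 1 = g.toLin 1) :
    f = g := by
  have hlin : f.toLin = g.toLin := LinearMap.ext_ring h
  obtain ⟨⟨f, _, _, _, _, _⟩, _, _⟩ := f
  obtain ⟨⟨g, _, _, _, _, _⟩, _, _⟩ := g
  cases hlin
  rfl

theorem pointFiltration_le_comap {M : Type*} [AddCommGroup M] [Module k M] {B : Filtration k M}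
    (hB : B.F 0 = ⊤) (f : k →ₗ[k] M) (p : ℕ) : (pointFiltration k).F p ≤ (B.F p).comap f := by
  intro c hc
  change c ∈ (ite _ _ _ : Submodule k k) at hc
  split_ifs at hc with hp
  · exact hp ▸ hB ▸ Submodule.mem_top
  · rw [(Submodule.mem_bot k).1 hc]
    exact zero_mem _

theorem curvature_const {p : L} (hp : p ∈ A.deg 1) (γ : PUnit) :
    curvature (fun _ => p) A γ = -(A.d p + (2 : k)⁻¹ • A.bracket p p) := by
  have hparity : A.parity p = -p := by simpa using parity_of_mem _ _ hp
  have hsum : ∑ _ ∈ antidiagonal γ, A.bracket (A.parity p) p = -A.bracket p p := by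
    rw [hparity, map_neg, LinearMap.neg_apply]
    exact sum_singleton _ _
  rw [curvature, hsum, smul_neg]
  abel

section GroupLike

variable {p : L} (hp : p ∈ A.deg 1)

include hp

theorem groupLike_mem_deg : groupLike F p ∈ (completedTensorCoalgebra F).deg 0 := by
  rw [← tensorSeries_const F p 0]
  exact tensorSeries_mem_completionClosure fun r => by
    simpa using tensorPow_mem_tensorDeg (A := A) (x := fun _ : PUnit => p) 0
      (fun _ => by simpa using hp) r 0

theorem memC_groupLike [CharZero k] : MemC F (groupLike F p) := by
  rw [← tensorSeries_const F p 0]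
  exact tensorSeries_mem_completionClosure fun r =>
    tensorPow_mem_symmetricTensors (A := A) (x := fun _ : PUnit => p) 0
      (fun _ => by simpa using hp) r zero_le_one

theorem hasCogenerator_d_groupLike : HasCogenerator F
    ((completedTensorCoalgebra F).d (groupLike F p)) (-(A.d p + (2 : k)⁻¹ • A.bracket p p)) := by
  rw [← curvature_const hp 0, ← tensorSeries_const F p 0]
  exact hasCogenerator_d_tensorSeries _ _

end GroupLike

theorem d_groupLike (p : MaurerCartan A) :
    (completedTensorCoalgebra F).d (groupLike F p.1) = 0 := by
  rw [← tensorSeries_const F p.1 0]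
  refine d_tensorSeries_eq_zero _ (D := Set.univ) (fun _ _ _ _ => ⟨trivial, trivial⟩)
    (fun γ _ => ?_) trivial
  rw [curvature_const p.2.1, p.2.2, neg_zero]

theorem counit_groupLike (p : L) : (completedTensorCoalgebra F).counit (groupLike F p) = 1 := by
  rw [← tensorSeries_const F p 0, counit_tensorSeries]
  exact if_pos rfl

theorem comul_groupLike (p : L) : (completedTensorCoalgebra F).comul (groupLike F p) =
    toCompletion _ (groupLike F p ⊗ₜ[k] groupLike F p) := by
  have h := comul_tensorSeries (F := F) (fun _ : PUnit => p) 0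
  simp only [tensorSeries_const] at h
  exact h.trans (congrArg _ (sum_singleton _ _))

theorem cogeneratorMem_groupLike (p : L) : CogeneratorMem F 0 (groupLike F p) := by
  rw [← tensorSeries_const F p 0]
  exact cogeneratorMem_tensorSeries (F.F_zero ▸ Submodule.mem_top)

/-- The classifying map `χ(p)`. -/
def classifyingMap [CharZero k] (F : CompleteFiltration A) (p : MaurerCartan A) :
    FilteredMap (point k) F where
  toLin := LinearMap.toSpanSingleton k _ (groupLike F p.1)
  map_deg i c hc := by
    change c ∈ (ite _ _ _ : Submodule k k) at hc
    split_ifs at hc with hi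
    · exact hi ▸ Submodule.smul_mem _ c (groupLike_mem_deg p.2.1)
    · rw [(Submodule.mem_bot k).1 hc, map_zero]
      exact zero_mem _
  map_fil := pointFiltration_le_comap
    (completionFiltration_zero (tensorCoalgebraFiltration_zero (F := F))) _
  map_d c := by
    change _ = (completedTensorCoalgebra F).d (c • groupLike F p.1)
    rw [map_smul, d_groupLike, smul_zero]
    exact map_zero _
  map_counit c := (LinearMap.map_smul _ c _).trans <|
    (congrArg (c • ·) (counit_groupLike p.1)).trans (mul_one c)
  map_comul := LinearMap.congr_fun (f := completedSquare _ _ _ (pointFiltration_le_comap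
      (completionFiltration_zero (tensorCoalgebraFiltration_zero (F := F))) _) ∘ₗ (point k).comul)
    (g := (completedTensorCoalgebra F).comul ∘ₗ _) <| LinearMap.ext_ring <| by
      have hone : LinearMap.toSpanSingleton k _ (groupLike F p.1) 1 = groupLike F p.1 :=
        one_smul k _
      exact (congrArg (toCompletion _) (congrArg₂ (TensorProduct.tmul k) hone hone)).trans
        ((comul_groupLike p.1).symm.trans (congrArg _ hone.symm))
  mem_C c := Submodule.smul_mem (completionClosure _ (symmetricTensors A)) c
    (memC_groupLike p.2.1)
  filtered q c hc := by
    change c ∈ (ite _ _ _ : Submodule k k) at hc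
    change c • groupLike F p.1 ∈
      completionClosure _ ((F.F q).comap (cogenerator k L))
    split_ifs at hc with hq
    · exact hq ▸ Submodule.smul_mem _ c (cogeneratorMem_groupLike p.1)
    · rw [(Submodule.mem_bot k).1 hc, zero_smul]
      exact zero_mem _

theorem isClassifyingMap_classifyingMap [CharZero k] (p : MaurerCartan A) :
    IsClassifyingMap p (classifyingMap F p) :=
  one_smul k _

theorem FilteredMap.exists_isClassifyingMap (f : FilteredMap (point k) F) :
    ∃ p, IsClassifyingMap p f := by
  have hdeg : (1 : k) ∈ (point k).deg 0 := Submodule.mem_top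
  obtain ⟨p, hp, hcog⟩ := exists_hasCogenerator (f.map_deg 0 1 hdeg)
  rw [zero_add] at hp
  have hgroup : f.toLin 1 = groupLike F p := eq_groupLike_of_comul hcog (f.map_counit 1)
    (f.comul_eq_toCompletion (c := 1) (z := 1 ⊗ₜ[k] 1) rfl)
  have hd := hasCogenerator_d_groupLike (F := F) hp
  rw [← hgroup, ← f.map_d, show (point k).d 1 = 0 from rfl, map_zero] at hd
  have hcurv : -(A.d p + (2 : k)⁻¹ • A.bracket p p) ∈ A.deg 2 :=
    neg_mem (add_mem (A.d_mem _ _ hp) (Submodule.smul_mem _ _ (A.bracket_mem _ _ _ hp _ hp)))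
  exact ⟨⟨p, hp, neg_eq_zero.1 (hd.unique hcurv (zero_mem _) .zero)⟩, hgroup⟩

variable [CharZero k]

theorem homotopic_iff {p q : MaurerCartan A} {f g : FilteredMap (point k) F}
    (hf : IsClassifyingMap p f) (hg : IsClassifyingMap q g) :
    Homotopic f g ↔ GaugeEquivalent F p q := by
  rw [gaugeEquivalent_iff_exists_path]
  constructor
  · rintro ⟨h, h0, h1⟩
    exact h.exists_path p.2.1 (h0.trans hf) (h1.trans hg)
  · rintro ⟨P, B, hP, hpq⟩
    exact ⟨pathMap hP, (pathMap_tElt_zero hP).trans (hpq.zero ▸ hf.symm),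
      (pathMap_intervalOne hP hpq.sum).trans hg.symm⟩

theorem homotopic_equivalence (F : CompleteFiltration A) : Equivalence (Homotopic (F := F)) := by
  have hgauge := gaugeEquivalent_equivalence F
  refine ⟨fun f => ?_, fun {f g} hfg => ?_, fun {f g e} hfg hge => ?_⟩
  · obtain ⟨p, hp⟩ := f.exists_isClassifyingMap
    exact (homotopic_iff hp hp).2 (hgauge.refl p)
  · obtain ⟨p, hp⟩ := f.exists_isClassifyingMap
    obtain ⟨q, hq⟩ := g.exists_isClassifyingMap
    exact (homotopic_iff hq hp).2 (hgauge.symm ((homotopic_iff hp hq).1 hfg))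
  · obtain ⟨p, hp⟩ := f.exists_isClassifyingMap
    obtain ⟨q, hq⟩ := g.exists_isClassifyingMap
    obtain ⟨r, hr⟩ := e.exists_isClassifyingMap
    exact (homotopic_iff hp hr).2
      (hgauge.trans ((homotopic_iff hp hq).1 hfg) ((homotopic_iff hq hr).1 hge))

/-- The map from the moduli set to homotopy classes induced by `p ↦ χ(p)`. -/
def classifyingClass (F : CompleteFiltration A) : ModuliSet F → HomotopyClasses F :=
  Quot.map (classifyingMap F) fun p q h =>
    (homotopic_iff (isClassifyingMap_classifyingMap p) (isClassifyingMap_classifyingMap q)).2 h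

theorem classifyingClass_bijective (F : CompleteFiltration A) :
    Function.Bijective (classifyingClass F) := by
  constructor
  · rintro ⟨p⟩ ⟨q⟩ h
    have hpq := (homotopic_equivalence F).eqvGen_iff.1 (Quot.eqvGen_exact h)
    exact Quot.sound ((homotopic_iff (isClassifyingMap_classifyingMap p)
      (isClassifyingMap_classifyingMap q)).1 hpq)
  · rintro ⟨f⟩
    obtain ⟨p, hp⟩ := f.exists_isClassifyingMap
    exact ⟨Quot.mk _ p, congrArg (Quot.mk _)
      (FilteredMap.point_ext ((isClassifyingMap_classifyingMap p).trans hp.symm))⟩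

end Classification

end HomotopyModuli

end

theorem mainTheorem3 {k : Type*} [Field k] [CharZero k] {L : Type*} [AddCommGroup L] [Module k L]
    (A : HomotopyModuli.DGLieAlgebra k L) (F : HomotopyModuli.CompleteFiltration A) :
    Equivalence (HomotopyModuli.GaugeEquivalent F) ∧
    Equivalence (HomotopyModuli.Homotopic (F := F)) ∧
    ∃ Φ : HomotopyModuli.ModuliSet F → HomotopyModuli.HomotopyClasses F,
      Function.Bijective Φ ∧
      ∀ p : HomotopyModuli.MaurerCartan A,
        ∃ f : HomotopyModuli.FilteredMap (HomotopyModuli.point k) F,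
          HomotopyModuli.IsClassifyingMap p f ∧ Φ (Quot.mk _ p) = Quot.mk _ f :=
  ⟨HomotopyModuli.gaugeEquivalent_equivalence F, HomotopyModuli.homotopic_equivalence F,
    HomotopyModuli.classifyingClass F, HomotopyModuli.classifyingClass_bijective F,
    fun p => ⟨HomotopyModuli.classifyingMap F p,
      HomotopyModuli.isClassifyingMap_classifyingMap p, rfl⟩⟩
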